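/- Let $m\ge 1$, $n\ge 0$, let $\pi\colon E\to M$ be a surjective submersion of smooth manifolds, $\dim M=m$, $\dim E=m+n$, let $\eta$ be a volume form on $M$, and let $\mathcal L=L\eta\colon J^1\pi\to\Lambda^mM$ be a Lagrangian density, i.e. a fibered map over $M$ with $L\colon J^1\pi\to\mathbb R$ smooth; write $\pi_1\colon J^1\pi\to M$ for the projection and $d\mathcal L=dL\wedge\pi_1^*\eta$. Notation. $(x^i,u^\alpha)$ denote fibered coordinates of $\pi$, $d^mx=dx^1\wedge\dots\wedge dx^m$, $d^{m-1}x_i=i_{\partial/\partial x^i}d^mx$, $(x^i,u^\alpha,u^\alpha_i)$ are the induced coordinates of $J^1\pi$, and $L_{\rm loc}(x^i,u^\alpha,u^\alpha_i)$ is the local function with $\mathcal L=L_{\rm loc}\,d^mx$ (so $L_{\rm loc}=L$ if $\eta=d^mx$). For a map to $M$, $\Lambda^k_2$ denotes the bundle of $k$-forms that vanish when two arguments are vertical. $\mathcal M\pi=\Lambda^m_2E\xrightarrow{\nu}E$ has coordinates $(x^i,u^\alpha,p,p^i_\alpha)$, standing for $p\,d^mx+p^i_\alpha\,du^\alpha\wedge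 d^{m-1}x_i$, and $J^1(\pi\circ\nu)$ has the coordinates $(x^i,u^\alpha,p,p^i_\alpha,u^\alpha_j,p_j,p^i_{\alpha j})$. A local section $\sigma$ of $\pi$ solves the Euler-Lagrange equations if in all fibered coordinates $$\frac{\partial L_{\rm loc}}{\partial u^\alpha}-\frac{d}{dx^i}\frac{\partial L_{\rm loc}}{\partial u^\alpha_i}=0\quad(1\le\alpha\le n)\quad\text{along } j^1\sigma .$$ $\mathrm{Leg}_{\mathcal L}\colon J^1\pi\to\mathcal M\pi$ is the extended Legendre transform, given by the Poincaré-Cartan form; in coordinates $p=L_{\rm loc}-u^\alpha_i\,\partial L_{\rm loc}/\partial u^\alpha_i$, $p^i_\alpha=\partial L_{\rm loc}/\partial u^\alpha_i$. The Tulczyjew morphism $A^\eta_\pi\colon J^1(\pi\circ\nu)\to\Lambda^{m+1}_2J^1\pi$ is the map over the identity of $J^1\pi$ which in coordinates is $$(x^i,u^\alpha,p,p^i_\alpha,u^\alpha_j,p_j,p^i_{\alpha j})\mapsto(p^i_{\alpha i}\,du^\alpha+p^i_\alpha\,du^\alpha_i)\wedge d^mx .$$ Let $\widetilde\Omega=(A^\eta_\pi)^*\Omega$,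 where $\Omega=-d\Theta$ is the canonical multisymplectic form of $\Lambda^{m+1}_2J^1\pi$ ($\Theta$ the tautological form), and $S_{\mathcal L}=(A^\eta_\pi)^{-1}(d\mathcal L(J^1\pi))\subset J^1(\pi\circ\nu)$. A submanifold $S$ is called $(m+1)$-Lagrangian for $\widetilde\Omega$ if for all $z\in S$ the image $W$ of $T_zS$ in $T_z/\ker\flat_{\widetilde\Omega}$, $\flat_{\widetilde\Omega}(v)=i_v\widetilde\Omega$, is equal to $\{v : i_{v\wedge w_1\wedge\dots\wedge w_{m+1}}\widetilde\Omega=0\ \text{for all } w_1,\dots,w_{m+1}\in W\}$ (with the induced form on the quotient). Then: 1. A local section $\sigma\colon U\to E$ of $\pi$, $U\subset M$ open, solves the Euler-Lagrange equations if and only if $j^1(\mathrm{Leg}_{\mathcal L}\circ j^1\sigma)$ takes its values in the inverse image under $A^\eta_\pi$ of $d\mathcal L\circ j^1\sigma$, that is, $$A^\eta_\pi\circ j^1(\mathrm{Leg}_{\mathcal L}\circ j^1\sigma)=d\mathcal L\circ j^1\sigma\quad\text{on } U.$$ 2. $S_{\mathcal L}$ is an $(m+1)$-Lagrangian submanifold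 of $(J^1(\pi\circ\nu),\widetilde\Omega)$, and its local equations are the Euler-Lagrange equations for $\mathcal L$. Precisely: over the domain of any fibered coordinates, $S_{\mathcal L}$ is the zero set of the independent equations $$p^i_\alpha=\frac{\partial L_{\rm loc}}{\partial u^\alpha_i},\qquad \sum_i p^i_{\alpha i}=\frac{\partial L_{\rm loc}}{\partial u^\alpha};$$ and for a local section $\tau\colon U\to\mathcal M\pi$ of $\pi\circ\nu$, $j^1\tau$ takes its values in $S_{\mathcal L}$ if and only if $\sigma=\nu\circ\tau$ solves the Euler-Lagrange equations and, at each $x\in U$, $\tau(x)$ differs from $\mathrm{Leg}_{\mathcal L}(j^1_x\sigma)$ by a multiple of $\eta$ (pulled back to $E$), i.e. $\tau$ and $\mathrm{Leg}_{\mathcal L}\circ j^1\sigma$ have the same image in $\Lambda^m_2E/\Lambda^m_1E$. -/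

import Mathlib

open scoped Manifold ContDiff Topology

namespace Tulczyjew

noncomputable section

/-- The model space of the base manifold. -/
abbrev Base (m : ℕ) : Type := EuclideanSpace ℝ (Fin m)

/-- The `i`-th vector of the standard basis. -/
abbrev ebasis {m : ℕ} (i : Fin m) : Base m := EuclideanSpace.single i 1

section Fibrations

variable (m : ℕ) (F EE : Type*) [NormedAddCommGroup F] [NormedSpace ℝ F]
  [NormedAddCommGroup EE] [NormedSpace ℝ EE]
  {M E : Type*} [TopologicalSpace M] [ChartedSpace (Base m) M]
  [TopologicalSpace E] [ChartedSpace EE E]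

/-- `π : E → M` is a fibration, that is, a surjective submersion, from a manifold `E` modelled on
`EE` to a manifold `M` of dimension `m`; the fibres are modelled on `F`. -/
class IsFibration (π : E → M) : Prop where
  surjective : Function.Surjective π
  submersion : Manifold.IsSubmersionOfComplement F 𝓘(ℝ, EE) 𝓘(ℝ, Base m) ∞ π

/-- Fibered coordinates `(xⁱ, uᵅ)`: a chart `tot` of `E` and a chart `base` of `M` in which `π` is
the projection `(x, u) ↦ x`. All smooth charts with this property are allowed.

Here and below tangent spaces are written as the model spaces, which they are by definition. -/
structure FiberedChart (π : E → M) where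
  tot : OpenPartialHomeomorph E (Base m × F)
  base : OpenPartialHomeomorph M (Base m)
  contMDiffOn_tot : ContMDiffOn 𝓘(ℝ, EE) 𝓘(ℝ, Base m × F) ∞ tot tot.source
  contMDiffOn_tot_symm : ContMDiffOn 𝓘(ℝ, Base m × F) 𝓘(ℝ, EE) ∞ tot.symm tot.target
  contMDiffOn_base : ContMDiffOn 𝓘(ℝ, Base m) 𝓘(ℝ, Base m) ∞ base base.source
  contMDiffOn_base_symm : ContMDiffOn 𝓘(ℝ, Base m) 𝓘(ℝ, Base m) ∞ base.symm base.target
  map_source : ∀ u ∈ tot.source, π u ∈ base.source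
  fst_tot : ∀ u ∈ tot.source, (tot u).1 = base (π u)

variable {m F EE}

/-- The differential `T_u π : T_u E → T_{π u} M`. -/
def dproj (π : E → M) (u : E) : EE →L[ℝ] Base m := mfderiv 𝓘(ℝ, EE) 𝓘(ℝ, Base m) π u

namespace FiberedChart
variable {π : E → M} (c : FiberedChart m F EE π)

/-- The differential of the chart of the total space. -/
def dtot (u : E) : EE →L[ℝ] Base m × F := mfderiv 𝓘(ℝ, EE) 𝓘(ℝ, Base m × F) c.tot u
/-- The differential of the inverse chart of the total space. -/
def dtotSymm (y : Base m × F) : Base m × F →L[ℝ] EE :=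
  mfderiv 𝓘(ℝ, Base m × F) 𝓘(ℝ, EE) c.tot.symm y
/-- The differential of the chart of the base. -/
def dbase (x : M) : Base m →L[ℝ] Base m := mfderiv 𝓘(ℝ, Base m) 𝓘(ℝ, Base m) c.base x
/-- The differential of the inverse chart of the base: it maps the standard basis to the coordinate
vectors. -/
def dbaseSymm (y : Base m) : Base m →L[ℝ] Base m :=
  mfderiv 𝓘(ℝ, Base m) 𝓘(ℝ, Base m) c.base.symm y

lemma mdiff_tot : c.tot.MDifferentiable 𝓘(ℝ, EE) 𝓘(ℝ, Base m × F) :=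
  ⟨c.contMDiffOn_tot.mdifferentiableOn (by simp), c.contMDiffOn_tot_symm.mdifferentiableOn (by simp)⟩
lemma mdiff_base : c.base.MDifferentiable 𝓘(ℝ, Base m) 𝓘(ℝ, Base m) :=
  ⟨c.contMDiffOn_base.mdifferentiableOn (by simp), c.contMDiffOn_base_symm.mdifferentiableOn (by simp)⟩

lemma dtotSymm_comp_dtot {u : E} (hu : u ∈ c.tot.source) :
    (c.dtotSymm (c.tot u)).comp (c.dtot u) = .id ℝ EE := c.mdiff_tot.symm_comp_deriv hu
lemma dtot_comp_dtotSymm {y : Base m × F} (hy : y ∈ c.tot.target) :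
    (c.dtot (c.tot.symm y)).comp (c.dtotSymm y) = .id ℝ _ := c.mdiff_tot.comp_symm_deriv hy
lemma dbaseSymm_comp_dbase {x : M} (hx : x ∈ c.base.source) :
    (c.dbaseSymm (c.base x)).comp (c.dbase x) = .id ℝ _ := c.mdiff_base.symm_comp_deriv hx
lemma dbase_comp_dbaseSymm {y : Base m} (hy : y ∈ c.base.target) :
    (c.dbase (c.base.symm y)).comp (c.dbaseSymm y) = .id ℝ _ := c.mdiff_base.comp_symm_deriv hy

lemma proj_eqOn {u : E} (hu : u ∈ c.tot.source) : π u = c.base.symm (c.tot u).1 := by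
  rw [c.fst_tot u hu, c.base.left_inv (c.map_source u hu)]

lemma proj_contMDiffAt {u : E} (hu : u ∈ c.tot.source) :
    ContMDiffAt 𝓘(ℝ, EE) 𝓘(ℝ, Base m) ∞ π u := by
  have h1 : ContMDiffAt 𝓘(ℝ, EE) 𝓘(ℝ, Base m × F) ∞ c.tot u :=
    c.contMDiffOn_tot.contMDiffAt (c.tot.open_source.mem_nhds hu)
  have h2 : ContMDiffAt 𝓘(ℝ, Base m × F) 𝓘(ℝ, Base m) ∞ (Prod.fst : Base m × F → Base m) (c.tot u) :=
    contDiff_fst.contMDiff.contMDiffAt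
  have hx : (c.tot u).1 ∈ c.base.target := by
    rw [c.fst_tot u hu]; exact c.base.map_source (c.map_source u hu)
  have h3 : ContMDiffAt 𝓘(ℝ, Base m) 𝓘(ℝ, Base m) ∞ c.base.symm (c.tot u).1 :=
    c.contMDiffOn_base_symm.contMDiffAt (c.base.open_target.mem_nhds hx)
  refine (h3.comp u (h2.comp u h1)).congr_of_eventuallyEq ?_
  filter_upwards [c.tot.open_source.mem_nhds hu] with v hv using c.proj_eqOn hv

lemma fst_comp_dtot {u : E} (hu : u ∈ c.tot.source) :
    (ContinuousLinearMap.fst ℝ (Base m) F).comp (c.dtot u) = (c.dbase (π u)).comp (dproj π u) := by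
  have h1 : MDifferentiableAt 𝓘(ℝ, EE) 𝓘(ℝ, Base m × F) c.tot u := c.mdiff_tot.mdifferentiableAt hu
  have h2 : MDifferentiableAt 𝓘(ℝ, Base m × F) 𝓘(ℝ, Base m) (Prod.fst : Base m × F → Base m)
      (c.tot u) := differentiableAt_fst.mdifferentiableAt
  have h3 : MDifferentiableAt 𝓘(ℝ, Base m) 𝓘(ℝ, Base m) c.base (π u) :=
    c.mdiff_base.mdifferentiableAt (c.map_source u hu)
  have h4 : MDifferentiableAt 𝓘(ℝ, EE) 𝓘(ℝ, Base m) π u :=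
    (c.proj_contMDiffAt hu).mdifferentiableAt (by simp)
  have e : (Prod.fst ∘ c.tot : E → Base m) =ᶠ[𝓝 u] c.base ∘ π := by
    filter_upwards [c.tot.open_source.mem_nhds hu] with v hv using c.fst_tot v hv
  have := e.mfderiv_eq (I := 𝓘(ℝ, EE)) (I' := 𝓘(ℝ, Base m))
  rw [mfderiv_comp u h2 h1, mfderiv_comp u h3 h4, mfderiv_eq_fderiv, fderiv_fst] at this
  exact this

end FiberedChart

variable (m F EE) in
lemma exists_fiberedChart (π : E → M)
    [IsFibration m F EE π] (u : E) :
    ∃ c : FiberedChart m F EE π, u ∈ c.tot.source := by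
  have h := (IsFibration.submersion (m := m) (F := F) (EE := EE) (π := π)) u
  let e := h.domChart
  let b := h.codChart
  let q := h.equiv
  have he := contMDiffOn_of_mem_maximalAtlas h.domChart_mem_maximalAtlas
  have he' := contMDiffOn_symm_of_mem_maximalAtlas h.domChart_mem_maximalAtlas
  refine ⟨{ tot := e.transHomeomorph q.toHomeomorph, base := b
            contMDiffOn_tot := ?_
            contMDiffOn_tot_symm := ?_
            contMDiffOn_base := contMDiffOn_of_mem_maximalAtlas h.codChart_mem_maximalAtlas
            contMDiffOn_base_symm := contMDiffOn_symm_of_mem_maximalAtlas h.codChart_mem_maximalAtlas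
            map_source := fun v hv => h.source_subset_preimage_source hv
            fst_tot := ?_ }, ?_⟩
  · exact (q.contDiff.contMDiff (n := ∞)).comp_contMDiffOn he
  · refine he'.comp (t := e.target) (q.symm.contDiff.contMDiff (n := ∞)).contMDiffOn ?_
    intro y hy
    simpa using hy
  · intro v hv
    have hv' : v ∈ e.source := hv
    have := h.writtenInCharts (show e v ∈ (h.domChart.extend 𝓘(ℝ, EE)).target by
      simpa using e.map_source hv')
    simp only [Function.comp_apply] at this
    have h3 : (h.domChart.extend 𝓘(ℝ, EE)).symm (e v) = v := by
      simpa using e.left_inv hv'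
    rw [h3] at this
    simpa using this.symm
  · exact h.mem_domChart_source


section Transition
variable {π : E → M} (c c' : FiberedChart m F EE π)

/-- The change of coordinates between two fibered charts -/
def FiberedChart.trans (y : Base m × F) : Base m × F := c'.tot (c.tot.symm y)
/-- The domain of the change of coordinates. -/
def FiberedChart.transSet : Set (Base m × F) := c.tot.target ∩ c.tot.symm ⁻¹' c'.tot.source

lemma FiberedChart.isOpen_transSet : IsOpen (c.transSet c') :=
  c.tot.isOpen_inter_preimage_symm c'.tot.open_source

lemma FiberedChart.contDiffOn_trans : ContDiffOn ℝ ∞ (c.trans c') (c.transSet c') := by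
  rw [← contMDiffOn_iff_contDiffOn]
  exact c'.contMDiffOn_tot.comp (c.contMDiffOn_tot_symm.mono Set.inter_subset_left)
    Set.inter_subset_right

lemma FiberedChart.fderiv_trans {y : Base m × F} (hy : y ∈ c.transSet c') :
    fderiv ℝ (c.trans c') y = (c'.dtot (c.tot.symm y)).comp (c.dtotSymm y) := by
  rw [← mfderiv_eq_fderiv]
  exact mfderiv_comp y (c'.mdiff_tot.mdifferentiableAt hy.2)
    (c.mdiff_tot.mdifferentiableAt_symm hy.1)

/-- The change of coordinates on the base. -/
def FiberedChart.baseTrans (y : Base m) : Base m := c'.base (c.base.symm y)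
/-- The domain of the change of coordinates on the base. -/
def FiberedChart.baseTransSet : Set (Base m) := c.base.target ∩ c.base.symm ⁻¹' c'.base.source

lemma FiberedChart.isOpen_baseTransSet : IsOpen (c.baseTransSet c') :=
  c.base.isOpen_inter_preimage_symm c'.base.open_source

lemma FiberedChart.contDiffOn_baseTrans : ContDiffOn ℝ ∞ (c.baseTrans c') (c.baseTransSet c') := by
  rw [← contMDiffOn_iff_contDiffOn]
  exact c'.contMDiffOn_base.comp (c.contMDiffOn_base_symm.mono Set.inter_subset_left)
    Set.inter_subset_right

lemma FiberedChart.fderiv_baseTrans {y : Base m} (hy : y ∈ c.baseTransSet c') :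
    fderiv ℝ (c.baseTrans c') y = (c'.dbase (c.base.symm y)).comp (c.dbaseSymm y) := by
  rw [← mfderiv_eq_fderiv]
  exact mfderiv_comp y (c'.mdiff_base.mdifferentiableAt hy.2)
    (c.mdiff_base.mdifferentiableAt_symm hy.1)

end Transition

/-! ### First jets -/

/-- The first jet bundle `J¹π`: a jet at the point `pt` of `E` is a linear map
`T_{π pt} M → T_pt E` which is a right inverse of `T_pt π`. The parameter `F`, the model of the
fibres of `π`, is only there to determine the manifold structure below. -/
structure J1 (m : ℕ) (F EE : Type*) [NormedAddCommGroup EE] [NormedSpace ℝ EE]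
    {M E : Type*} [TopologicalSpace M] [ChartedSpace (Base m) M]
    [TopologicalSpace E] [ChartedSpace EE E] (π : E → M) where
  pt : E
  lin : Base m →L[ℝ] EE
  isSection : (dproj π pt).comp lin = .id ℝ (Base m)

section Jets

lemma FiberedChart.isSection_dtotSymm {π : E → M} (c : FiberedChart m F EE π) {u : E}
    (hu : u ∈ c.tot.source) (w : Base m →L[ℝ] F) :
    (dproj π u).comp ((c.dtotSymm (c.tot u)).comp
      (((ContinuousLinearMap.id ℝ (Base m)).prod w).comp (c.dbase (π u)))) = .id ℝ _ := by
  have h1 := c.fst_comp_dtot hu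
  have h2 := c.dtot_comp_dtotSymm (c.tot.map_source hu)
  rw [c.tot.left_inv hu] at h2
  have h3 := c.dbaseSymm_comp_dbase (c.map_source u hu)
  ext1 v
  have e1 := DFunLike.congr_fun h1 (c.dtotSymm (c.tot u) (c.dbase (π u) v, w (c.dbase (π u) v)))
  have e2 := DFunLike.congr_fun h2 (c.dbase (π u) v, w (c.dbase (π u) v))
  simp only [ContinuousLinearMap.comp_apply, ContinuousLinearMap.id_apply,
    ContinuousLinearMap.coe_fst', ContinuousLinearMap.prod_apply] at e1 e2 ⊢
  rw [e2] at e1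
  have e3 := fun t => DFunLike.congr_fun h3 t
  simp only [ContinuousLinearMap.comp_apply, ContinuousLinearMap.id_apply] at e3
  have e4 := congrArg (c.dbaseSymm (c.base (π u))) e1
  simp only [e3] at e4
  exact e4.symm

variable (m F EE) in
lemma exists_splitting (π : E → M) [IsFibration m F EE π] (u : E) :
    ∃ ℓ : Base m →L[ℝ] EE, (dproj π u).comp ℓ = .id ℝ _ := by
  obtain ⟨c, hc⟩ := exists_fiberedChart m F EE π u
  exact ⟨_, c.isSection_dtotSymm hc 0⟩

variable (m F EE) in
open Classical in
/-- The jet with linear part `ℓ`, if `ℓ` is a right inverse of the differential of `π`; otherwise an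
arbitrary jet at the same point. -/
def J1.ofLin (π : E → M) [IsFibration m F EE π] (u : E)
    (ℓ : Base m →L[ℝ] EE) : J1 m F EE π where
  pt := u
  lin := if (dproj π u).comp ℓ = .id ℝ _ then ℓ else (exists_splitting m F EE π u).choose
  isSection := by
    split_ifs with h
    · exact h
    · exact (exists_splitting m F EE π u).choose_spec

lemma J1.ofLin_lin {π : E → M} [IsFibration m F EE π] {u : E} {ℓ : Base m →L[ℝ] EE}
    (h : (dproj π u).comp ℓ = .id ℝ _) : (J1.ofLin m F EE π u ℓ).lin = ℓ := if_pos h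

lemma J1.ext' {π : E → M} {z z' : J1 m F EE π} (h : z.pt = z'.pt)
    (h' : z.lin = z'.lin) : z = z' := by
  rcases z with ⟨u, l, p⟩
  rcases z' with ⟨u', l', p'⟩
  obtain rfl : u = u' := h
  obtain rfl : l = l' := h'
  rfl

variable (m F) in
/-- The model space of the first jet bundle. -/
abbrev JModel : Type _ := Base m × (F × (Base m →L[ℝ] F))

variable {π : E → M}

/-- The natural coordinates `(xⁱ, (uᵅ, uᵅᵢ))` of a jet. -/
def FiberedChart.jetCoord (c : FiberedChart m F EE π) (z : J1 m F EE π) : JModel m F :=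
  ((c.tot z.pt).1, (c.tot z.pt).2,
    (ContinuousLinearMap.snd ℝ (Base m) F).comp
      ((c.dtot z.pt).comp (z.lin.comp (c.dbaseSymm (c.base (π z.pt))))))

variable [IsFibration m F EE π]

/-- The jet with given natural coordinates. -/
def FiberedChart.jetOfCoord (c : FiberedChart m F EE π) (y : JModel m F) : J1 m F EE π :=
  J1.ofLin m F EE π (c.tot.symm (y.1, y.2.1))
    ((c.dtotSymm (y.1, y.2.1)).comp
      (((ContinuousLinearMap.id ℝ (Base m)).prod y.2.2).comp
        (c.dbase (π (c.tot.symm (y.1, y.2.1))))))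

lemma FiberedChart.jetOfCoord_lin (c : FiberedChart m F EE π) {y : JModel m F}
    (hy : (y.1, y.2.1) ∈ c.tot.target) : (c.jetOfCoord y).lin = (c.dtotSymm (y.1, y.2.1)).comp
      (((ContinuousLinearMap.id ℝ (Base m)).prod y.2.2).comp
        (c.dbase (π (c.tot.symm (y.1, y.2.1))))) := by
  refine J1.ofLin_lin ?_
  have := c.isSection_dtotSymm (c.tot.map_target hy) y.2.2
  rwa [c.tot.right_inv hy] at this

lemma FiberedChart.lin_eq (c : FiberedChart m F EE π) (z : J1 m F EE π)
    (hz : z.pt ∈ c.tot.source) : (c.dtotSymm (c.tot z.pt)).comp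
      (((ContinuousLinearMap.id ℝ (Base m)).prod (c.jetCoord z).2.2).comp
        (c.dbase (π z.pt))) = z.lin := by
  have h1 := c.fst_comp_dtot hz
  have h2 := c.dtotSymm_comp_dtot hz
  have h3 := c.dbaseSymm_comp_dbase (c.map_source _ hz)
  have h4 : (dproj π z.pt).comp z.lin = .id ℝ _ := z.isSection
  unfold FiberedChart.jetCoord
  generalize z.lin = l at *
  ext1 v
  have e1 := DFunLike.congr_fun h1 (l v)
  have e2 := DFunLike.congr_fun h2 (l v)
  have e3 := DFunLike.congr_fun h3 v
  have e4 := DFunLike.congr_fun h4 v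
  simp only [ContinuousLinearMap.comp_apply, ContinuousLinearMap.id_apply,
    ContinuousLinearMap.coe_fst', ContinuousLinearMap.coe_snd',
    ContinuousLinearMap.prod_apply] at e1 e2 e3 e4 ⊢
  rw [e3]
  rw [e4] at e1
  rw [← e1]
  exact e2

/-- The natural coordinates on the first jet bundle as a partial equivalence. -/
def FiberedChart.jetEquiv (c : FiberedChart m F EE π) : PartialEquiv (J1 m F EE π) (JModel m F) where
  toFun := c.jetCoord
  invFun := c.jetOfCoord
  source := {z | z.pt ∈ c.tot.source}
  target := {y | (y.1, y.2.1) ∈ c.tot.target}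
  map_source' z hz := c.tot.map_source hz
  map_target' y hy := c.tot.map_target hy
  left_inv' z hz := by
    have ht : (c.tot z.pt) ∈ c.tot.target := c.tot.map_source hz
    have hp : (c.jetOfCoord (c.jetCoord z)).pt = z.pt := c.tot.left_inv hz
    refine J1.ext' hp ?_
    have h1 := c.jetOfCoord_lin (y := c.jetCoord z) ht
    have h2 := c.lin_eq z hz
    refine h1.trans (Eq.trans ?_ h2)
    have : c.tot.symm ((c.jetCoord z).1, (c.jetCoord z).2.1) = z.pt := hp
    rw [this]
    rfl
  right_inv' y hy := by
    have h1 := c.jetOfCoord_lin hy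
    have hp : c.tot (c.jetOfCoord y).pt = (y.1, y.2.1) := c.tot.right_inv hy
    have h2 := c.dtot_comp_dtotSymm hy
    have hs : π (c.jetOfCoord y).pt ∈ c.base.source := c.map_source _ (c.tot.map_target hy)
    have h3 := c.dbase_comp_dbaseSymm (c.base.map_source hs)
    rw [c.base.left_inv hs] at h3
    have hq1 := congrArg Prod.fst hp
    have hq2 := congrArg Prod.snd hp
    refine Prod.ext hq1 (Prod.ext hq2 ?_)
    unfold FiberedChart.jetCoord
    change (ContinuousLinearMap.snd ℝ (Base m) F).comp
      ((c.dtot (c.tot.symm (y.1, y.2.1))).comp ((c.jetOfCoord y).lin.comp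
      (c.dbaseSymm (c.base (π (c.jetOfCoord y).pt))))) = y.2.2
    refine (congrArg (fun l : Base m →L[ℝ] EE => (ContinuousLinearMap.snd ℝ (Base m) F).comp
      ((c.dtot (c.tot.symm (y.1, y.2.1))).comp (l.comp
      (c.dbaseSymm (c.base (π (c.jetOfCoord y).pt)))))) h1).trans ?_
    ext1 v
    have e3 := DFunLike.congr_fun h3 v
    have e2 := fun v => DFunLike.congr_fun h2 v
    simp only [ContinuousLinearMap.comp_apply, ContinuousLinearMap.id_apply,
      ContinuousLinearMap.coe_snd', ContinuousLinearMap.prod_apply] at e2 e3 ⊢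
    rw [e2]
    change y.2.2 ((c.dbase (π (c.jetOfCoord y).pt)) _) = _
    rw [e3]

lemma FiberedChart.jet_trans_source (c c' : FiberedChart m F EE π) :
    (c.jetEquiv.symm.trans c'.jetEquiv).source =
      (fun y : JModel m F => (y.1, y.2.1)) ⁻¹' c.transSet c' := by
  ext y; exact Iff.rfl

lemma FiberedChart.contDiffOn_jet_trans (c c' : FiberedChart m F EE π) :
    ContDiffOn ℝ ∞ (c.jetEquiv.symm.trans c'.jetEquiv)
      (c.jetEquiv.symm.trans c'.jetEquiv).source := by
  rw [jet_trans_source]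
  set S : Set (JModel m F) := (fun y : JModel m F => (y.1, y.2.1)) ⁻¹' c.transSet c'
  have hp : ContDiff ℝ ∞ (fun y : JModel m F => (y.1, y.2.1)) := by fun_prop
  have h1 : ContDiffOn ℝ ∞ (fun y : JModel m F => c.trans c' (y.1, y.2.1)) S :=
    (c.contDiffOn_trans c').comp hp.contDiffOn (fun y hy => hy)
  have h2 : ContDiffOn ℝ ∞ (fun y : JModel m F => fderiv ℝ (c.trans c') (y.1, y.2.1)) S :=
    ((c.contDiffOn_trans c').fderiv_of_isOpen (c.isOpen_transSet c') (m := ∞) (by simp)).comp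
      hp.contDiffOn (fun y hy => hy)
  have hb : ∀ y ∈ S, (c.trans c' (y.1, y.2.1)).1 ∈ c'.baseTransSet c := by
    rintro y (hy : (y.1, y.2.1) ∈ c.transSet c')
    have hy2 : c.tot.symm (y.1, y.2.1) ∈ c'.tot.source := hy.2
    have e := c'.fst_tot _ hy2
    have hs := c'.map_source _ hy2
    refine ⟨?_, ?_⟩
    · show (c'.tot _).1 ∈ c'.base.target
      rw [e]; exact c'.base.map_source hs
    · show c'.base.symm (c'.tot _).1 ∈ c.base.source
      rw [e, c'.base.left_inv hs]; exact c.map_source _ (c.tot.map_target hy.1)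
  have h3 : ContDiffOn ℝ ∞
      (fun y : JModel m F => fderiv ℝ (c'.baseTrans c) (c.trans c' (y.1, y.2.1)).1) S :=
    ((c'.contDiffOn_baseTrans c).fderiv_of_isOpen (c'.isOpen_baseTransSet c) (m := ∞)
      (by simp)).comp (contDiff_fst.comp_contDiffOn h1) hb
  have h4 : ContDiffOn ℝ ∞ (fun y : JModel m F =>
      ((c.trans c' (y.1, y.2.1)).1, ((c.trans c' (y.1, y.2.1)).2,
      (ContinuousLinearMap.snd ℝ (Base m) F).comp ((fderiv ℝ (c.trans c') (y.1, y.2.1)).comp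
        (((ContinuousLinearMap.id ℝ (Base m)).prod y.2.2).comp
          (fderiv ℝ (c'.baseTrans c) (c.trans c' (y.1, y.2.1)).1)))))) S := by
    refine (contDiff_fst.comp_contDiffOn h1).prodMk ((contDiff_snd.comp_contDiffOn h1).prodMk ?_)
    refine contDiffOn_const.clm_comp (h2.clm_comp (ContDiffOn.clm_comp ?_ h3))
    have e : ∀ w : Base m →L[ℝ] F, (ContinuousLinearMap.id ℝ (Base m)).prod w =
        ContinuousLinearMap.inl ℝ (Base m) F + (ContinuousLinearMap.inr ℝ (Base m) F).comp w := by
      intro w; ext1 v; simp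
    have : ContDiff ℝ ∞ (fun y : JModel m F => (ContinuousLinearMap.id ℝ (Base m)).prod y.2.2) := by
      simp only [e]
      exact contDiff_const.add (contDiff_const.clm_comp (by fun_prop))
    exact this.contDiffOn
  refine h4.congr ?_
  intro y hy
  have h1 := c.jetOfCoord_lin (y := y) hy.1
  have hy2 : c.tot.symm (y.1, y.2.1) ∈ c'.tot.source := hy.2
  refine Prod.ext rfl (Prod.ext rfl ?_)
  refine (congrArg (fun l : Base m →L[ℝ] EE => (ContinuousLinearMap.snd ℝ (Base m) F).comp
      ((c'.dtot (c.tot.symm (y.1, y.2.1))).comp (l.comp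
      (c'.dbaseSymm (c'.base (π (c.jetOfCoord y).pt)))))) h1).trans ?_
  dsimp only
  rw [c.fderiv_trans c' hy, c'.fderiv_baseTrans c (hb y hy)]
  have e : (c.trans c' (y.1, y.2.1)).1 = c'.base (π (c.tot.symm (y.1, y.2.1))) := c'.fst_tot _ hy2
  rw [e, c'.base.left_inv (c'.map_source _ hy2)]
  rfl

lemma FiberedChart.isOpen_jet_trans_source (c c' : FiberedChart m F EE π) :
    IsOpen (c.jetEquiv.symm.trans c'.jetEquiv).source := by
  rw [jet_trans_source]
  exact (c.isOpen_transSet c').preimage (by fun_prop)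

variable (m F EE) in
/-- A choice of fibered chart around each point of the total space. -/
def fiberedChartAt (π : E → M) [IsFibration m F EE π] (u : E) : FiberedChart m F EE π :=
  (exists_fiberedChart m F EE π u).choose

lemma mem_fiberedChartAt (u : E) : u ∈ (fiberedChartAt m F EE π u).tot.source :=
  (exists_fiberedChart m F EE π u).choose_spec

variable (m F EE) in
/-- The atlas of natural coordinates of the first jet bundle. -/
def jetCore (π : E → M) [IsFibration m F EE π] : ChartedSpaceCore (JModel m F) (J1 m F EE π) where
  atlas := Set.range FiberedChart.jetEquiv
  chartAt z := (fiberedChartAt m F EE π z.pt).jetEquiv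
  mem_chart_source z := mem_fiberedChartAt z.pt
  chart_mem_atlas z := ⟨_, rfl⟩
  open_source := by
    rintro _ _ ⟨c, rfl⟩ ⟨c', rfl⟩
    exact c.isOpen_jet_trans_source c'
  continuousOn_toFun := by
    rintro _ _ ⟨c, rfl⟩ ⟨c', rfl⟩
    exact (c.contDiffOn_jet_trans c').continuousOn

instance : TopologicalSpace (J1 m F EE π) := (jetCore m F EE π).toTopologicalSpace
instance : ChartedSpace (JModel m F) (J1 m F EE π) := (jetCore m F EE π).toChartedSpace

instance : IsManifold 𝓘(ℝ, JModel m F) ∞ (J1 m F EE π) := by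
  apply isManifold_of_contDiffOn
  intro e e' he he'
  obtain ⟨_, ⟨_, rfl⟩, _, ⟨⟨c, rfl⟩, rfl⟩, he⟩ := he
  obtain ⟨_, ⟨_, rfl⟩, _, ⟨⟨c', rfl⟩, rfl⟩, he'⟩ := he'
  obtain rfl := he
  obtain rfl := he'
  simp only [modelWithCornersSelf_coe, modelWithCornersSelf_coe_symm, Set.range_id, Set.preimage_id, Function.comp_id, Function.id_comp, Set.inter_univ]
  exact c.contDiffOn_jet_trans c'

end Jets


/-! ### Horizontal forms -/

/-- The bundle `Λ₂ᵏE` of 2-horizontal `k`-forms: a `k`-form at a point of `E` which vanishes as soon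
as two of its arguments are vertical. The extended multimomentum bundle `𝓜π` is the case `k = m`. -/
structure HForm (m : ℕ) (F EE : Type*) [NormedAddCommGroup EE] [NormedSpace ℝ EE]
    {M E : Type*} [TopologicalSpace M] [ChartedSpace (Base m) M]
    [TopologicalSpace E] [ChartedSpace EE E] (π : E → M) (k : ℕ) where
  pt : E
  form : EE [⋀^Fin k]→L[ℝ] ℝ
  horizontal : ∀ (v : Fin k → EE) (i j : Fin k), i ≠ j →
    (dproj π pt (v i) : Base m) = 0 → (dproj π pt (v j) : Base m) = 0 → form v = 0

variable (m F) in
/-- The typical fibre of the bundle of 2-horizontal forms. -/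
def HFib (k : ℕ) : Submodule ℝ ((Base m × F) [⋀^Fin k]→L[ℝ] ℝ) where
  carrier := {q | ∀ (v : Fin k → Base m × F) (i j : Fin k), i ≠ j →
    (v i).1 = 0 → (v j).1 = 0 → q v = 0}
  add_mem' {p q} hp hq v i j hij hi hj := by
    simp [hp v i j hij hi hj, hq v i j hij hi hj]
  zero_mem' v i j hij hi hj := by simp
  smul_mem' t q hq v i j hij hi hj := by simp [hq v i j hij hi hj]

section Forms

variable {k : ℕ}

instance instNormedAddCommGroupHFib : NormedAddCommGroup (HFib m F k) := inferInstance

instance instNormedSpaceHFib : NormedSpace ℝ (HFib m F k) := inferInstance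

instance [FiniteDimensional ℝ F] : FiniteDimensional ℝ
    (ContinuousMultilinearMap ℝ (fun _ : Fin k => Base m × F) ℝ) :=
  Module.Finite.of_injective (ContinuousMultilinearMap.toMultilinearMapLinear
    (R' := ℝ) (A := ℝ) (M₁ := fun _ : Fin k => Base m × F) (M₂ := ℝ))
    ContinuousMultilinearMap.toMultilinearMap_injective

/-- The inclusion of `HFib` into multilinear maps. -/
def HFib.incl : HFib m F k →L[ℝ] ContinuousMultilinearMap ℝ (fun _ : Fin k => Base m × F) ℝ :=
  (ContinuousAlternatingMap.toContinuousMultilinearMapCLM ℝ).comp (HFib m F k).subtypeL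

lemma HFib.incl_injective : Function.Injective (HFib.incl (m := m) (F := F) (k := k)) := by
  intro p q h
  apply Subtype.ext
  exact ContinuousAlternatingMap.toContinuousMultilinearMap_injective h

instance [FiniteDimensional ℝ F] : FiniteDimensional ℝ (HFib m F k) :=
  Module.Finite.of_injective (HFib.incl (m := m) (F := F) (k := k)).toLinearMap HFib.incl_injective

lemma exists_contDiff_retract {A B : Type*} [NormedAddCommGroup A] [NormedSpace ℝ A]
    [NormedAddCommGroup B] [NormedSpace ℝ B] [FiniteDimensional ℝ B]
    (f : A →L[ℝ] B) (hf : Function.Injective f) :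
    ∃ r : B → A, ContDiff ℝ ∞ r ∧ ∀ q, r (f q) = q := by
  obtain ⟨g, hg⟩ := LinearMap.exists_leftInverse_of_injective f.toLinearMap
    (LinearMap.ker_eq_bot.2 hf)
  exact ⟨g, (LinearMap.toContinuousLinearMap g).contDiff, fun q => LinearMap.congr_fun hg q⟩

lemma HFib.exists_retract [FiniteDimensional ℝ F] :
    ∃ r : ContinuousMultilinearMap ℝ (fun _ : Fin k => Base m × F) ℝ → HFib m F k,
      ContDiff ℝ ∞ r ∧ ∀ q, r (HFib.incl q) = q :=
  exists_contDiff_retract (A := HFib m F k)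
    (B := ContinuousMultilinearMap ℝ (fun _ : Fin k => Base m × F) ℝ)
    HFib.incl HFib.incl_injective

lemma HForm.ext' {π : E → M} {μ μ' : HForm m F EE π k} (h : μ.pt = μ'.pt)
    (h' : μ.form = μ'.form) : μ = μ' := by
  rcases μ with ⟨u, l, p⟩
  rcases μ' with ⟨u', l', p'⟩
  obtain rfl : u = u' := h
  obtain rfl : l = l' := h'
  rfl

variable (m F) in
/-- The model of the manifold of 2-horizontal `k`-forms. -/
abbrev HModel (k : ℕ) : Type _ := Base m × (F × HFib m F k)

variable {π : E → M}

lemma FiberedChart.fst_eq_zero_iff (c : FiberedChart m F EE π) {u : E} (hu : u ∈ c.tot.source)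
    (v : EE) : (c.dtot u v).1 = 0 ↔ (dproj π u v : Base m) = 0 := by
  have h1 := DFunLike.congr_fun (c.fst_comp_dtot hu) v
  have h3 := DFunLike.congr_fun (c.dbaseSymm_comp_dbase (c.map_source u hu)) (dproj π u v)
  simp only [ContinuousLinearMap.comp_apply, ContinuousLinearMap.coe_fst',
    ContinuousLinearMap.id_apply] at h1 h3
  rw [h1]
  constructor
  · intro h
    rw [h, map_zero] at h3
    exact h3.symm
  · intro h
    rw [h, map_zero]

open Classical in
/-- The coordinate expression of a 2-horizontal form. -/
def FiberedChart.formCoord (c : FiberedChart m F EE π) (μ : HForm m F EE π k) : HModel m F k :=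
  ((c.tot μ.pt).1, (c.tot μ.pt).2,
    if h : μ.pt ∈ c.tot.source then
      ⟨μ.form.compContinuousLinearMap (c.dtotSymm (c.tot μ.pt)), by
        have e := c.dtot_comp_dtotSymm (c.tot.map_source h)
        rw [c.tot.left_inv h] at e
        intro v i j hij hi hj
        have e' := fun w => DFunLike.congr_fun e w
        simp only [ContinuousLinearMap.comp_apply, ContinuousLinearMap.id_apply] at e'
        exact μ.horizontal _ i j hij
          ((c.fst_eq_zero_iff h _).1 (by simp [e', hi])) ((c.fst_eq_zero_iff h _).1 (by simp [e', hj]))⟩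
    else 0)

open Classical in
/-- The 2-horizontal form with given coordinate expression. -/
def FiberedChart.formOfCoord (c : FiberedChart m F EE π) (y : HModel m F k) : HForm m F EE π k where
  pt := c.tot.symm (y.1, y.2.1)
  form := if (y.1, y.2.1) ∈ c.tot.target then
      y.2.2.1.compContinuousLinearMap (c.dtot (c.tot.symm (y.1, y.2.1)))
    else 0
  horizontal v i j hij hi hj := by
    split_ifs with h
    · have hs := c.tot.map_target h
      exact y.2.2.2 _ i j hij ((c.fst_eq_zero_iff hs _).2 hi) ((c.fst_eq_zero_iff hs _).2 hj)
    · simp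

lemma FiberedChart.formCoord_coe (c : FiberedChart m F EE π) (μ : HForm m F EE π k)
    (hμ : μ.pt ∈ c.tot.source) :
    ((c.formCoord μ).2.2 : (Base m × F) [⋀^Fin k]→L[ℝ] ℝ) =
      μ.form.compContinuousLinearMap (c.dtotSymm (c.tot μ.pt)) := by
  simp only [FiberedChart.formCoord, dif_pos hμ]

lemma FiberedChart.formOfCoord_form (c : FiberedChart m F EE π) (y : HModel m F k)
    (hy : (y.1, y.2.1) ∈ c.tot.target) :
    (c.formOfCoord y).form =
      y.2.2.1.compContinuousLinearMap (c.dtot (c.tot.symm (y.1, y.2.1))) := if_pos hy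

variable (k) in
/-- The natural coordinates on the bundle of 2-horizontal forms as a partial
equivalence. -/
def FiberedChart.formEquiv (c : FiberedChart m F EE π) :
    PartialEquiv (HForm m F EE π k) (HModel m F k) where
  toFun := c.formCoord
  invFun := c.formOfCoord
  source := {μ | μ.pt ∈ c.tot.source}
  target := {y | (y.1, y.2.1) ∈ c.tot.target}
  map_source' z hz := c.tot.map_source hz
  map_target' y hy := c.tot.map_target hy
  left_inv' μ (hμ : μ.pt ∈ c.tot.source) := by
    have ht : (c.tot μ.pt) ∈ c.tot.target := c.tot.map_source hμ
    have hp : (c.formOfCoord (c.formCoord μ)).pt = μ.pt := c.tot.left_inv hμ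
    refine HForm.ext' hp ?_
    have e := c.dtotSymm_comp_dtot hμ
    rw [c.formOfCoord_form _ ht, c.formCoord_coe μ hμ]
    have e2 : c.tot.symm ((c.formCoord μ).1, (c.formCoord μ).2.1) = μ.pt := hp
    rw [e2]
    ext v
    simp only [ContinuousAlternatingMap.compContinuousLinearMap_apply]
    congr 1
    ext1 i
    exact DFunLike.congr_fun e (v i)
  right_inv' y (hy : (y.1, y.2.1) ∈ c.tot.target) := by
    have hp : c.tot (c.formOfCoord y).pt = (y.1, y.2.1) := c.tot.right_inv hy
    have hs : (c.formOfCoord y).pt ∈ c.tot.source := c.tot.map_target hy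
    have hq1 := congrArg Prod.fst hp
    have hq2 := congrArg Prod.snd hp
    refine Prod.ext hq1 (Prod.ext hq2 ?_)
    apply Subtype.ext
    have e := c.dtot_comp_dtotSymm hy
    rw [c.formCoord_coe _ hs, c.formOfCoord_form _ hy, hp]
    ext v
    simp only [ContinuousAlternatingMap.compContinuousLinearMap_apply]
    congr 1
    ext1 i
    exact DFunLike.congr_fun e (v i)

lemma FiberedChart.form_trans_source (c c' : FiberedChart m F EE π) :
    ((c.formEquiv k).symm.trans (c'.formEquiv k)).source =
      (fun y : HModel m F k => (y.1, y.2.1)) ⁻¹' c.transSet c' := by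
  ext y; exact Iff.rfl

lemma FiberedChart.contDiffOn_form_trans [FiniteDimensional ℝ F] (c c' : FiberedChart m F EE π) :
    ContDiffOn ℝ ∞ ((c.formEquiv k).symm.trans (c'.formEquiv k))
      ((c.formEquiv k).symm.trans (c'.formEquiv k)).source := by
  rw [form_trans_source]
  set S : Set (HModel m F k) := (fun y : HModel m F k => (y.1, y.2.1)) ⁻¹' c.transSet c'
  have hp : ContDiff ℝ ∞ (fun y : HModel m F k => (y.1, y.2.1)) := by fun_prop
  have h1 : ContDiffOn ℝ ∞ (fun y : HModel m F k => c.trans c' (y.1, y.2.1)) S :=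
    (c.contDiffOn_trans c').comp hp.contDiffOn (fun y hy => hy)
  have hb : ∀ y ∈ S, c.trans c' (y.1, y.2.1) ∈ c'.transSet c := by
    rintro y (hy : (y.1, y.2.1) ∈ c.transSet c')
    have hy2 : c.tot.symm (y.1, y.2.1) ∈ c'.tot.source := hy.2
    refine ⟨c'.tot.map_source hy2, ?_⟩
    show c'.tot.symm (c'.tot _) ∈ c.tot.source
    rw [c'.tot.left_inv hy2]; exact c.tot.map_target hy.1
  have h2 : ContDiffOn ℝ ∞ (fun y : HModel m F k => fderiv ℝ (c'.trans c)
      (c.trans c' (y.1, y.2.1))) S :=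
    ((c'.contDiffOn_trans c).fderiv_of_isOpen (c'.isOpen_transSet c) (m := ∞) (by simp)).comp
      h1 hb
  obtain ⟨r, hd, hr⟩ := HFib.exists_retract (m := m) (F := F) (k := k)
  have h3 : ContDiffOn ℝ ∞ (fun y : HModel m F k =>
      r (ContinuousMultilinearMap.compContinuousLinearMapContinuousMultilinear ℝ
        (fun _ : Fin k => Base m × F) (fun _ => Base m × F) ℝ
        (fun _ => fderiv ℝ (c'.trans c) (c.trans c' (y.1, y.2.1))) (HFib.incl y.2.2))) S := by
    have ha : ContDiffOn ℝ ∞ (fun y : HModel m F k =>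
        ContinuousMultilinearMap.compContinuousLinearMapContinuousMultilinear ℝ
        (fun _ : Fin k => Base m × F) (fun _ => Base m × F) ℝ
        (fun _ => fderiv ℝ (c'.trans c) (c.trans c' (y.1, y.2.1)))) S :=
      (ContinuousMultilinearMap.contDiff _).comp_contDiffOn (contDiffOn_pi.2 fun _ => h2)
    have hc : ContDiffOn ℝ ∞ (fun y : HModel m F k => HFib.incl y.2.2) S := by
      have h0 : ContDiff ℝ ∞ (fun y : HModel m F k => y.2.2) := by fun_prop
      have h00 : ContDiff ℝ ∞ (HFib.incl (m := m) (F := F) (k := k)) :=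
        ContinuousLinearMap.contDiff _
      exact (h00.comp h0).contDiffOn
    exact hd.comp_contDiffOn (ha.clm_apply hc)
  refine ((contDiff_fst.comp_contDiffOn h1).prodMk
    ((contDiff_snd.comp_contDiffOn h1).prodMk h3)).congr ?_
  rintro y (hy : (y.1, y.2.1) ∈ c.transSet c')
  refine Prod.ext rfl (Prod.ext rfl ?_)
  dsimp only
  have hy2 : c.tot.symm (y.1, y.2.1) ∈ c'.tot.source := hy.2
  rw [← hr ((((c.formEquiv k).symm.trans (c'.formEquiv k)) y).2.2)]
  congr 1
  rw [c'.fderiv_trans c (hb y hy)]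
  ext v
  have hs : (c.formOfCoord (k := k) y).pt ∈ c'.tot.source := hy2
  have hL := congrArg (fun q : (Base m × F) [⋀^Fin k]→L[ℝ] ℝ => q v)
    ((c'.formCoord_coe (c.formOfCoord y) hs).trans
      (congrArg (fun q : EE [⋀^Fin k]→L[ℝ] ℝ => q.compContinuousLinearMap
        (c'.dtotSymm (c'.tot (c.formOfCoord (k := k) y).pt))) (c.formOfCoord_form y hy.1)))
  refine hL.trans ?_
  have e : c'.tot.symm (c.trans c' (y.1, y.2.1)) = c.tot.symm (y.1, y.2.1) :=
    c'.tot.left_inv hy2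
  rw [e]
  rfl

lemma FiberedChart.isOpen_form_trans_source (c c' : FiberedChart m F EE π) :
    IsOpen ((c.formEquiv k).symm.trans (c'.formEquiv k)).source := by
  rw [form_trans_source]
  exact (c.isOpen_transSet c').preimage (by fun_prop)

variable [FiniteDimensional ℝ F] [IsFibration m F EE π]

variable (m F EE k) in
/-- The atlas of natural coordinates of the bundle of 2-horizontal forms. -/
def formCore (π : E → M) [IsFibration m F EE π] :
    ChartedSpaceCore (HModel m F k) (HForm m F EE π k) where
  atlas := Set.range (FiberedChart.formEquiv k)
  chartAt z := (fiberedChartAt m F EE π z.pt).formEquiv k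
  mem_chart_source z := mem_fiberedChartAt z.pt
  chart_mem_atlas z := ⟨_, rfl⟩
  open_source := by
    rintro _ _ ⟨c, rfl⟩ ⟨c', rfl⟩
    exact c.isOpen_form_trans_source c'
  continuousOn_toFun := by
    rintro _ _ ⟨c, rfl⟩ ⟨c', rfl⟩
    exact (c.contDiffOn_form_trans c').continuousOn

instance : TopologicalSpace (HForm m F EE π k) := (formCore m F EE k π).toTopologicalSpace
instance : ChartedSpace (HModel m F k) (HForm m F EE π k) := (formCore m F EE k π).toChartedSpace

instance : IsManifold 𝓘(ℝ, HModel m F k) ∞ (HForm m F EE π k) := by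
  apply isManifold_of_contDiffOn
  intro e e' he he'
  obtain ⟨_, ⟨_, rfl⟩, _, ⟨⟨c, rfl⟩, rfl⟩, he⟩ := he
  obtain ⟨_, ⟨_, rfl⟩, _, ⟨⟨c', rfl⟩, rfl⟩, he'⟩ := he'
  obtain rfl := he
  obtain rfl := he'
  simp only [modelWithCornersSelf_coe, modelWithCornersSelf_coe_symm, Set.range_id, Set.preimage_id, Function.comp_id, Function.id_comp, Set.inter_univ]
  exact c.contDiffOn_form_trans c'

end Forms

/-! ### The bundles over the base manifold -/

section Bundles

variable {π : E → M}

/-- A submersion is obtained from fibered charts around every point. -/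
lemma IsFibration.of_fiberedCharts [IsManifold 𝓘(ℝ, Base m) ∞ M]
    {E' : Type*} [TopologicalSpace E'] [ChartedSpace (Base m × F) E']
    [IsManifold 𝓘(ℝ, Base m × F) ∞ E'] {π' : E' → M} (hs : Function.Surjective π')
    (h : ∀ u, ∃ c : FiberedChart m F (Base m × F) π', u ∈ c.tot.source) :
    IsFibration m F (Base m × F) π' where
  surjective := hs
  submersion u := by
    obtain ⟨c, hc⟩ := h u
    refine Manifold.IsSubmersionAtOfComplement.mk_of_charts (ContinuousLinearEquiv.refl ℝ _)
      c.tot c.base hc (c.map_source u hc)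
      (c.tot.mem_maximalAtlas_of_contMDiffOn c.contMDiffOn_tot c.contMDiffOn_tot_symm)
      (c.base.mem_maximalAtlas_of_contMDiffOn c.contMDiffOn_base c.contMDiffOn_base_symm)
      c.map_source ?_
    intro y hy
    have hy' : y ∈ c.tot.target := by simpa using hy
    have := c.fst_tot _ (c.tot.map_target hy')
    rw [c.tot.right_inv hy'] at this
    simpa using this.symm

variable (m F EE) in
/-- The projection of the first jet bundle to the base manifold. -/
def jetProj (π : E → M) (z : J1 m F EE π) : M := π z.pt

variable (m F EE) in
/-- The projection of the bundle of 2-horizontal `k`-forms to the base manifold. -/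
def formProj (π : E → M) (k : ℕ) (p : HForm m F EE π k) : M := π p.pt

variable [IsFibration m F EE π]

/-- The fibered chart of the first jet bundle over the base induced by a fibered chart. -/
def FiberedChart.jet (c : FiberedChart m F EE π) :
    FiberedChart m (F × (Base m →L[ℝ] F)) (JModel m F) (jetProj m F EE π) where
  tot := (jetCore m F EE π).openPartialHomeomorph c.jetEquiv ⟨c, rfl⟩
  base := c.base
  contMDiffOn_tot := contMDiffOn_of_mem_maximalAtlas (IsManifold.subset_maximalAtlas
    (Set.mem_iUnion₂.2 ⟨_, ⟨c, rfl⟩, rfl⟩))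
  contMDiffOn_tot_symm := contMDiffOn_symm_of_mem_maximalAtlas (IsManifold.subset_maximalAtlas
    (Set.mem_iUnion₂.2 ⟨_, ⟨c, rfl⟩, rfl⟩))
  contMDiffOn_base := c.contMDiffOn_base
  contMDiffOn_base_symm := c.contMDiffOn_base_symm
  map_source u hu := c.map_source u.pt hu
  fst_tot u hu := c.fst_tot u.pt hu

instance [IsManifold 𝓘(ℝ, Base m) ∞ M] :
    IsFibration m (F × (Base m →L[ℝ] F)) (JModel m F) (jetProj m F EE π) :=
  IsFibration.of_fiberedCharts
    (fun x => by
      obtain ⟨u, hu⟩ := IsFibration.surjective (m := m) (F := F) (EE := EE) (π := π) x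
      exact ⟨J1.ofLin m F EE π u 0, hu⟩)
    (fun z => ⟨(fiberedChartAt m F EE π z.pt).jet, mem_fiberedChartAt z.pt⟩)

variable [FiniteDimensional ℝ F] {k : ℕ}

variable (k) in
/-- The fibered chart of the bundle of 2-horizontal forms over the base induced by a fibered
chart. -/
def FiberedChart.forms (c : FiberedChart m F EE π) :
    FiberedChart m (F × HFib m F k) (HModel m F k) (formProj m F EE π k) where
  tot := (formCore m F EE k π).openPartialHomeomorph (c.formEquiv k) ⟨c, rfl⟩
  base := c.base
  contMDiffOn_tot := contMDiffOn_of_mem_maximalAtlas (IsManifold.subset_maximalAtlas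
    (Set.mem_iUnion₂.2 ⟨_, ⟨c, rfl⟩, rfl⟩))
  contMDiffOn_tot_symm := contMDiffOn_symm_of_mem_maximalAtlas (IsManifold.subset_maximalAtlas
    (Set.mem_iUnion₂.2 ⟨_, ⟨c, rfl⟩, rfl⟩))
  contMDiffOn_base := c.contMDiffOn_base
  contMDiffOn_base_symm := c.contMDiffOn_base_symm
  map_source u hu := c.map_source u.pt hu
  fst_tot u hu := c.fst_tot u.pt hu

instance [IsManifold 𝓘(ℝ, Base m) ∞ M] :
    IsFibration m (F × HFib m F k) (HModel m F k) (formProj m F EE π k) :=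
  IsFibration.of_fiberedCharts
    (fun x => by
      obtain ⟨u, hu⟩ := IsFibration.surjective (m := m) (F := F) (EE := EE) (π := π) x
      exact ⟨⟨u, 0, fun _ _ _ _ _ _ => rfl⟩, hu⟩)
    (fun p => ⟨(fiberedChartAt m F EE π p.pt).forms k, mem_fiberedChartAt p.pt⟩)

end Bundles

/-! ### Sections and their jets -/

section Sections

variable {π : E → M}

variable (m EE) in
/-- `σ` restricts to a smooth local section of `π` over the open set `U`. -/
structure IsLocalSection (π : E → M) (U : Set M) (σ : M → E) : Prop where
  isOpen : IsOpen U
  contMDiffOn : ContMDiffOn 𝓘(ℝ, Base m) 𝓘(ℝ, EE) ∞ σ U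
  proj_eq : ∀ x ∈ U, π (σ x) = x

variable [IsFibration m F EE π]

variable (m F EE) in
/-- The first jet `j¹ₓσ` of a local section at a point of its domain: its linear part is the
differential `Tₓσ`. -/
def jet (π : E → M) [IsFibration m F EE π] (σ : M → E) (x : M) : J1 m F EE π :=
  J1.ofLin m F EE π (σ x) (mfderiv 𝓘(ℝ, Base m) 𝓘(ℝ, EE) σ x)

lemma jet_lin {U : Set M} {σ : M → E} (h : IsLocalSection m EE π U σ) {x : M} (hx : x ∈ U) :
    (jet m F EE π σ x).lin = mfderiv 𝓘(ℝ, Base m) 𝓘(ℝ, EE) σ x := by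
  refine J1.ofLin_lin ?_
  have hσ : MDifferentiableAt 𝓘(ℝ, Base m) 𝓘(ℝ, EE) σ x :=
    (h.contMDiffOn.contMDiffAt (h.isOpen.mem_nhds hx)).mdifferentiableAt (by simp)
  have hπ : MDifferentiableAt 𝓘(ℝ, EE) 𝓘(ℝ, Base m) π (σ x) :=
    ((fiberedChartAt m F EE π (σ x)).proj_contMDiffAt (mem_fiberedChartAt (σ x))).mdifferentiableAt
      (by simp)
  have e : π ∘ σ =ᶠ[𝓝 x] id := by
    filter_upwards [h.isOpen.mem_nhds hx] with y hy using h.proj_eq y hy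
  have h1 := e.mfderiv_eq (I := 𝓘(ℝ, Base m)) (I' := 𝓘(ℝ, Base m))
  rw [mfderiv_comp x hπ hσ, mfderiv_id] at h1
  exact h1

end Sections

/-! ### Volume forms, Lagrangian densities and the Legendre transform -/

section Lagrangian

variable {π : E → M}

variable (m M) in
/-- A volume form on the base manifold: a nowhere vanishing smooth `m`-form. Smoothness is
smoothness of its coefficient in the charts of the atlas. -/
structure VolumeForm where
  toFun : M → (Base m) [⋀^Fin m]→L[ℝ] ℝ
  ne_zero : ∀ x, toFun x ≠ 0
  smooth : ∀ b ∈ atlas (Base m) M, ContDiffOn ℝ ∞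
    (fun y => toFun (b.symm y) (fun i =>
      (mfderiv 𝓘(ℝ, Base m) 𝓘(ℝ, Base m) b.symm y (ebasis i) : Base m))) b.target

variable (m F EE) in
/-- Lagrangian densities: fibered maps from the first jet bundle to the bundle of `m`-forms of the
base manifold (the value at `z` is an `m`-form on the tangent space at the base point of `z`). -/
abbrev LagrangianDensity (π : E → M) : Type _ := J1 m F EE π → (Base m) [⋀^Fin m]→L[ℝ] ℝ

/-- The Lagrangian function `L` with `𝓛 = L η`. -/
def lagrangianFunction (η : VolumeForm m M) (𝓛 : LagrangianDensity m F EE π)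
    (z : J1 m F EE π) : ℝ :=
  𝓛 z (fun i => ebasis i) / η.toFun (jetProj m F EE π z) (fun i => ebasis i)

lemma eq_smul_det (f : (Base m) [⋀^Fin m]→L[ℝ] ℝ) (v : Fin m → Base m) :
    f v = f (fun i => ebasis i) * (EuclideanSpace.basisFun (Fin m) ℝ).toBasis.det v := by
  have := f.toAlternatingMap.eq_smul_basis_det (EuclideanSpace.basisFun (Fin m) ℝ).toBasis
  have h := DFunLike.congr_fun this v
  simpa [ContinuousAlternatingMap.coe_toAlternatingMap, show (⇑(EuclideanSpace.basisFun (Fin m) ℝ) : Fin m → Base m) =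
    fun i => ebasis i from funext fun i => EuclideanSpace.basisFun_apply ..] using h

lemma lagrangianFunction_smul (η : VolumeForm m M) (𝓛 : LagrangianDensity m F EE π)
    (z : J1 m F EE π) :
    lagrangianFunction η 𝓛 z • η.toFun (jetProj m F EE π z) = 𝓛 z := by
  have key := eq_smul_det (m := m)
  have h := key (η.toFun (jetProj m F EE π z))
  have h' := key (𝓛 z)
  have h0 : η.toFun (jetProj m F EE π z) (fun i => ebasis i) ≠ 0 := by
    intro h0
    apply η.ne_zero (jetProj m F EE π z)
    ext v
    rw [h v, h0, zero_mul]
    rfl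
  ext v
  rw [ContinuousAlternatingMap.smul_apply, h v, h' v, lagrangianFunction, smul_eq_mul]
  field_simp

/-- The affine action of `T*M ⊗ V(π)` on jets: a linear map `w` from the tangent space of the base
to the tangent space of `E` acts through its vertical part. -/
def J1.translate (z : J1 m F EE π) (w : Base m →L[ℝ] EE) : J1 m F EE π where
  pt := z.pt
  lin := z.lin + (w - z.lin.comp ((dproj π z.pt).comp w))
  isSection := by
    have h := z.isSection
    rw [ContinuousLinearMap.comp_add, ContinuousLinearMap.comp_sub,
      ← ContinuousLinearMap.comp_assoc, h, ContinuousLinearMap.id_comp, sub_self, add_zero]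

/-- The derivative of a function on the first jet bundle along the fibre over `E`: its value at
`dxⁱ ⊗ ∂/∂uᵅ` is `∂L/∂uᵅᵢ`. -/
def fiberDeriv (L : J1 m F EE π → ℝ) (z : J1 m F EE π) : (Base m →L[ℝ] EE) →L[ℝ] ℝ :=
  fderiv ℝ (fun w => L (z.translate w)) 0

/-- The linear map `X ↦ ∑ᵢ ∂L/∂uᵅᵢ θᵅ(X) ∂/∂xⁱ` with the contact forms `θᵅ = duᵅ - uᵅⱼ dxʲ`. -/
def contactMap (L : J1 m F EE π → ℝ) (z : J1 m F EE π) : EE →L[ℝ] Base m :=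
  ∑ i : Fin m, ContinuousLinearMap.smulRight
    ((fiberDeriv L z).comp (ContinuousLinearMap.smulRightL ℝ (Base m) EE (EuclideanSpace.proj i)))
    (ebasis i)

/-- The extended Legendre transform `Leg_𝓛 : J¹π → 𝓜π`, given by the Poincaré-Cartan form
`Θ_𝓛 = L η + (∂L/∂uᵅᵢ) θᵅ ∧ i_{∂/∂xⁱ} η`; the second term has the value
`∑ₖ η(X₁, …, a(Xₖ), …, Xₘ)`, where `a` is the map `contactMap`. -/
def Leg (η : VolumeForm m M) (𝓛 : LagrangianDensity m F EE π) (z : J1 m F EE π) :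
    HForm m F EE π m where
  pt := z.pt
  form := lagrangianFunction η 𝓛 z •
      (η.toFun (jetProj m F EE π z)).compContinuousLinearMap (dproj π z.pt) +
    (η.toFun (jetProj m F EE π z)).fderivCompContinuousLinearMap (dproj π z.pt)
      (contactMap (lagrangianFunction η 𝓛) z)
  horizontal v i j hij hi hj := by
    have h1 : η.toFun (jetProj m F EE π z) (fun l => dproj π z.pt (v l)) = 0 :=
      (η.toFun (jetProj m F EE π z)).map_coord_zero i hi
    have h2 : ∀ k, η.toFun (jetProj m F EE π z) (fun l => Function.update
        (fun _ => dproj π z.pt) k (contactMap (lagrangianFunction η 𝓛) z) l (v l)) = 0 := by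
      intro k
      by_cases hk : i = k
      · refine (η.toFun (jetProj m F EE π z)).map_coord_zero j ?_
        rw [Function.update_of_ne (by rintro rfl; exact hij hk)]
        exact hj
      · refine (η.toFun (jetProj m F EE π z)).map_coord_zero i ?_
        rw [Function.update_of_ne hk]
        exact hi
    rw [ContinuousAlternatingMap.add_apply, ContinuousAlternatingMap.smul_apply,
      ContinuousAlternatingMap.fderivCompContinuousLinearMap_apply]
    simp only [h2, Finset.sum_const_zero, add_zero]
    exact (congrArg _ h1).trans (smul_zero _)

/-- The map `Leg_𝓛 ∘ j¹σ` from the base manifold to the extended multimomentum bundle. -/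
def legJet [IsFibration m F EE π] (η : VolumeForm m M) (𝓛 : LagrangianDensity m F EE π)
    (σ : M → E) (x : M) : HForm m F EE π m :=
  Leg η 𝓛 (jet m F EE π σ x)

/-- The action of the real numbers on the extended multimomentum bundle, `(t, ω) ↦ t • η + ω`,
whose orbits are the fibres of the projection to the reduced multimomentum bundle. -/
def HForm.addVol (η : VolumeForm m M) (t : ℝ) (p : HForm m F EE π m) : HForm m F EE π m where
  pt := p.pt
  form := t • (η.toFun (formProj m F EE π m p)).compContinuousLinearMap (dproj π p.pt) + p.form
  horizontal v i j hij hi hj := by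
    have h1 : η.toFun (formProj m F EE π m p) (fun l => dproj π p.pt (v l)) = 0 :=
      (η.toFun (formProj m F EE π m p)).map_coord_zero i hi
    rw [ContinuousAlternatingMap.add_apply, ContinuousAlternatingMap.smul_apply,
      p.horizontal v i j hij hi hj, add_zero]
    exact (congrArg _ h1).trans (smul_zero _)

end Lagrangian

/-! ### The differential of the Lagrangian density and the Tulczyjew morphism -/

section Tulczyjew

variable {π : E → M} [IsFibration m F EE π]

/-- The `(m+1)`-form `α ∧ π₁^*η` at a point of the first jet bundle. -/
def wedgeVol (η : VolumeForm m M) (z : J1 m F EE π) (α : JModel m F →L[ℝ] ℝ) :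
    HForm m (F × (Base m →L[ℝ] F)) (JModel m F) (jetProj m F EE π) (m + 1) where
  pt := z
  form := ContinuousAlternatingMap.alternatizeUncurryFin (α.smulRight
    ((η.toFun (jetProj m F EE π z)).compContinuousLinearMap (dproj (jetProj m F EE π) z)))
  horizontal v i j hij hi hj := by
    rw [ContinuousAlternatingMap.alternatizeUncurryFin_apply]
    refine Finset.sum_eq_zero fun k _ => ?_
    have h1 : η.toFun (jetProj m F EE π z)
        (fun l => dproj (jetProj m F EE π) z (k.removeNth v l)) = 0 := by
      by_cases hk : i = k
      · obtain ⟨l, hl⟩ := Fin.exists_succAbove_eq (x := j) (y := k) (by rintro rfl; exact hij hk)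
        refine (η.toFun (jetProj m F EE π z)).map_coord_zero l ?_
        rw [Fin.removeNth_apply, hl]
        exact hj
      · obtain ⟨l, hl⟩ := Fin.exists_succAbove_eq (x := i) (y := k) hk
        refine (η.toFun (jetProj m F EE π z)).map_coord_zero l ?_
        rw [Fin.removeNth_apply, hl]
        exact hi
    have h2 : (α (v k)) • η.toFun (jetProj m F EE π z)
        (fun l => dproj (jetProj m F EE π) z (k.removeNth v l)) = 0 := by rw [h1, smul_zero]
    exact (congrArg _ h2).trans (smul_zero _)

/-- The differential `d𝓛 = dL ∧ η` of a Lagrangian density `𝓛 = L η`. -/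
def dLagrangian (η : VolumeForm m M) (𝓛 : LagrangianDensity m F EE π) (z : J1 m F EE π) :
    HForm m (F × (Base m →L[ℝ] F)) (JModel m F) (jetProj m F EE π) (m + 1) :=
  wedgeVol η z (mfderiv 𝓘(ℝ, JModel m F) 𝓘(ℝ, ℝ) (lagrangianFunction η 𝓛) z)

/-- The linear form `∑ pⁱ_α duᵅ`, for `q = p dᵐx + ∑ pⁱ_α duᵅ ∧ dᵐ⁻¹xᵢ`. -/
def HFib.mom (q : HFib m F m) (i : Fin m) : F →L[ℝ] ℝ :=
  (q.1.toContinuousMultilinearMap.toContinuousLinearMap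
    (fun k => ((ebasis k, 0) : Base m × F)) i).comp (ContinuousLinearMap.inr ℝ (Base m) F)

variable [FiniteDimensional ℝ F]

variable (m F EE π) in
/-- The first jet bundle of `π ∘ ν : 𝓜π → M`. -/
abbrev JMom : Type _ := J1 m (F × HFib m F m) (HModel m F m) (formProj m F EE π m)

variable [IsManifold 𝓘(ℝ, Base m) ∞ M]

lemma contMDiffAt_pt (p : HForm m F EE π m) :
    ContMDiffAt 𝓘(ℝ, HModel m F m) 𝓘(ℝ, EE) ∞ (HForm.pt : HForm m F EE π m → E) p := by
  have hc := mem_fiberedChartAt (m := m) (F := F) (EE := EE) (π := π) p.pt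
  set c := fiberedChartAt m F EE π p.pt
  have h1 : ContMDiffAt 𝓘(ℝ, HModel m F m) 𝓘(ℝ, HModel m F m) ∞ (c.forms m).tot p :=
    (c.forms m).contMDiffOn_tot.contMDiffAt ((c.forms m).tot.open_source.mem_nhds hc)
  have h2 : ContMDiffAt 𝓘(ℝ, HModel m F m) 𝓘(ℝ, Base m × F) ∞
      (fun y : HModel m F m => (y.1, y.2.1)) ((c.forms m).tot p) := by
    have : ContDiff ℝ ∞ (fun y : HModel m F m => (y.1, y.2.1)) := by fun_prop
    exact this.contMDiff.contMDiffAt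
  have h3 : ContMDiffAt 𝓘(ℝ, Base m × F) 𝓘(ℝ, EE) ∞ c.tot.symm (c.tot p.pt) :=
    c.contMDiffOn_tot_symm.contMDiffAt (c.tot.open_target.mem_nhds (c.tot.map_source hc))
  have h4 : ContMDiffAt 𝓘(ℝ, HModel m F m) 𝓘(ℝ, EE) ∞
      (fun y : HModel m F m => c.tot.symm (y.1, y.2.1)) ((c.forms m).tot p) :=
    ContMDiffAt.comp (f := fun y : HModel m F m => (y.1, y.2.1)) (g := c.tot.symm) _ h3 h2
  refine (ContMDiffAt.comp p (f := (c.forms m).tot) h4 h1).congr_of_eventuallyEq ?_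
  filter_upwards [(c.forms m).tot.open_source.mem_nhds hc] with q hq
  exact (c.tot.left_inv (x := q.pt) hq).symm

/-- The first jet of a local section `τ` of `π ∘ ν : 𝓜π → M`. -/
def jetMom (τ : M → HForm m F EE π m) (x : M) : JMom m F EE π :=
  jet m (F × HFib m F m) (HModel m F m) (formProj m F EE π m) τ x

/-- The differential at `p` of the projection of the bundle of 2-horizontal forms to `E`. -/
def HForm.dpt {k : ℕ} (p : HForm m F EE π k) : HModel m F k →L[ℝ] EE :=
  mfderiv 𝓘(ℝ, HModel m F k) 𝓘(ℝ, EE) (HForm.pt : HForm m F EE π k → E) p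

lemma dproj_formProj (p : HForm m F EE π m) :
    (dproj (formProj m F EE π m) p : HModel m F m →L[ℝ] Base m) = (dproj π p.pt).comp p.dpt := by
  have h : ContMDiffAt 𝓘(ℝ, EE) 𝓘(ℝ, Base m) ∞ π p.pt :=
    (fiberedChartAt m F EE π p.pt).proj_contMDiffAt (mem_fiberedChartAt p.pt)
  exact mfderiv_comp p (h.mdifferentiableAt (by simp))
    ((contMDiffAt_pt p).mdifferentiableAt (by simp))

variable (m F EE π) in
/-- The prolongation `j¹ν` of the projection `ν : 𝓜π → E`. -/
def j1nu (z : JMom m F EE π) : J1 m F EE π where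
  pt := z.pt.pt
  lin := z.pt.dpt.comp z.lin
  isSection := by
    have h := z.isSection
    rw [dproj_formProj] at h
    exact h

/-- The function `ρ` with `η = ρ dᵐx` in a fibered chart. -/
def FiberedChart.density (c : FiberedChart m F EE π) (η : VolumeForm m M) (x : M) : ℝ :=
  η.toFun x (fun i => c.dbaseSymm (c.base x) (ebasis i))

/-- In the natural coordinates `(xⁱ, uᵅ, p, pⁱ_α, uᵅⱼ, pⱼ, pⁱ_αⱼ)` of a point of `J¹(π ∘ ν)`, the
linear form `pⁱ_αᵢ duᵅ + pⁱ_α duᵅᵢ` on the tangent space of `J¹π`. -/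
def FiberedChart.momentumForm (c : FiberedChart m F EE π) (z : JMom m F EE π) :
    JModel m F →L[ℝ] ℝ :=
  (∑ i : Fin m,
    ((HFib.mom (((c.forms m).jetCoord z).2.2 (ebasis i)).2 i).comp
        ((ContinuousLinearMap.fst ℝ F (Base m →L[ℝ] F)).comp
          (ContinuousLinearMap.snd ℝ (Base m) (F × (Base m →L[ℝ] F)))) +
      (HFib.mom ((c.forms m).jetCoord z).2.1.2 i).comp
        ((ContinuousLinearMap.apply ℝ F (ebasis i)).comp
          ((ContinuousLinearMap.snd ℝ F (Base m →L[ℝ] F)).comp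
            (ContinuousLinearMap.snd ℝ (Base m) (F × (Base m →L[ℝ] F))))))).comp
    (c.jet.dtot (j1nu m F EE π z))

/-- The Tulczyjew morphism `A : J¹(π ∘ ν) → Λ₂ᵐ⁺¹ J¹π`, in natural coordinates
`(pⁱ_αᵢ duᵅ + pⁱ_α duᵅᵢ) ∧ dᵐx`. It is evaluated in a fibered chart around the point; the result
does not depend on the chart. -/
def tulczyjew (η : VolumeForm m M) (z : JMom m F EE π) :
    HForm m (F × (Base m →L[ℝ] F)) (JModel m F) (jetProj m F EE π) (m + 1) :=
  wedgeVol η (j1nu m F EE π z)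
    (((fiberedChartAt m F EE π z.pt.pt).density η (π z.pt.pt))⁻¹ •
      (fiberedChartAt m F EE π z.pt.pt).momentumForm z)

/-- The set `S_𝓛`, the inverse image of the image of `d𝓛` under the Tulczyjew morphism. -/
def lagrangianSet (η : VolumeForm m M) (𝓛 : LagrangianDensity m F EE π) :
    Set (JMom m F EE π) :=
  {z | tulczyjew η z ∈ Set.range (dLagrangian η 𝓛)}

/-! ### Multisymplectic forms -/

/-- The exterior derivative of a `k`-form on a manifold, computed at each point in the preferred
chart. -/
def mextDeriv {V X : Type*} [NormedAddCommGroup V] [NormedSpace ℝ V] [TopologicalSpace X]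
    [ChartedSpace V X] {k : ℕ} (θ : X → V [⋀^Fin k]→L[ℝ] ℝ) (x : X) :
    V [⋀^Fin (k + 1)]→L[ℝ] ℝ :=
  (extDeriv (fun y : V => (θ ((chartAt V x).symm y)).compContinuousLinearMap
      (mfderiv 𝓘(ℝ, V) 𝓘(ℝ, V) (chartAt V x).symm y)) (chartAt V x x)).compContinuousLinearMap
    (mfderiv 𝓘(ℝ, V) 𝓘(ℝ, V) (chartAt V x) x)

variable {k : ℕ}

/-- The tautological form `Θ` on the bundle of 2-horizontal `k`-forms. -/
def tautologicalForm (p : HForm m F EE π k) : (HModel m F k) [⋀^Fin k]→L[ℝ] ℝ :=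
  p.form.compContinuousLinearMap p.dpt

/-- The canonical multisymplectic form `Ω = - dΘ`. -/
def multisymplecticForm (p : HForm m F EE π k) : (HModel m F k) [⋀^Fin (k + 1)]→L[ℝ] ℝ :=
  - mextDeriv (V := HModel m F k) (tautologicalForm (π := π)) p

/-- The premultisymplectic `(m+2)`-form on `J¹(π ∘ ν)`, the pullback of the canonical
multisymplectic form by the Tulczyjew morphism. -/
def premultisymplecticForm (η : VolumeForm m M) (z : JMom m F EE π) :
    (JModel m (F × HFib m F m)) [⋀^Fin (m + 1 + 1)]→L[ℝ] ℝ :=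
  (multisymplecticForm (tulczyjew η z)).compContinuousLinearMap
    (mfderiv 𝓘(ℝ, JModel m (F × HFib m F m))
      𝓘(ℝ, HModel m (F × (Base m →L[ℝ] F)) (m + 1)) (tulczyjew (π := π) η) z)

end Tulczyjew

/-! ### Lagrangian submanifolds -/

section LagrangianSubmanifolds

variable {V : Type*} [NormedAddCommGroup V] [NormedSpace ℝ V] {k : ℕ}

/-- The map `v ↦ i_v Ω` of a `(k+1)`-form. -/
def flat (Ω : V [⋀^Fin (k + 1)]→L[ℝ] ℝ) : V →ₗ[ℝ] V [⋀^Fin k]→ₗ[ℝ] ℝ :=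
  Ω.toAlternatingMap.curryLeft

/-- The `l`-orthogonal complement of `W`: the vectors `v` such that `i_{v ∧ w₁ ∧ … ∧ w_l} Ω = 0`
for all `w₁, …, w_l` in `W`. -/
def orthogonal (Ω : V [⋀^Fin (k + 1)]→L[ℝ] ℝ) (W : Submodule ℝ V) (l : ℕ) : Submodule ℝ V where
  carrier := {v | ∀ w : Fin k → V, (∀ i : Fin k, (i : ℕ) < l → w i ∈ W) → flat Ω v w = 0}
  add_mem' {v v'} hv hv' w hw := by
    rw [map_add, AlternatingMap.add_apply, hv w hw, hv' w hw, add_zero]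
  zero_mem' w hw := by rw [map_zero, AlternatingMap.zero_apply]
  smul_mem' t v hv w hw := by rw [map_smul, AlternatingMap.smul_apply, hv w hw, smul_zero]

/-- `l`-Lagrangian subspaces of a premultisymplectic vector space: the image `W'` of `W` in the
multisymplectic quotient `V / ker ♭` is equal to its `l`-orthogonal complement. The inverse image
of `W'` in `V` is `W + ker ♭`, and the inverse image of the `l`-orthogonal complement of `W'` is the
`l`-orthogonal complement of `W`. -/
def IsLagrangianSubspace (Ω : V [⋀^Fin (k + 1)]→L[ℝ] ℝ) (l : ℕ) (W : Submodule ℝ V) : Prop :=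
  W ⊔ LinearMap.ker (flat Ω) = orthogonal Ω W l

variable {P : Type*} [NormedAddCommGroup P] [NormedSpace ℝ P]
  {X : Type*} [TopologicalSpace X] [ChartedSpace V X]

variable (V) in
/-- The kernel of the differential of a map at a point. -/
def kerDeriv (f : X → P) (x : X) : Submodule ℝ V :=
  LinearMap.ker (mfderiv 𝓘(ℝ, V) 𝓘(ℝ, P) f x : V →L[ℝ] P).toLinearMap

variable (V) in
/-- `f = 0` are local equations in the open set `O` of the submanifold `S`: in `O` the set `S` is
the zero set of the smooth map `f`, whose differential is surjective along `S`. -/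
structure IsLocalEquations (O : Set X) (f : X → P) (S : Set X) : Prop where
  isOpen : IsOpen O
  contMDiffOn : ContMDiffOn 𝓘(ℝ, V) 𝓘(ℝ, P) ∞ f O
  mem_iff : ∀ x ∈ O, x ∈ S ↔ f x = 0
  surjective : ∀ x ∈ O ∩ S, Function.Surjective (mfderiv 𝓘(ℝ, V) 𝓘(ℝ, P) f x : V →L[ℝ] P)

variable (V) in
/-- `S` is an (embedded) submanifold all of whose tangent spaces are `l`-Lagrangian. The tangent
space is the kernel of the differential of local equations. -/
def IsLagrangianSubmanifold (Ω : X → V [⋀^Fin (k + 1)]→L[ℝ] ℝ) (l : ℕ) (S : Set X) : Prop :=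
  ∀ x ∈ S, ∃ (d : ℕ) (O : Set X) (f : X → EuclideanSpace ℝ (Fin d)), x ∈ O ∧
    IsLocalEquations V O f S ∧ IsLagrangianSubspace (Ω x) l (kerDeriv V f x)

end LagrangianSubmanifolds

/-! ### The Euler-Lagrange equations -/

section EulerLagrange

variable {n : ℕ} {π : E → M} [IsFibration m (Base n) EE π]
  (c : FiberedChart m (Base n) EE π) (𝓛 : LagrangianDensity m (Base n) EE π)

/-- The function `L(xⁱ, uᵅ, uᵅᵢ)` with `𝓛 = L dᵐx` in natural coordinates. -/
def FiberedChart.localLagrangian (y : JModel m (Base n)) : ℝ :=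
  𝓛 (c.jetOfCoord y) (fun i => c.dbaseSymm y.1 (ebasis i))

/-- The partial derivative `∂L/∂uᵅ`. -/
def FiberedChart.dLdu (α : Fin n) (y : JModel m (Base n)) : ℝ :=
  fderiv ℝ (c.localLagrangian 𝓛) y (0, (ebasis α, 0))

/-- The partial derivative `∂L/∂uᵅᵢ`. -/
def FiberedChart.dLdv (α : Fin n) (i : Fin m) (y : JModel m (Base n)) : ℝ :=
  fderiv ℝ (c.localLagrangian 𝓛) y (0, (0, (EuclideanSpace.proj i).smulRight (ebasis α)))

/-- The coordinate expression `uᵅ(xⁱ)` of a section. -/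
def FiberedChart.coordSection (σ : M → E) (x : Base m) : Base n :=
  (c.tot (σ (c.base.symm x))).2

/-- The coordinate expression `(xⁱ, uᵅ(x), ∂uᵅ/∂xⁱ(x))` of the first jet of a section. -/
def FiberedChart.coordJet (σ : M → E) (x : Base m) : JModel m (Base n) :=
  (x, (c.coordSection σ x, fderiv ℝ (c.coordSection σ) x))

/-- The Euler-Lagrange equations `∂L/∂uᵅ - d/dxⁱ (∂L/∂uᵅᵢ) = 0` along the first jet of a local
section over `U`, in every system of fibered coordinates. -/
def IsEulerLagrange (U : Set M) (σ : M → E) : Prop :=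
  ∀ c : FiberedChart m (Base n) EE π, ∀ x ∈ U, σ x ∈ c.tot.source → ∀ α : Fin n,
    c.dLdu 𝓛 α (c.coordJet σ (c.base x)) -
      ∑ i : Fin m, fderiv ℝ (fun y => c.dLdv 𝓛 α i (c.coordJet σ y)) (c.base x) (ebasis i) = 0

variable [IsManifold 𝓘(ℝ, Base m) ∞ M]

/-- The equations `pⁱ_α = ∂L/∂uᵅᵢ` and `pⁱ_αᵢ = ∂L/∂uᵅ` on `J¹(π ∘ ν)`, in the natural coordinates
`(xⁱ, uᵅ, p, pⁱ_α, uᵅⱼ, pⱼ, pⁱ_αⱼ)`; here `pⁱ_αⱼ` is the jet coordinate that corresponds to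
`∂pⁱ_α/∂xʲ`. -/
def FiberedChart.elEquations (z : JMom m (Base n) EE π) : (Fin m → Fin n → ℝ) × (Fin n → ℝ) :=
  (fun i α => HFib.mom ((c.forms m).jetCoord z).2.1.2 i (ebasis α) -
      c.dLdv 𝓛 α i (c.jetCoord (j1nu m (Base n) EE π z)),
    fun α => ∑ i : Fin m, HFib.mom (((c.forms m).jetCoord z).2.2 (ebasis i)).2 i (ebasis α) -
      c.dLdu 𝓛 α (c.jetCoord (j1nu m (Base n) EE π z)))

end EulerLagrange

end Fibrations
end
end Tulczyjew

open Tulczyjew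

namespace Tulczyjew

noncomputable section

-- Natural coordinates make both sides explicit. A 2-horizontal `(m+1)`-form over an `m`-dimensional
-- base has the shape `α ∧ dᵐx` with `α` a linear form on the fibre (`HFib.dualEquiv`): `m+1` base
-- vectors are linearly dependent, and one vertical slot leaves a top form on the base. In these
-- terms the Tulczyjew morphism `A` sends a jet to the linear form `pⁱ_αᵢ duᵅ + pⁱ_α duᵅᵢ`
-- (`FiberedChart.vertPart_tulczyjew`), and `d𝓛` becomes the fibre derivative of the local
-- Lagrangian (`FiberedChart.vertPart_dLagrangian`), because the density of `η` depends on the base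
-- alone. Comparing components turns `A(z) = d𝓛(j¹ν(z))` into the equations `elEquations`
-- (`FiberedChart.tulczyjew_eq_dLagrangian_iff`).
--
-- To compute `A` in an arbitrary chart one needs its independence of the chart,
-- `FiberedChart.momentumForm_trans`. If `P` is a section of `𝓜π` and `g` a vertical variation along
-- it, then by the Leibniz rule the momentum form at `j¹P`, evaluated on `j¹g`, is the divergence
-- `∑ᵢ ∂ᵢ(pⁱ(g))`. This is the exterior derivative of the `(m-1)`-form `i_g P`
-- (`extDeriv_contract`). Since `d` commutes with pullback, a change of coordinates multiplies it by
-- the Jacobian of the base (`divergence_transform`), and the density of `η` is multiplied by the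
-- same factor.
--
-- Along `j¹τ` the sums `pⁱ_αᵢ` are divergences of the momenta of `τ`. For `τ = Leg ∘ j¹σ` the first
-- half of the equations holds identically and the second half becomes the Euler-Lagrange equations.
-- For general `τ` the first half says that `τ` has the momenta of the Legendre transform, that is,
-- differs from it by a multiple of `η`.
--
-- For the Lagrangian property, `A` is a linear surjection in coordinates (`tulL_surjective`, where
-- `m ≥ 1` enters), and `S_𝓛` is the inverse image of the image of the section `d𝓛`. This section is
-- closed: in coordinates it is `d(f dᵐx)`, so the canonical form vanishes on its tangent spaces.
-- Conversely, testing a vector against all tangent vectors recovers its deviation from the tangent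
-- space. `isLagrangianSubspace_of_section` is this argument as linear algebra. The canonical form
-- is computed in the preferred chart of `J¹π`, the equations in the chart induced from `E`;
-- `dtot_eq_sectionDeriv_iff` describes tangency to the image of `d𝓛` without charts and reconciles
-- the two.

local instance HFib.seminormedAddCommGroup {m k : ℕ} {F : Type*} [NormedAddCommGroup F]
    [NormedSpace ℝ F] : SeminormedAddCommGroup (HFib m F k) :=
  instNormedAddCommGroupHFib.toSeminormedAddCommGroup

local instance HFib.normedSpace {m k : ℕ} {F : Type*} [NormedAddCommGroup F] [NormedSpace ℝ F] :
    @NormedSpace ℝ (HFib m F k) _ instNormedAddCommGroupHFib.toSeminormedAddCommGroup :=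
  instNormedSpaceHFib

local instance HFib.t2Space {m k : ℕ} {F : Type*} [NormedAddCommGroup F] [NormedSpace ℝ F] :
    T2Space (HFib m F k) := inferInstance

local instance HFib.isTopologicalAddGroup {m k : ℕ} {F : Type*} [NormedAddCommGroup F]
    [NormedSpace ℝ F] : IsTopologicalAddGroup (HFib m F k) := inferInstance

local instance HFib.continuousSMul {m k : ℕ} {F : Type*} [NormedAddCommGroup F] [NormedSpace ℝ F] :
    ContinuousSMul ℝ (HFib m F k) := inferInstance

local instance Base.continuousSMul {m : ℕ} : ContinuousSMul ℝ (Base m) := inferInstance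

local instance Base.isTopologicalAddGroup {m : ℕ} : IsTopologicalAddGroup (Base m) := inferInstance

local instance Base.t2Space {m : ℕ} : T2Space (Base m) := inferInstance

/-! ### Linear algebra of top-degree and 2-horizontal forms -/

section LinearAlgebra

/-- The standard volume form on the model space of the base. -/
def stdVol (m : ℕ) : (Base m) [⋀^Fin m]→L[ℝ] ℝ :=
  { (EuclideanSpace.basisFun (Fin m) ℝ).toBasis.det with
    cont := by
      change Continuous fun v : Fin m → Base m => (EuclideanSpace.basisFun (Fin m) ℝ).toBasis.det v
      simp only [Module.Basis.det_apply]
      refine Continuous.matrix_det ?_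
      refine continuous_matrix fun i j => ?_
      simp only [Module.Basis.toMatrix_apply, OrthonormalBasis.coe_toBasis_repr_apply,
        EuclideanSpace.basisFun_repr]
      fun_prop }

variable {m : ℕ}

lemma stdVol_apply (v : Fin m → Base m) :
    stdVol m v = (EuclideanSpace.basisFun (Fin m) ℝ).toBasis.det v := rfl

lemma coe_basisFun_toBasis :
    (⇑(EuclideanSpace.basisFun (Fin m) ℝ).toBasis : Fin m → Base m) = fun i => ebasis i := by
  ext1 i
  simp

lemma stdVol_ebasis : stdVol m (fun i => ebasis i) = 1 := by
  rw [stdVol_apply, ← coe_basisFun_toBasis, Module.Basis.det_self]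

lemma form_eq_smul_stdVol (f : (Base m) [⋀^Fin m]→L[ℝ] ℝ) :
    f = f (fun i => ebasis i) • stdVol m := by
  ext v
  exact eq_smul_det f v

lemma form_comp_eq_det (f : (Base m) [⋀^Fin m]→L[ℝ] ℝ) (A : Base m →L[ℝ] Base m) :
    f.compContinuousLinearMap A = A.det • f := by
  ext v
  rw [eq_smul_det (f.compContinuousLinearMap A) v, ContinuousAlternatingMap.smul_apply,
    eq_smul_det f v, ContinuousAlternatingMap.compContinuousLinearMap_apply]
  rw [eq_smul_det f, ← coe_basisFun_toBasis]
  have := (EuclideanSpace.basisFun (Fin m) ℝ).toBasis.det_comp A.toLinearMap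
    (EuclideanSpace.basisFun (Fin m) ℝ).toBasis
  have h2 : (EuclideanSpace.basisFun (Fin m) ℝ).toBasis.det
      (⇑A ∘ (EuclideanSpace.basisFun (Fin m) ℝ).toBasis) = A.det := by
    refine this.trans ?_
    rw [Module.Basis.det_self, mul_one]
  rw [smul_eq_mul]
  refine Eq.trans (congrArg (fun t => f _ * t * _) h2) ?_
  ring

lemma form_eq_zero_of_lt {k : ℕ} (hk : m < k) (f : (Base m) [⋀^Fin k]→L[ℝ] ℝ) : f = 0 := by
  ext v
  refine f.toAlternatingMap.map_linearDependent v fun h => ?_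
  have := h.fintype_card_le_finrank
  simp at this
  omega

variable {F : Type*} [NormedAddCommGroup F] [NormedSpace ℝ F] {k : ℕ}

/-- Expand each argument as horizontal plus vertical part by multilinearity; every term with at
least two vertical slots vanishes, which leaves the terms with no or one vertical slot. -/
lemma HFib.apply_eq (q : HFib m F k) (v : Fin k → Base m × F) :
    q.1 v = q.1 (fun i => ((v i).1, 0)) +
      ∑ i, q.1 (Function.update (fun j => ((v j).1, 0)) i (0, (v i).2)) := by
  have h := q.1.toMultilinearMap.map_add_eq_map_add_linearDeriv_add
    (fun i => ((v i).1, 0)) (fun i => (0, (v i).2))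
  have h0 : ((fun i => ((v i).1, 0)) + (fun i => (0, (v i).2)) : Fin k → Base m × F) = v := by
    ext1 i; simp
  rw [h0] at h
  have h1 : ∀ s ∈ Finset.univ.filter (fun s : Finset (Fin k) => 2 ≤ s.card),
      q.1.toMultilinearMap (s.piecewise (fun i => ((0 : Base m), (v i).2))
        (fun i => ((v i).1, 0))) = 0 := by
    intro s hs
    have hs2 := (Finset.mem_filter.1 hs).2
    obtain ⟨i, hi, j, hj, hij⟩ := Finset.one_lt_card.1 hs2
    exact q.2 _ i j hij (by simp [hi]) (by simp [hj])
  rw [Finset.sum_eq_zero h1, add_zero] at h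
  simpa using h

lemma HFib.eq_zero_of (q : HFib m F k) (h0 : ∀ a : Fin k → Base m, q.1 (fun i => (a i, 0)) = 0)
    (h1 : ∀ (a : Fin k → Base m) (i : Fin k) (g : F),
      q.1 (Function.update (fun j => (a j, 0)) i (0, g)) = 0) : q = 0 := by
  apply Subtype.ext
  ext v
  rw [HFib.apply_eq q v, h0 (fun i => (v i).1)]
  simp [h1 (fun i => (v i).1)]

lemma update_eq_insertNth {X : Type*} (v : Fin (k + 1) → X) (i : Fin (k + 1)) (x : X) :
    Function.update v i x = i.insertNth x (i.removeNth v) := by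
  rw [Fin.insertNth_removeNth]

/-- Moving the vertical vector from slot `i` to the front costs the sign `(-1)^i`; what remains is a
form on the base alone. -/
lemma update_mem_horizontal (q : HFib m F (k + 1)) (a : Fin (k + 1) → Base m) (i : Fin (k + 1))
    (g : F) : q.1 (Function.update (fun j => (a j, 0)) i (0, g)) =
      (-1) ^ (i : ℕ) • ((q.1.curryLeft (0, g)).compContinuousLinearMap
        (ContinuousLinearMap.inl ℝ (Base m) F)) (i.removeNth a) := by
  rw [update_eq_insertNth, ContinuousAlternatingMap.map_insertNth]
  rfl

/-- The linear form `α` on the fibre, for `q = α ∧ dᵐx`. -/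
def HFib.vertPart (q : HFib m F (m + 1)) : F →L[ℝ] ℝ :=
  (q.1.toContinuousMultilinearMap.toContinuousLinearMap
    (Fin.cons 0 (fun i => ((ebasis i, 0) : Base m × F))) 0).comp
      (ContinuousLinearMap.inr ℝ (Base m) F)

lemma HFib.vertPart_apply (q : HFib m F (m + 1)) (g : F) :
    HFib.vertPart q g = q.1 (Fin.cons (0, g) (fun i => ((ebasis i, 0) : Base m × F))) := by
  change q.1 (Function.update (Fin.cons 0 (fun i => ((ebasis i, 0) : Base m × F))) 0 (0, g)) = _
  rw [Fin.update_cons_zero]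

/-- With no vertical slot the form is an `(m+1)`-form on an `m`-dimensional space. With one vertical
slot it is a top-degree form on the base, hence determined by its value on the standard basis, which
is the vertical part. -/
lemma HFib.eq_zero_of_vertPart {q : HFib m F (m + 1)} (h : HFib.vertPart q = 0) : q = 0 := by
  refine HFib.eq_zero_of q (fun a => ?_) (fun a i g => ?_)
  · have := form_eq_zero_of_lt (Nat.lt_succ_self m)
      (q.1.compContinuousLinearMap (ContinuousLinearMap.inl ℝ (Base m) F))
    exact DFunLike.congr_fun this a
  · rw [update_mem_horizontal, form_eq_smul_stdVol ((q.1.curryLeft (0, g)).compContinuousLinearMap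
        (ContinuousLinearMap.inl ℝ (Base m) F))]
    have h2 : ((q.1.curryLeft (0, g)).compContinuousLinearMap
        (ContinuousLinearMap.inl ℝ (Base m) F)) (fun i => ebasis i) = HFib.vertPart q g :=
      (HFib.vertPart_apply q g).symm
    rw [h2, h]
    simp

/-- The form `α ∧ θ` on the product, where `θ` is a top degree form on the base. -/
def wedgeFst (θ : (Base m) [⋀^Fin m]→L[ℝ] ℝ) (α : Base m × F →L[ℝ] ℝ) : HFib m F (m + 1) :=
  ⟨ContinuousAlternatingMap.alternatizeUncurryFin (α.smulRight
    (θ.compContinuousLinearMap (ContinuousLinearMap.fst ℝ (Base m) F))), by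
    intro v i j hij hi hj
    rw [ContinuousAlternatingMap.alternatizeUncurryFin_apply]
    refine Finset.sum_eq_zero fun l _ => ?_
    have h1 : θ (fun r => (l.removeNth v r).1) = 0 := by
      by_cases hk : i = l
      · obtain ⟨r, hr⟩ := Fin.exists_succAbove_eq (x := j) (y := l) (by rintro rfl; exact hij hk)
        refine θ.map_coord_zero r ?_
        rw [Fin.removeNth_apply, hr]
        exact hj
      · obtain ⟨r, hr⟩ := Fin.exists_succAbove_eq (x := i) (y := l) hk
        refine θ.map_coord_zero r ?_
        rw [Fin.removeNth_apply, hr]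
        exact hi
    have h2 : (α (v l)) • θ (fun r => (l.removeNth v r).1) = 0 := by rw [h1, smul_zero]
    exact (congrArg _ h2).trans (smul_zero _)⟩

lemma wedgeFst_apply (θ : (Base m) [⋀^Fin m]→L[ℝ] ℝ) (α : Base m × F →L[ℝ] ℝ)
    (v : Fin (m + 1) → Base m × F) :
    (wedgeFst θ α).1 v =
      ∑ i : Fin (m + 1), (-1) ^ (i : ℕ) • (α (v i) * θ (fun r => (i.removeNth v r).1)) := by
  change ContinuousAlternatingMap.alternatizeUncurryFin _ v = _
  rw [ContinuousAlternatingMap.alternatizeUncurryFin_apply]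
  rfl

/-- Only the summand in which `α` takes the vertical vector survives; in the others that vector goes
into `θ`, which sees its zero base component. -/
lemma vertPart_wedgeFst (θ : (Base m) [⋀^Fin m]→L[ℝ] ℝ) (α : Base m × F →L[ℝ] ℝ) :
    HFib.vertPart (wedgeFst θ α) =
      θ (fun i => ebasis i) • α.comp (ContinuousLinearMap.inr ℝ (Base m) F) := by
  ext g
  rw [HFib.vertPart_apply, wedgeFst_apply, Fin.sum_univ_succ, Finset.sum_eq_zero]
  · simp [Fin.removeNth, mul_comm]
  · intro i _
    have : θ (fun r => (i.succ.removeNth (Fin.cons ((0 : Base m), g)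
        (fun i => ((ebasis i, 0) : Base m × F)) : Fin (m + 1) → Base m × F) r).1) = 0 := by
      obtain ⟨r, hr⟩ := Fin.exists_succAbove_eq (x := (0 : Fin (m + 1))) (y := i.succ)
        (Fin.succ_ne_zero i).symm
      refine θ.map_coord_zero r ?_
      rw [Fin.removeNth_apply, hr]
      rfl
    rw [this, mul_zero, smul_zero]

lemma HFib.ext_vertPart {p q : HFib m F (m + 1)} (h : HFib.vertPart p = HFib.vertPart q) :
    p = q := by
  rw [← sub_eq_zero]
  apply HFib.eq_zero_of_vertPart
  ext g
  have := DFunLike.congr_fun h g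
  rw [HFib.vertPart_apply, HFib.vertPart_apply] at this
  rw [HFib.vertPart_apply]
  simpa [sub_eq_zero] using this

variable (m F) in
/-- Two-horizontal `(m + 1)`-forms are the products of a linear form on the fibre with `dᵐx`. -/
def HFib.dualEquiv : HFib m F (m + 1) ≃ₗ[ℝ] (F →L[ℝ] ℝ) where
  toFun := HFib.vertPart
  map_add' p q := by
    ext g
    simp [HFib.vertPart_apply]
  map_smul' t q := by
    ext g
    simp [HFib.vertPart_apply]
  invFun α := wedgeFst (stdVol m) (α.comp (ContinuousLinearMap.snd ℝ (Base m) F))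
  left_inv q := by
    apply HFib.ext_vertPart
    rw [vertPart_wedgeFst, stdVol_ebasis, one_smul]
    rfl
  right_inv α := by
    rw [vertPart_wedgeFst, stdVol_ebasis, one_smul]
    rfl

lemma HFib.dualEquiv_apply (q : HFib m F (m + 1)) : HFib.dualEquiv m F q = HFib.vertPart q := rfl

lemma HFib.mom_apply (q : HFib m F m) (i : Fin m) (g : F) :
    HFib.mom q i g = q.1 (Function.update (fun k => ((ebasis k, 0) : Base m × F)) i (0, g)) := rfl

lemma HFib.mom_add (p q : HFib m F m) (i : Fin m) :
    HFib.mom (p + q) i = HFib.mom p i + HFib.mom q i := by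
  ext g; simp [HFib.mom_apply]

lemma HFib.mom_smul (t : ℝ) (q : HFib m F m) (i : Fin m) :
    HFib.mom (t • q) i = t • HFib.mom q i := by
  ext g; simp [HFib.mom_apply]

lemma HFib.mom_sub (p q : HFib m F m) (i : Fin m) :
    HFib.mom (p - q) i = HFib.mom p i - HFib.mom q i := by
  ext g; simp [HFib.mom_apply]

/-- The values of `s` away from `i` miss some index `t`; redefining `s i` as `t` gives an injective,
hence bijective, map. -/
lemma exists_perm_of_injOn_compl {s : Fin m → Fin m} {i : Fin m}
    (hs : ∀ j l, j ≠ i → l ≠ i → s j = s l → j = l) :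
    ∃ σ : Equiv.Perm (Fin m), ∀ j, j ≠ i → σ j = s j := by
  classical
  have hc : (Finset.image s (Finset.univ.erase i)).card < (Finset.univ : Finset (Fin m)).card := by
    refine Finset.card_image_le.trans_lt ?_
    exact Finset.card_erase_lt_of_mem (Finset.mem_univ i)
  obtain ⟨t, -, ht⟩ := Finset.exists_mem_notMem_of_card_lt_card hc
  have ht' : ∀ j, j ≠ i → s j ≠ t := fun j hj h =>
    ht (Finset.mem_image.2 ⟨j, Finset.mem_erase.2 ⟨hj, Finset.mem_univ j⟩, h⟩)
  have hinj : Function.Injective (Function.update s i t) := by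
    intro j l h
    by_cases hj : j = i <;> by_cases hl : l = i
    · rw [hj, hl]
    · subst hj
      rw [Function.update_self, Function.update_of_ne hl] at h
      exact absurd h.symm (ht' l hl)
    · subst hl
      rw [Function.update_self, Function.update_of_ne hj] at h
      exact absurd h (ht' j hj)
    · rw [Function.update_of_ne hj, Function.update_of_ne hl] at h
      exact hs j l hj hl h
  refine ⟨Equiv.ofBijective _ (Finite.injective_iff_bijective.1 hinj), fun j hj => ?_⟩
  exact Function.update_of_ne hj t s

/-- A 2-horizontal `m`-form has no coordinates besides `p` and the momenta. -/
lemma HFib.eq_zero_of_mom {q : HFib m F m} (h0 : q.1 (fun i => (ebasis i, 0)) = 0)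
    (h : ∀ i, HFib.mom q i = 0) : q = 0 := by
  refine HFib.eq_zero_of q (fun a => ?_) (fun a i g => ?_)
  · have h1 := form_eq_smul_stdVol
      (q.1.compContinuousLinearMap (ContinuousLinearMap.inl ℝ (Base m) F))
    have h2 := DFunLike.congr_fun h1 a
    have h3 : q.1.compContinuousLinearMap (ContinuousLinearMap.inl ℝ (Base m) F)
      (fun i => ebasis i) = 0 := h0
    rw [h3, zero_smul] at h2
    exact h2
  -- On basis vectors: if those outside slot `i` are distinct, a permutation reduces the value to a
  -- momentum; if two coincide, the form vanishes by alternation.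
  · have key : ∀ s : Fin m → Fin m,
        q.1 (Function.update (fun j => ((ebasis (s j), 0) : Base m × F)) i (0, g)) = 0 := by
      intro s
      by_cases hs : ∀ j l, j ≠ i → l ≠ i → s j = s l → j = l
      · obtain ⟨σ, hσ⟩ := exists_perm_of_injOn_compl hs
        have e : (Function.update (fun j => ((ebasis (s j), 0) : Base m × F)) i (0, g)) =
            (Function.update (fun j => ((ebasis j, 0) : Base m × F)) (σ i) (0, g)) ∘ σ := by
          ext1 j
          by_cases hj : j = i
          · subst hj; simp
          · rw [Function.comp_apply, Function.update_of_ne hj,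
              Function.update_of_ne (fun h => hj (σ.injective h)), hσ j hj]
        rw [e]
        have := q.1.toAlternatingMap.map_perm
          (Function.update (fun j => ((ebasis j, 0) : Base m × F)) (σ i) (0, g)) σ
        refine this.trans ?_
        have h4 : q.1.toAlternatingMap
            (Function.update (fun j => ((ebasis j, 0) : Base m × F)) (σ i) (0, g)) = 0 :=
          DFunLike.congr_fun (h (σ i)) g
        rw [h4, smul_zero]
      · push Not at hs
        obtain ⟨j, l, hj, hl, hjl, hne⟩ := hs
        refine q.1.map_eq_zero_of_eq _ ?_ hne
        rw [Function.update_of_ne hj, Function.update_of_ne hl, hjl]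
    -- The expression does not depend on `a i`, so it is not multilinear in all of `a`. The factor
    -- `a i i` makes it so, which allows a check on basis vectors; setting `a i` to the basis vector
    -- `ebasis i` removes the factor again.
    obtain ⟨A, hA⟩ : ∃ A : MultilinearMap ℝ (fun _ : Fin m => Base m) ℝ,
        ∀ a, A a = a i i * q.1 (Function.update (fun j => (a j, 0)) i (0, g)) := by
      refine ⟨q.1.toMultilinearMap.compLinearMap (fun j => if j = i then
        ((LinearMap.toSpanSingleton ℝ (Base m × F) (0, g)).comp
          (EuclideanSpace.proj i : Base m →L[ℝ] ℝ).toLinearMap)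
        else LinearMap.inl ℝ (Base m) F), fun a => ?_⟩
      rw [MultilinearMap.compLinearMap_apply]
      have e : (fun j => (if j = i then ((LinearMap.toSpanSingleton ℝ (Base m × F) (0, g)).comp
          (EuclideanSpace.proj i : Base m →L[ℝ] ℝ).toLinearMap)
        else LinearMap.inl ℝ (Base m) F) (a j)) =
          Function.update (fun j => (a j, 0)) i ((a i i) • ((0, g) : Base m × F)) := by
        ext1 j
        by_cases hj : j = i
        · subst hj; simp
        · simp [hj]
      rw [e]
      exact q.1.map_update_smul _ i (a i i) (0, g)
    have hA0 : A = 0 := by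
      refine Module.Basis.ext_multilinear
        (fun _ => (EuclideanSpace.basisFun (Fin m) ℝ).toBasis) fun s => ?_
      rw [hA, coe_basisFun_toBasis, key s, mul_zero]
      rfl
    have h5 := hA (Function.update a i (ebasis i))
    rw [hA0] at h5
    have e : Function.update (fun j => ((Function.update a i (ebasis i) j, 0) : Base m × F)) i
        (0, g) = Function.update (fun j => (a j, 0)) i (0, g) := by
      ext1 j
      by_cases hj : j = i
      · subst hj; simp
      · simp [hj]
    rw [e] at h5
    simpa using h5.symm

end LinearAlgebra

/-! ### Differentiation of bilinear expressions -/

section Bilinear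

variable {A B C X : Type*} [NormedAddCommGroup A] [NormedSpace ℝ A] [NormedAddCommGroup B]
  [NormedSpace ℝ B] [NormedAddCommGroup C] [NormedSpace ℝ C] [NormedAddCommGroup X]
  [NormedSpace ℝ X] (φ : A →L[ℝ] B →L[ℝ] C) {f : X → A} {g : X → B} {x : X}

lemma differentiableAt_bilinear (hf : DifferentiableAt ℝ f x) (hg : DifferentiableAt ℝ g x) :
    DifferentiableAt ℝ (fun y => φ (f y) (g y)) x :=
  (φ.differentiableAt.comp x hf).clm_apply hg

lemma fderiv_bilinear_apply (hf : DifferentiableAt ℝ f x) (hg : DifferentiableAt ℝ g x) (v : X) :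
    fderiv ℝ (fun y => φ (f y) (g y)) x v = φ (fderiv ℝ f x v) (g x) + φ (f x) (fderiv ℝ g x v) := by
  have h : HasFDerivAt (fun y => φ (f y) (g y)) _ x :=
    (φ.hasFDerivAt.comp x hf.hasFDerivAt).clm_apply hg.hasFDerivAt
  rw [h.fderiv]
  simp [add_comm]

end Bilinear

/-! ### The divergence of the momenta as an exterior derivative -/

section Divergence

variable {m k : ℕ} {F : Type*} [NormedAddCommGroup F] [NormedSpace ℝ F]

/-- The contraction of a 2-horizontal form with a vertical vector, as a form on the base. -/
def HFib.contract (q : HFib m F (k + 1)) (g : F) : (Base m) [⋀^Fin k]→L[ℝ] ℝ :=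
  (q.1.curryLeft (0, g)).compContinuousLinearMap (ContinuousLinearMap.inl ℝ (Base m) F)

lemma HFib.contract_removeNth (q : HFib m F (k + 1)) (g : F) (a : Fin (k + 1) → Base m)
    (i : Fin (k + 1)) : HFib.contract q g (i.removeNth a) =
      (-1) ^ (i : ℕ) • q.1 (Function.update (fun j => (a j, 0)) i (0, g)) := by
  rw [update_mem_horizontal, smul_smul, ← pow_add, Even.neg_one_pow ⟨_, rfl⟩, one_smul]
  rfl

lemma differentiableAt_contract {X : Type*} [NormedAddCommGroup X] [NormedSpace ℝ X]
    {P : X → HFib m F (k + 1)} {g : X → F} {x : X} (hP : DifferentiableAt ℝ P x)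
    (hg : DifferentiableAt ℝ g x) : DifferentiableAt ℝ (fun y => HFib.contract (P y) (g y)) x :=
  differentiableAt_bilinear
    ((ContinuousLinearMap.compL ℝ F ((Base m × F) [⋀^Fin k]→L[ℝ] ℝ) ((Base m) [⋀^Fin k]→L[ℝ] ℝ)
      (ContinuousAlternatingMap.compContinuousLinearMapCLM
        (ContinuousLinearMap.inl ℝ (Base m) F))).comp
      (((ContinuousLinearMap.compL ℝ F (Base m × F) ((Base m × F) [⋀^Fin k]→L[ℝ] ℝ)).flip
        (ContinuousLinearMap.inr ℝ (Base m) F)).comp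
        ((ContinuousAlternatingMap.curryLeftLI (𝕜 := ℝ) (E := Base m × F) (F := ℝ)
          (n := k)).toContinuousLinearMap.comp (HFib m F (k + 1)).subtypeL))) hP hg

/-- The sign `(-1)^i` in the exterior derivative cancels the one from moving the vertical slot to
position `i`, so the plain divergence remains. -/
lemma extDeriv_contract {P : Base (k + 1) → HFib (k + 1) F (k + 1)} {g : Base (k + 1) → F}
    {x : Base (k + 1)} (hP : DifferentiableAt ℝ P x) (hg : DifferentiableAt ℝ g x) :
    extDeriv (fun y => HFib.contract (P y) (g y)) x (fun i => ebasis i) =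
      ∑ i, fderiv ℝ (fun y => HFib.mom (P y) i (g y)) x (ebasis i) := by
  rw [extDeriv_apply (differentiableAt_contract hP hg)]
  refine Finset.sum_congr rfl fun i _ => ?_
  have h : (fun y => HFib.contract (P y) (g y) (i.removeNth fun i => ebasis i)) =
      fun y => ((-1 : ℝ) ^ (i : ℕ)) • HFib.mom (P y) i (g y) := by
    ext1 y
    rw [HFib.contract_removeNth, HFib.mom_apply]
    rcases neg_one_pow_eq_or ℤ (i : ℕ) with h | h <;>
      rcases Nat.even_or_odd (i : ℕ) with h' | h' <;> simp [h'.neg_one_pow]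
  rw [h]
  rcases Nat.even_or_odd (i : ℕ) with h' | h' <;> simp [h'.neg_one_pow, fderiv_fun_neg]

/-- The divergence of the contraction of a section of the multimomentum bundle with a variation
is multiplied by the Jacobian determinant under a change of coordinates. -/
lemma divergence_transform {P P' : Base m → HFib m F m} {g g' : Base m → F}
    {ψ : Base m → Base m} {x : Base m} (hP : DifferentiableAt ℝ P x) (hg : DifferentiableAt ℝ g x)
    (hP' : DifferentiableAt ℝ P' (ψ x)) (hg' : DifferentiableAt ℝ g' (ψ x))
    (hψ : ContDiffAt ℝ ∞ ψ x)
    (h : ∀ᶠ y in 𝓝 x, ∀ (v : Fin m → Base m) (i : Fin m),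
      (P y).1 (Function.update (fun j => (v j, 0)) i (0, g y)) =
        (P' (ψ y)).1 (Function.update (fun j => (fderiv ℝ ψ y (v j), 0)) i (0, g' (ψ y)))) :
    ∑ i, fderiv ℝ (fun y => HFib.mom (P y) i (g y)) x (ebasis i) =
      (fderiv ℝ ψ x).det *
        ∑ i, fderiv ℝ (fun y => HFib.mom (P' y) i (g' y)) (ψ x) (ebasis i) := by
  -- Over a zero-dimensional base there is no contraction of degree `m - 1`, but both sums are
  -- empty.
  rcases m with _ | k
  · simp
  rw [← extDeriv_contract hP hg, ← extDeriv_contract hP' hg']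
  -- The hypothesis says that the first contraction is the pullback of the second by `ψ`. The dummy
  -- entry in slot `0` is overwritten by the vertical vector.
  have e : (fun y => HFib.contract (P y) (g y)) =ᶠ[𝓝 x] fun y =>
      (HFib.contract (P' (ψ y)) (g' (ψ y))).compContinuousLinearMap (fderiv ℝ ψ y) := by
    filter_upwards [h] with y hy
    ext v
    have h1 := HFib.contract_removeNth (P y) (g y) (Fin.cons 0 v) 0
    have h2 := HFib.contract_removeNth (P' (ψ y)) (g' (ψ y)) (fun j => fderiv ℝ ψ y
      ((Fin.cons 0 v : Fin (k + 1) → Base (k + 1)) j)) 0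
    rw [hy] at h1
    exact h1.trans h2.symm
  -- Naturality of `d`; the pullback of a top-degree form by the derivative of `ψ` then produces the
  -- determinant.
  have hp := extDeriv_pullback (r := ∞) (differentiableAt_contract hP' hg') hψ
    (by rw [minSmoothness_of_isRCLikeNormedField]; exact WithTop.coe_le_coe.2 le_top)
  rw [e.extDeriv_eq, hp, form_comp_eq_det]
  rfl

variable [FiniteDimensional ℝ F]

/-- The momentum of a 2-horizontal `m`-form as a continuous linear map. -/
def HFib.momL (i : Fin m) : HFib m F m →L[ℝ] F →L[ℝ] ℝ :=
  LinearMap.toContinuousLinearMap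
    { toFun q := HFib.mom q i
      map_add' p q := HFib.mom_add p q i
      map_smul' t q := HFib.mom_smul t q i }

/-- The two summands are the two kinds of terms of the momentum form: derivatives of the momenta
paired with the variation, and momenta paired with its derivatives. -/
lemma fderiv_mom_apply {P : Base m → HFib m F m} {g : Base m → F} {x : Base m}
    (hP : DifferentiableAt ℝ P x) (hg : DifferentiableAt ℝ g x) (i : Fin m) (v : Base m) :
    fderiv ℝ (fun y => HFib.mom (P y) i (g y)) x v =
      HFib.mom (fderiv ℝ P x v) i (g x) + HFib.mom (P x) i (fderiv ℝ g x v) :=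
  fderiv_bilinear_apply (HFib.momL i) hP hg v

end Divergence

/-! ### Changes of fibered coordinates -/

section ChartChange

variable {m : ℕ} {F EE : Type*} [NormedAddCommGroup F] [NormedSpace ℝ F]
  [NormedAddCommGroup EE] [NormedSpace ℝ EE]
  {M E : Type*} [TopologicalSpace M] [ChartedSpace (Base m) M]
  [TopologicalSpace E] [ChartedSpace EE E] {π : E → M}

/-- Once slot `i` is vertical, a vertical component in any other slot contributes nothing. -/
lemma HFib.apply_update_vertical {k : ℕ} (q : HFib m F k) (v : Fin k → Base m × F) (i : Fin k)
    (g : F) : q.1 (Function.update v i (0, g)) =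
      q.1 (Function.update (fun j => ((v j).1, 0)) i (0, g)) := by
  rw [HFib.apply_eq q, HFib.apply_eq q (Function.update (fun j => ((v j).1, (0 : F))) i (0, g))]
  have e : ∀ j, (Function.update v i (0, g) j).1 =
      (Function.update (fun j => ((v j).1, (0 : F))) i (0, g) j).1 := by
    intro j
    by_cases hj : j = i
    · subst hj; simp
    · simp [hj]
  simp only [e]
  congr 1
  refine Finset.sum_congr rfl fun j _ => ?_
  by_cases hj : j = i
  · subst hj; simp
  · refine (q.2 _ i j (Ne.symm hj) ?_ ?_).trans (q.2 _ i j (Ne.symm hj) ?_ ?_).symm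
    all_goals simp [hj, Function.update_of_ne (Ne.symm hj)]

namespace FiberedChart
variable (c c' : FiberedChart m F EE π)

lemma tot_mem_transSet {u : E} (h : u ∈ c.tot.source) (h' : u ∈ c'.tot.source) :
    c.tot u ∈ c.transSet c' := by
  refine ⟨c.tot.map_source h, ?_⟩
  change c.tot.symm (c.tot u) ∈ c'.tot.source
  rwa [c.tot.left_inv h]

lemma trans_tot {u : E} (h : u ∈ c.tot.source) : c.trans c' (c.tot u) = c'.tot u := by
  rw [FiberedChart.trans, c.tot.left_inv h]

lemma base_mem_baseTransSet {x : M} (h : x ∈ c.base.source) (h' : x ∈ c'.base.source) :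
    c.base x ∈ c.baseTransSet c' := by
  refine ⟨c.base.map_source h, ?_⟩
  change c.base.symm (c.base x) ∈ c'.base.source
  rwa [c.base.left_inv h]

lemma baseTrans_base {x : M} (h : x ∈ c.base.source) : c.baseTrans c' (c.base x) = c'.base x := by
  rw [FiberedChart.baseTrans, c.base.left_inv h]

lemma fderiv_trans_tot {u : E} (h : u ∈ c.tot.source) (h' : u ∈ c'.tot.source) :
    fderiv ℝ (c.trans c') (c.tot u) = (c'.dtot u).comp (c.dtotSymm (c.tot u)) := by
  have := c.fderiv_trans c' (c.tot_mem_transSet c' h h')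
  rwa [c.tot.left_inv h] at this

lemma fderiv_baseTrans_base {x : M} (h : x ∈ c.base.source) (h' : x ∈ c'.base.source) :
    fderiv ℝ (c.baseTrans c') (c.base x) = (c'.dbase x).comp (c.dbaseSymm (c.base x)) := by
  have := c.fderiv_baseTrans c' (c.base_mem_baseTransSet c' h h')
  rwa [c.base.left_inv h] at this

lemma dtotSymm_dtot_apply {u : E} (h : u ∈ c.tot.source) (v : EE) :
    c.dtotSymm (c.tot u) (c.dtot u v) = v := DFunLike.congr_fun (c.dtotSymm_comp_dtot h) v

lemma dtot_dtotSymm_apply {u : E} (h : u ∈ c.tot.source) (v : Base m × F) :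
    c.dtot u (c.dtotSymm (c.tot u) v) = v := by
  have := c.dtot_comp_dtotSymm (c.tot.map_source h)
  rw [c.tot.left_inv h] at this
  exact DFunLike.congr_fun this v

lemma dbaseSymm_dbase_apply {x : M} (h : x ∈ c.base.source) (v : Base m) :
    c.dbaseSymm (c.base x) (c.dbase x v) = v := DFunLike.congr_fun (c.dbaseSymm_comp_dbase h) v

lemma fst_dtot_apply {u : E} (h : u ∈ c.tot.source) (v : EE) :
    (c.dtot u v).1 = c.dbase (π u) (dproj π u v) := DFunLike.congr_fun (c.fst_comp_dtot h) v

lemma dproj_dtotSymm_apply {u : E} (h : u ∈ c.tot.source) (v : Base m × F) :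
    (dproj π u (c.dtotSymm (c.tot u) v) : Base m) = c.dbaseSymm (c.base (π u)) v.1 := by
  have h1 := c.fst_dtot_apply h (c.dtotSymm (c.tot u) v)
  rw [c.dtot_dtotSymm_apply h] at h1
  rw [h1]
  exact (c.dbaseSymm_dbase_apply (c.map_source u h) _).symm

lemma fst_fderiv_trans_tot {u : E} (h : u ∈ c.tot.source) (h' : u ∈ c'.tot.source)
    (v : Base m × F) : (fderiv ℝ (c.trans c') (c.tot u) v).1 =
      fderiv ℝ (c.baseTrans c') (c.base (π u)) v.1 := by
  rw [c.fderiv_trans_tot c' h h', c.fderiv_baseTrans_base c' (c.map_source u h)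
    (c'.map_source u h')]
  have h1 := c'.fst_dtot_apply h' (c.dtotSymm (c.tot u) v)
  rw [c.dproj_dtotSymm_apply h] at h1
  exact h1

lemma fderiv_trans_fderiv_trans {u : E} (h : u ∈ c.tot.source) (h' : u ∈ c'.tot.source)
    (v : Base m × F) : fderiv ℝ (c'.trans c) (c'.tot u) (fderiv ℝ (c.trans c') (c.tot u) v) = v := by
  rw [c.fderiv_trans_tot c' h h', c'.fderiv_trans_tot c h' h]
  have h1 := c'.dtotSymm_dtot_apply h' (c.dtotSymm (c.tot u) v)
  have h2 := c.dtot_dtotSymm_apply h v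
  exact (congrArg (c.dtot u) h1).trans h2

lemma jetCoord_eq (z : J1 m F EE π) (v : Base m) :
    (c.jetCoord z).2.2 v = (c.dtot z.pt (z.lin (c.dbaseSymm (c.base (π z.pt)) v))).2 := rfl

lemma dtot_lin_apply (z : J1 m F EE π) (h : z.pt ∈ c.tot.source) (v : Base m) :
    c.dtot z.pt (z.lin v) = (c.dbase (π z.pt) v, (c.jetCoord z).2.2 (c.dbase (π z.pt) v)) := by
  refine Prod.ext ?_ ?_
  · have h4 := DFunLike.congr_fun z.isSection v
    have h5 := c.fst_dtot_apply h (z.lin v)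
    rw [h5]
    exact congrArg _ h4
  · rw [c.jetCoord_eq, c.dbaseSymm_dbase_apply (c.map_source _ h)]

/-- The new derivative coordinates arise by carrying a base vector to the old coordinates, lifting
it by the jet there, and pushing the lift forward by the change of coordinates. -/
lemma jetCoord_trans (z : J1 m F EE π) (h : z.pt ∈ c.tot.source) (h' : z.pt ∈ c'.tot.source)
    (v : Base m) : (c'.jetCoord z).2.2 v = (fderiv ℝ (c.trans c') (c.tot z.pt)
      (fderiv ℝ (c'.baseTrans c) (c'.base (π z.pt)) v,
        (c.jetCoord z).2.2 (fderiv ℝ (c'.baseTrans c) (c'.base (π z.pt)) v))).2 := by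
  rw [c.fderiv_trans_tot c' h h', c'.fderiv_baseTrans_base c (c'.map_source _ h')
    (c.map_source _ h), c'.jetCoord_eq]
  have h1 := c.dtot_lin_apply z h (c'.dbaseSymm (c'.base (π z.pt)) v)
  have h2 := c.dtotSymm_dtot_apply h (z.lin (c'.dbaseSymm (c'.base (π z.pt)) v))
  rw [h1] at h2
  exact congrArg (fun t => (c'.dtot z.pt t).2) h2.symm

lemma formCoord_trans {k : ℕ} (μ : HForm m F EE π k) (h : μ.pt ∈ c.tot.source)
    (h' : μ.pt ∈ c'.tot.source) (v : Fin k → Base m × F) :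
    (c'.formCoord μ).2.2.1 v =
      (c.formCoord μ).2.2.1 (fun j => fderiv ℝ (c'.trans c) (c'.tot μ.pt) (v j)) := by
  rw [c.formCoord_coe μ h, c'.formCoord_coe μ h', c'.fderiv_trans_tot c h' h]
  refine congrArg μ.form ?_
  ext1 j
  exact (c.dtotSymm_dtot_apply h _).symm

end FiberedChart

/-- A volume form, evaluated on the coordinate vectors, is transformed by the Jacobian. -/
lemma FiberedChart.density_trans (c c' : FiberedChart m F EE π) (η : VolumeForm m M) {x : M}
    (h : x ∈ c.base.source) (h' : x ∈ c'.base.source) [IsFibration m F EE π] :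
    c'.density η x = (fderiv ℝ (c'.baseTrans c) (c'.base x)).det * c.density η x := by
  have h1 := form_comp_eq_det ((η.toFun x).compContinuousLinearMap (c.dbaseSymm (c.base x)))
    (fderiv ℝ (c'.baseTrans c) (c'.base x))
  have h2 := DFunLike.congr_fun h1 (fun i => ebasis i)
  refine Eq.trans ?_ h2
  refine congrArg (η.toFun x) ?_
  ext1 i
  rw [c'.fderiv_baseTrans_base c h' h]
  exact (c.dbaseSymm_dbase_apply h _).symm

end ChartChange

/-! ### Derivatives along curves -/

section Curves

variable {X Y : Type*} [NormedAddCommGroup X] [NormedSpace ℝ X] [NormedAddCommGroup Y]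
  [NormedSpace ℝ Y]

lemma hasDerivAt_comp_curve {f : X → Y} {l : ℝ → X} {p v : X} {t : ℝ}
    (hf : DifferentiableAt ℝ f p) (hl : HasDerivAt l v t) (h : l t = p) :
    HasDerivAt (fun s => f (l s)) (fderiv ℝ f p v) t := by
  subst h
  exact hf.hasFDerivAt.comp_hasDerivAt t hl

lemma hasDerivAt_clm_comp_curve (L : X →L[ℝ] Y) {l : ℝ → X} {v : X} {t : ℝ}
    (hl : HasDerivAt l v t) : HasDerivAt (fun s => L (l s)) (L v) t :=
  L.hasFDerivAt.comp_hasDerivAt t hl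

lemma hasDerivAt_line (p v : X) (t : ℝ) : HasDerivAt (fun s : ℝ => p + s • v) v t := by
  simpa using ((hasDerivAt_id t).smul_const v).const_add p

lemma hasDerivAt_const_prodMk (a : X) {l : ℝ → Y} {v : Y} {t : ℝ} (hl : HasDerivAt l v t) :
    HasDerivAt (fun s => (a, l s)) (0, v) t := (hasDerivAt_const _ _).prodMk hl

lemma hasDerivAt_prodMk_lines {Z : Type*} [NormedAddCommGroup Z] [NormedSpace ℝ Z] (a : X)
    (p v : Y) (q w : Z) (t : ℝ) :
    HasDerivAt (fun s : ℝ => (a, p + s • v, q + s • w)) (0, v, w) t :=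
  hasDerivAt_const_prodMk a ((hasDerivAt_line p v t).prodMk (hasDerivAt_line q w t))

lemma hasDerivAt_snd_clm_apply {Z W : Type*} [NormedAddCommGroup Z] [NormedSpace ℝ Z]
    [NormedAddCommGroup W] [NormedSpace ℝ W] {Φ : ℝ → X × Y →L[ℝ] Z × W} {Φ' : X × Y →L[ℝ] Z × W}
    {t : ℝ} (hΦ : HasDerivAt Φ Φ' t) (a : X) {l : ℝ → Y} {v : Y} (hl : HasDerivAt l v t) :
    HasDerivAt (fun s => (Φ s (a, l s)).2) (Φ' (a, l t) + Φ t (0, v)).2 t :=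
  hasDerivAt_clm_comp_curve (ContinuousLinearMap.snd ℝ Z W)
    (hΦ.clm_apply (hasDerivAt_const_prodMk a hl))

end Curves

/-! ### The change of jet coordinates along vertical vectors -/

section Variation

variable {m : ℕ} {F EE : Type*} [NormedAddCommGroup F] [NormedSpace ℝ F]
  [NormedAddCommGroup EE] [NormedSpace ℝ EE]
  {M E : Type*} [TopologicalSpace M] [ChartedSpace (Base m) M]
  [TopologicalSpace E] [ChartedSpace EE E] {π : E → M} [IsFibration m F EE π]

namespace FiberedChart
variable (c c' : FiberedChart m F EE π)

lemma jet_tot_apply (z : J1 m F EE π) : c.jet.tot z = c.jetCoord z := rfl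

lemma jet_trans_apply {y : JModel m F} (hy : (y.1, y.2.1) ∈ c.transSet c') (v : Base m) :
    (c.jet.trans c'.jet y).2.2 v = (fderiv ℝ (c.trans c') (y.1, y.2.1)
      (fderiv ℝ (c'.baseTrans c) (c'.base (c.base.symm y.1)) v,
        y.2.2 (fderiv ℝ (c'.baseTrans c) (c'.base (c.base.symm y.1)) v))).2 := by
  have hp : c.tot (c.jetOfCoord y).pt = (y.1, y.2.1) := c.tot.right_inv hy.1
  have hs : (c.jetOfCoord y).pt ∈ c.tot.source := c.tot.map_target hy.1
  have h := c.jetCoord_trans c' (c.jetOfCoord y) hs hy.2 v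
  have hr : c.jetCoord (c.jetOfCoord y) = y := c.jetEquiv.right_inv hy.1
  rw [hp, hr, c.proj_eqOn hs, hp] at h
  exact h

/-- The jet coordinates change by the first derivative of the change of coordinates. Varying them
vertically therefore brings in its second derivative in the direction of the variation of `u`. -/
lemma fderiv_jet_trans {y V : JModel m F} (hy : (y.1, y.2.1) ∈ c.transSet c') (hV : V.1 = 0) :
    (fderiv ℝ (c.jet.trans c'.jet) y V).2.1 =
        (fderiv ℝ (c.trans c') (y.1, y.2.1) (0, V.2.1)).2 ∧
      ∀ v, (fderiv ℝ (c.jet.trans c'.jet) y V).2.2 v =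
        (fderiv ℝ (fderiv ℝ (c.trans c')) (y.1, y.2.1) (0, V.2.1)
            (fderiv ℝ (c'.baseTrans c) (c'.base (c.base.symm y.1)) v,
              y.2.2 (fderiv ℝ (c'.baseTrans c) (c'.base (c.base.symm y.1)) v)) +
          fderiv ℝ (c.trans c') (y.1, y.2.1)
            (0, V.2.2 (fderiv ℝ (c'.baseTrans c) (c'.base (c.base.symm y.1)) v))).2 := by
  obtain ⟨x, u, w⟩ := y
  obtain ⟨a, δu, δw⟩ := V
  obtain rfl : a = 0 := hV
  dsimp only at hy ⊢
  set D := fderiv ℝ (c'.baseTrans c) (c'.base (c.base.symm x))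
  have hJ : DifferentiableAt ℝ (c.jet.trans c'.jet) (x, u, w) :=
    ((c.jet.contDiffOn_trans c'.jet).contDiffAt
      ((c.jet.isOpen_transSet c'.jet).mem_nhds hy)).differentiableAt (by simp)
  -- Both sides are compared as derivatives along the line in direction `V`. Its base point `x`
  -- stays fixed, so the derivative `D` of the base change is constant along it.
  have hl : HasDerivAt (fun t : ℝ => ((x, u + t • δu, w + t • δw) : JModel m F)) (0, δu, δw) 0 :=
    hasDerivAt_prodMk_lines x u δu w δw 0
  have hl' : HasDerivAt (fun t : ℝ => ((x, u + t • δu) : Base m × F)) (0, δu) 0 :=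
    hasDerivAt_const_prodMk x (hasDerivAt_line u δu 0)
  have h0 : ((x, u + (0 : ℝ) • δu, w + (0 : ℝ) • δw) : JModel m F) = (x, u, w) := by simp
  have h0' : ((x, u + (0 : ℝ) • δu) : Base m × F) = (x, u) := by simp
  have hJl : HasDerivAt (fun t : ℝ => c.jet.trans c'.jet (x, u + t • δu, w + t • δw))
      (fderiv ℝ (c.jet.trans c'.jet) (x, u, w) (0, δu, δw)) 0 :=
    hasDerivAt_comp_curve hJ hl h0
  have hnhds : ∀ᶠ t : ℝ in 𝓝 0, ((x, u + t • δu) : Base m × F) ∈ c.transSet c' := by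
    refine hl'.continuousAt.eventually_mem ?_
    rw [h0']
    exact (c.isOpen_transSet c').mem_nhds hy
  have hΨ : ContDiffAt ℝ ∞ (c.trans c') (x, u) :=
    (c.contDiffOn_trans c').contDiffAt ((c.isOpen_transSet c').mem_nhds hy)
  have hΨ1 : DifferentiableAt ℝ (c.trans c') (x, u) := hΨ.differentiableAt (by simp)
  have hΨ2 : DifferentiableAt ℝ (fderiv ℝ (c.trans c')) (x, u) :=
    (hΨ.fderiv_right (m := ∞) (by simp)).differentiableAt (by simp)
  constructor
  · exact (hasDerivAt_clm_comp_curve ((ContinuousLinearMap.fst ℝ F (Base m →L[ℝ] F)).comp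
      (ContinuousLinearMap.snd ℝ (Base m) (F × (Base m →L[ℝ] F)))) hJl).unique
      (hasDerivAt_clm_comp_curve (ContinuousLinearMap.snd ℝ (Base m) F)
        (hasDerivAt_comp_curve hΨ1 hl' h0'))
  · intro v
    have h1 := hasDerivAt_clm_comp_curve ((ContinuousLinearMap.apply ℝ F v).comp
      ((ContinuousLinearMap.snd ℝ F (Base m →L[ℝ] F)).comp
        (ContinuousLinearMap.snd ℝ (Base m) (F × (Base m →L[ℝ] F))))) hJl
    have h2 : HasDerivAt (fun t : ℝ => (fderiv ℝ (c.trans c') (x, u + t • δu)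
        (D v, (w + t • δw) (D v))).2)
        (fderiv ℝ (fderiv ℝ (c.trans c')) (x, u) (0, δu) (D v, w (D v)) +
          fderiv ℝ (c.trans c') (x, u) (0, δw (D v))).2 0 := by
      have h3 : HasDerivAt (fun t : ℝ => fderiv ℝ (c.trans c') (x, u + t • δu))
          (fderiv ℝ (fderiv ℝ (c.trans c')) (x, u) (0, δu)) 0 :=
        hasDerivAt_comp_curve hΨ2 hl' h0'
      have h4 : HasDerivAt (fun t : ℝ => (w + t • δw) (D v)) (δw (D v)) 0 :=
        hasDerivAt_line (w (D v)) (δw (D v)) 0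
      have h5 := hasDerivAt_snd_clm_apply h3 (D v) h4
      rwa [h0', zero_smul, add_zero] at h5
    refine h1.unique (h2.congr_of_eventuallyEq ?_)
    filter_upwards [hnhds] with t ht
    exact c.jet_trans_apply c' (y := (x, u + t • δu, w + t • δw)) ht v

end FiberedChart
end Variation

/-! ### Chart independence of the momentum form -/

section MomentumChange

variable {m : ℕ} {F EE : Type*} [NormedAddCommGroup F] [NormedSpace ℝ F]
  [NormedAddCommGroup EE] [NormedSpace ℝ EE]
  {M E : Type*} [TopologicalSpace M] [ChartedSpace (Base m) M]
  [TopologicalSpace E] [ChartedSpace EE E] {π : E → M} [IsFibration m F EE π]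
  [FiniteDimensional ℝ F]

/-- The linear form `pⁱ_αᵢ duᵅ + pⁱ_α duᵅᵢ` on the model of the vertical vectors of `J¹π`. -/
def momPair (y : JModel m (F × HFib m F m)) : F × (Base m →L[ℝ] F) →L[ℝ] ℝ :=
  ∑ i : Fin m, ((HFib.mom (y.2.2 (ebasis i)).2 i).comp
      (ContinuousLinearMap.fst ℝ F (Base m →L[ℝ] F)) +
    (HFib.mom y.2.1.2 i).comp ((ContinuousLinearMap.apply ℝ F (ebasis i)).comp
      (ContinuousLinearMap.snd ℝ F (Base m →L[ℝ] F))))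

omit [FiniteDimensional ℝ F] in
lemma momPair_apply (y : JModel m (F × HFib m F m)) (V : F × (Base m →L[ℝ] F)) :
    momPair y V = ∑ i : Fin m, (HFib.mom (y.2.2 (ebasis i)).2 i V.1 +
      HFib.mom y.2.1.2 i (V.2 (ebasis i))) := by
  simp [momPair]

variable [IsManifold 𝓘(ℝ, Base m) ∞ M]
namespace FiberedChart
variable (c c' : FiberedChart m F EE π)

lemma momentumForm_apply (z : JMom m F EE π) (v : JModel m F) :
    c.momentumForm z v = momPair ((c.forms m).jetCoord z) (c.jet.dtot (j1nu m F EE π z) v).2 := by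
  rw [momPair_apply, FiberedChart.momentumForm, ContinuousLinearMap.comp_apply,
    sum_apply]
  rfl

omit [IsManifold 𝓘(ℝ, Base m) ∞ M] in
lemma dpt_eq {k : ℕ} {p : HForm m F EE π k} (h : p.pt ∈ c.tot.source) :
    p.dpt = (c.dtotSymm (c.tot p.pt)).comp (((ContinuousLinearMap.fst ℝ (Base m) (F × HFib m F k)).prod
      ((ContinuousLinearMap.fst ℝ F (HFib m F k)).comp
        (ContinuousLinearMap.snd ℝ (Base m) (F × HFib m F k)))).comp ((c.forms k).dtot p)) := by
  let L : HModel m F k →L[ℝ] Base m × F := (ContinuousLinearMap.fst ℝ (Base m) (F × HFib m F k)).prod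
    ((ContinuousLinearMap.fst ℝ F (HFib m F k)).comp
      (ContinuousLinearMap.snd ℝ (Base m) (F × HFib m F k)))
  have h1 : MDifferentiableAt 𝓘(ℝ, HModel m F k) 𝓘(ℝ, HModel m F k) (c.forms k).tot p :=
    (c.forms k).mdiff_tot.mdifferentiableAt h
  have h2 : MDifferentiableAt 𝓘(ℝ, HModel m F k) 𝓘(ℝ, Base m × F) L ((c.forms k).tot p) :=
    L.differentiableAt.mdifferentiableAt
  have h3 : MDifferentiableAt 𝓘(ℝ, Base m × F) 𝓘(ℝ, EE) c.tot.symm (L ((c.forms k).tot p)) :=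
    c.mdiff_tot.mdifferentiableAt_symm (c.tot.map_source h)
  have e : (HForm.pt : HForm m F EE π k → E) =ᶠ[𝓝 p] c.tot.symm ∘ L ∘ (c.forms k).tot := by
    filter_upwards [(c.forms k).tot.open_source.mem_nhds h] with q hq
    exact (c.tot.left_inv (x := q.pt) hq).symm
  have h4 := mfderiv_comp p h2 h1
  rw [mfderiv_eq_fderiv, L.fderiv] at h4
  have h5 := e.mfderiv_eq (I := 𝓘(ℝ, HModel m F k)) (I' := 𝓘(ℝ, EE))
  have h6 := mfderiv_comp p h3 (h2.comp p h1)
  rw [h4] at h6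
  exact h5.trans h6

omit [IsManifold 𝓘(ℝ, Base m) ∞ M] in
lemma dtot_dpt {k : ℕ} {p : HForm m F EE π k} (h : p.pt ∈ c.tot.source) (v : HModel m F k) :
    c.dtot p.pt (p.dpt v) = (((c.forms k).dtot p v).1, ((c.forms k).dtot p v).2.1) := by
  rw [c.dpt_eq h]
  exact c.dtot_dtotSymm_apply h _

/-- In natural coordinates `j¹ν` forgets the momentum components of the point and of its
derivatives. -/
lemma jetCoord_j1nu {z : JMom m F EE π} (h : z.pt.pt ∈ c.tot.source) :
    c.jetCoord (j1nu m F EE π z) = (((c.forms m).jetCoord z).1, ((c.forms m).jetCoord z).2.1.1,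
      (ContinuousLinearMap.fst ℝ F (HFib m F m)).comp ((c.forms m).jetCoord z).2.2) := by
  refine Prod.ext rfl (Prod.ext rfl ?_)
  ext1 v
  exact congrArg Prod.snd (c.dtot_dpt h (z.lin (c.dbaseSymm (c.base (π z.pt.pt)) v)))

-- With one slot vertical, only the base Jacobian acts on the remaining slots. This is the pointwise
-- hypothesis of `divergence_transform`.
omit [IsFibration m F EE π] [FiniteDimensional ℝ F] [IsManifold 𝓘(ℝ, Base m) ∞ M] in
lemma formCoord_trans_update {k : ℕ} {μ : HForm m F EE π k} (h : μ.pt ∈ c.tot.source)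
    (h' : μ.pt ∈ c'.tot.source) (w : Fin k → Base m) (i : Fin k) (b : F) :
    (c'.formCoord μ).2.2.1 (Function.update (fun j => (w j, 0)) i
        (0, (fderiv ℝ (c.trans c') (c.tot μ.pt) (0, b)).2)) =
      (c.formCoord μ).2.2.1 (Function.update
        (fun j => (fderiv ℝ (c'.baseTrans c) (c'.base (π μ.pt)) (w j), 0)) i (0, b)) := by
  have e1 : fderiv ℝ (c'.trans c) (c'.tot μ.pt)
      (0, (fderiv ℝ (c.trans c') (c.tot μ.pt) (0, b)).2) = (0, b) := by
    have h1 := c.fderiv_trans_fderiv_trans c' h h' (0, b)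
    have h2 := c.fst_fderiv_trans_tot c' h h' (0, b)
    rw [map_zero] at h2
    have h3 : fderiv ℝ (c.trans c') (c.tot μ.pt) (0, b) =
        (0, (fderiv ℝ (c.trans c') (c.tot μ.pt) (0, b)).2) := Prod.ext h2 rfl
    rw [← h3]
    exact h1
  have e2 : (fun j => fderiv ℝ (c'.trans c) (c'.tot μ.pt)
      (Function.update (fun j => (w j, (0 : F))) i
        (0, (fderiv ℝ (c.trans c') (c.tot μ.pt) (0, b)).2) j)) =
      Function.update (fun j => fderiv ℝ (c'.trans c) (c'.tot μ.pt) (w j, 0)) i (0, b) := by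
    ext1 j
    by_cases hj : j = i
    · subst hj
      simp only [Function.update_self]
      exact e1
    · simp only [Function.update_of_ne hj]
  have e3 : ∀ j, (fderiv ℝ (c'.trans c) (c'.tot μ.pt) (w j, 0)).1 =
      fderiv ℝ (c'.baseTrans c) (c'.base (π μ.pt)) (w j) := fun j =>
    c'.fst_fderiv_trans_tot c h' h (w j, 0)
  rw [c.formCoord_trans c' μ h h', e2, HFib.apply_update_vertical]
  simp only [e3]

set_option maxHeartbeats 1000000 in
/-- The momentum form is transformed by the Jacobian under a change of fibered coordinates. -/
lemma momentumForm_trans {z : JMom m F EE π} (h : z.pt.pt ∈ c.tot.source)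
    (h' : z.pt.pt ∈ c'.tot.source) {v : JModel m F}
    (hv : (c.jet.dtot (j1nu m F EE π z) v).1 = 0) :
    c'.momentumForm z v = (fderiv ℝ (c'.baseTrans c) (c'.base (π z.pt.pt))).det *
      c.momentumForm z v := by
  have hb := c.map_source _ h
  have hb' := c'.map_source _ h'
  set x := c'.base (π z.pt.pt) with hx
  set y := (c.forms m).jetCoord z with hy
  have hx0 : c'.baseTrans c x = y.1 := (c'.baseTrans_base c hb').trans (c.fst_tot _ h).symm
  set D := fderiv ℝ (c'.baseTrans c) x with hD
  set V := c.jet.dtot (j1nu m F EE π z) v with hVdef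
  have hmem : c.tot z.pt.pt ∈ c.transSet c' := c.tot_mem_transSet c' h h'
  have hytot : (y.1, y.2.1.1) = c.tot z.pt.pt := rfl
  have hψ : ContDiffAt ℝ ∞ (c'.baseTrans c) x := (c'.contDiffOn_baseTrans c).contDiffAt
    ((c'.isOpen_baseTransSet c).mem_nhds (c'.base_mem_baseTransSet c hb' hb))
  have hψ1 : HasFDerivAt (c'.baseTrans c) D x :=
    (hψ.differentiableAt (by simp)).hasFDerivAt
  -- the section with the given jet in the first chart
  let σ : Base m → F × HFib m F m := fun t => y.2.1 + y.2.2 (t - y.1)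
  have hσ0 : σ y.1 = y.2.1 := by simp [σ]
  have hσ : ∀ t, HasFDerivAt σ y.2.2 t := fun t => by
    have := (y.2.2.hasFDerivAt.comp t ((hasFDerivAt_id t).sub_const y.1)).const_add y.2.1
    simpa [σ] using this
  -- An affine variation whose value and derivative at the base point are the two components of the
  -- vertical vector `V`; `σ` plays the same role for the jet `z`. Only the first jets enter the
  -- momentum form, so affine representatives suffice.
  let g₁ : Base m → F := fun t => V.2.1 + V.2.2 (t - y.1)
  have hg₁0 : g₁ y.1 = V.2.1 := by simp [g₁]
  have hg₁ : ∀ t, HasFDerivAt g₁ V.2.2 t := fun t => by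
    have := (V.2.2.hasFDerivAt.comp t ((hasFDerivAt_id t).sub_const y.1)).const_add V.2.1
    simpa [g₁] using this
  let P₁ : Base m → HFib m F m := fun t => (σ t).2
  have hP₁ : ∀ t, HasFDerivAt P₁ ((ContinuousLinearMap.snd ℝ F (HFib m F m)).comp y.2.2) t :=
    fun t => (ContinuousLinearMap.snd ℝ F (HFib m F m)).hasFDerivAt.comp t (hσ t)
  let u₁ : Base m → F := fun t => (σ t).1
  have hu₁ : ∀ t, HasFDerivAt u₁ ((ContinuousLinearMap.fst ℝ F (HFib m F m)).comp y.2.2) t :=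
    fun t => (ContinuousLinearMap.fst ℝ F (HFib m F m)).hasFDerivAt.comp t (hσ t)
  -- its expression in the second chart
  have hq0 : (c'.baseTrans c x, σ (c'.baseTrans c x)) = (c.forms m).tot z.pt := by
    rw [hx0, hσ0]; rfl
  have hq : HasFDerivAt (fun t => (c'.baseTrans c t, σ (c'.baseTrans c t)))
      (D.prod (y.2.2.comp D)) x := hψ1.prodMk ((hσ _).comp x hψ1)
  have hr0 : (c'.baseTrans c x, u₁ (c'.baseTrans c x)) = c.tot z.pt.pt := by
    rw [hx0, ← hytot]; simp [u₁, hσ0]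
  have hr : HasFDerivAt (fun t => (c'.baseTrans c t, u₁ (c'.baseTrans c t)))
      (D.prod (((ContinuousLinearMap.fst ℝ F (HFib m F m)).comp y.2.2).comp D)) x :=
    hψ1.prodMk ((hu₁ _).comp x hψ1)
  have hT : DifferentiableAt ℝ ((c.forms m).trans (c'.forms m)) ((c.forms m).tot z.pt) :=
    (((c.forms m).contDiffOn_trans (c'.forms m)).contDiffAt
      (((c.forms m).isOpen_transSet (c'.forms m)).mem_nhds
        ((c.forms m).tot_mem_transSet (c'.forms m) h h'))).differentiableAt (by simp)
  have hΨ : ContDiffAt ℝ ∞ (c.trans c') (c.tot z.pt.pt) :=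
    (c.contDiffOn_trans c').contDiffAt ((c.isOpen_transSet c').mem_nhds hmem)
  have hΨ2 : DifferentiableAt ℝ (fderiv ℝ (c.trans c')) (c.tot z.pt.pt) :=
    (hΨ.fderiv_right (m := ∞) (by simp)).differentiableAt (by simp)
  let P : Base m → HFib m F m := fun t =>
    ((c.forms m).trans (c'.forms m) (c'.baseTrans c t, σ (c'.baseTrans c t))).2.2
  have hP : HasFDerivAt P ((((ContinuousLinearMap.snd ℝ F (HFib m F m)).comp
      (ContinuousLinearMap.snd ℝ (Base m) (F × HFib m F m))).comp
        (fderiv ℝ ((c.forms m).trans (c'.forms m)) ((c.forms m).tot z.pt))).comp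
          (D.prod (y.2.2.comp D))) x := by
    have h1 : HasFDerivAt ((c.forms m).trans (c'.forms m))
        (fderiv ℝ ((c.forms m).trans (c'.forms m)) ((c.forms m).tot z.pt))
        (c'.baseTrans c x, σ (c'.baseTrans c x)) := by
      rw [hq0]; exact hT.hasFDerivAt
    exact (((ContinuousLinearMap.snd ℝ F (HFib m F m)).comp
      (ContinuousLinearMap.snd ℝ (Base m) (F × HFib m F m))).hasFDerivAt.comp _ h1).comp x hq
  have hPd : ∀ e, fderiv ℝ P x e = (((c'.forms m).jetCoord z).2.2 e).2 := fun e => by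
    rw [hP.fderiv, (c.forms m).jetCoord_trans (c'.forms m) z h h' e]
    rfl
  have hP0 : P x = ((c'.forms m).jetCoord z).2.1.2 := by
    have := (c.forms m).trans_tot (c'.forms m) (u := z.pt) h
    rw [← hq0] at this
    exact congrArg (fun q : HModel m F m => q.2.2) this
  -- The same variation in the second chart: pushed forward by the derivative of the change of
  -- coordinates along the section.
  let g : Base m → F := fun t => (fderiv ℝ (c.trans c')
    (c'.baseTrans c t, u₁ (c'.baseTrans c t)) (0, g₁ (c'.baseTrans c t))).2
  have hg : HasFDerivAt g ((ContinuousLinearMap.snd ℝ (Base m) F).comp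
      ((fderiv ℝ (c.trans c') (c.tot z.pt.pt)).comp
        ((0 : Base m →L[ℝ] Base m).prod (V.2.2.comp D)) +
      ((fderiv ℝ (fderiv ℝ (c.trans c')) (c.tot z.pt.pt)).comp
        (D.prod (((ContinuousLinearMap.fst ℝ F (HFib m F m)).comp y.2.2).comp D))).flip
          (0, V.2.1))) x := by
    have h1 : HasFDerivAt (fun t => fderiv ℝ (c.trans c')
          (c'.baseTrans c t, u₁ (c'.baseTrans c t)))
        ((fderiv ℝ (fderiv ℝ (c.trans c')) (c.tot z.pt.pt)).comp
        (D.prod (((ContinuousLinearMap.fst ℝ F (HFib m F m)).comp y.2.2).comp D))) x := by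
      refine HasFDerivAt.comp x (g := fderiv ℝ (c.trans c')) ?_ hr
      rw [hr0]; exact hΨ2.hasFDerivAt
    have h2 : HasFDerivAt (fun t => ((0 : Base m), g₁ (c'.baseTrans c t)))
        ((0 : Base m →L[ℝ] Base m).prod (V.2.2.comp D)) x :=
      (hasFDerivAt_const _ _).prodMk ((hg₁ _).comp x hψ1)
    have h4 := (ContinuousLinearMap.snd ℝ (Base m) F).hasFDerivAt.comp x (h1.clm_apply h2)
    rw [hr0, hx0, hg₁0] at h4
    exact h4
  have hV' : c'.jet.dtot (j1nu m F EE π z) v = fderiv ℝ (c.jet.trans c'.jet)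
      (c.jet.tot (j1nu m F EE π z)) V := by
    rw [c.jet.fderiv_trans_tot c'.jet h h']
    exact congrArg (c'.jet.dtot (j1nu m F EE π z)) (c.jet.dtotSymm_dtot_apply h v).symm
  have hJ := c.fderiv_jet_trans c' (y := c.jet.tot (j1nu m F EE π z)) (V := V) hmem hv
  rw [← hV'] at hJ
  have hg0 : g x = (c'.jet.dtot (j1nu m F EE π z) v).2.1 := by
    refine Eq.trans ?_ hJ.1.symm
    change (fderiv ℝ (c.trans c') (c'.baseTrans c x, u₁ (c'.baseTrans c x))
      (0, g₁ (c'.baseTrans c x))).2 = _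
    rw [hr0, hx0, hg₁0]
    rfl
  -- Differentiating `g` puts the direction `e` first and the variation second in the second
  -- derivative of the change of coordinates; `fderiv_jet_trans` has them in the opposite order. The
  -- symmetry of second derivatives identifies the two.
  have hgd : ∀ e, fderiv ℝ g x e = (c'.jet.dtot (j1nu m F EE π z) v).2.2 e := fun e => by
    have hsymm : IsSymmSndFDerivAt ℝ (c.trans c') (c.tot z.pt.pt) :=
      hΨ.isSymmSndFDerivAt
        (by rw [minSmoothness_of_isRCLikeNormedField]; exact WithTop.coe_le_coe.2 le_top)
    have hbase : c'.base (c.base.symm (c.jet.tot (j1nu m F EE π z)).1) = x := by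
      change c'.base (c.base.symm (c.tot z.pt.pt).1) = x
      rw [← c.proj_eqOn h]
    have h1 := hJ.2 e
    rw [hbase, c.jet_tot_apply, c.jetCoord_j1nu h] at h1
    rw [hg.fderiv, h1, add_comm]
    have h2 := hsymm (D e, (y.2.2 (D e)).1) (0, V.2.1)
    exact congrArg (fun t => (t + fderiv ℝ (c.trans c') (c.tot z.pt.pt)
      (0, V.2.2 (D e))).2) h2
  -- By the Leibniz rule both momentum forms are divergences, so the claim is the transformation law
  -- of the divergence.
  have key := divergence_transform (P := P) (P' := P₁) (g := g) (g' := g₁)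
    (ψ := c'.baseTrans c) (x := x) hP.differentiableAt hg.differentiableAt
    (hP₁ _).differentiableAt (hg₁ _).differentiableAt hψ ?_
  · rw [c'.momentumForm_apply, c.momentumForm_apply, momPair_apply, momPair_apply]
    refine Eq.trans ?_ (key.trans ?_)
    · refine Finset.sum_congr rfl fun i _ => ?_
      rw [fderiv_mom_apply hP.differentiableAt hg.differentiableAt, hPd, hP0, hg0, hgd]
    · refine congrArg _ (Finset.sum_congr rfl fun i _ => ?_)
      rw [fderiv_mom_apply (hP₁ _).differentiableAt (hg₁ _).differentiableAt, (hP₁ _).fderiv,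
        (hg₁ _).fderiv, hx0, hg₁0]
      have : P₁ y.1 = y.2.1.2 := congrArg Prod.snd hσ0
      rw [this]
      rfl
  -- The contractions must agree near `x` and not just at `x`, because they are differentiated. At
  -- each nearby point the comparison is that of one form in two charts.
  · have hev : ∀ᶠ t in 𝓝 x, (c'.baseTrans c t, u₁ (c'.baseTrans c t)) ∈ c.transSet c' ∧
        t ∈ c'.baseTransSet c := by
      refine (hr.continuousAt.eventually_mem ?_).and ((c'.isOpen_baseTransSet c).mem_nhds
        (c'.base_mem_baseTransSet c hb' hb))
      exact (c.isOpen_transSet c').mem_nhds (by rw [hr0]; exact hmem)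
    filter_upwards [hev] with t ht w i
    set μ : HForm m F EE π m := c.formOfCoord (c'.baseTrans c t, σ (c'.baseTrans c t)) with hμ
    have hs : μ.pt ∈ c.tot.source := c.tot.map_target ht.1.1
    have hcr : c.tot μ.pt = (c'.baseTrans c t, u₁ (c'.baseTrans c t)) := c.tot.right_inv ht.1.1
    have hπ : π μ.pt = c'.base.symm t := by
      rw [c.proj_eqOn hs, hcr]
      exact c.base.left_inv ht.2.2
    have hcoord : c.formCoord μ = (c'.baseTrans c t, σ (c'.baseTrans c t)) :=
      (c.formEquiv m).right_inv ht.1.1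
    have hfin := c.formCoord_trans_update c' hs ht.1.2 w i (g₁ (c'.baseTrans c t))
    rw [hcr, hcoord, hπ, c'.base.right_inv ht.2.1] at hfin
    exact hfin

end FiberedChart
end MomentumChange

/-! ### Wedge products with the volume form and the Tulczyjew morphism in coordinates -/

section Coordinates

variable {m : ℕ} {F EE : Type*} [NormedAddCommGroup F] [NormedSpace ℝ F]
  [NormedAddCommGroup EE] [NormedSpace ℝ EE]
  {M E : Type*} [TopologicalSpace M] [ChartedSpace (Base m) M]
  [TopologicalSpace E] [ChartedSpace EE E] {π : E → M} [IsFibration m F EE π]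

omit [IsFibration m F EE π] in
lemma FiberedChart.density_ne_zero (c : FiberedChart m F EE π) (η : VolumeForm m M) {x : M}
    (h : x ∈ c.base.source) : c.density η x ≠ 0 := by
  intro h0
  apply η.ne_zero x
  have h1 : (η.toFun x).compContinuousLinearMap (c.dbaseSymm (c.base x)) = 0 := by
    rw [form_eq_smul_stdVol ((η.toFun x).compContinuousLinearMap (c.dbaseSymm (c.base x)))]
    have : (η.toFun x).compContinuousLinearMap (c.dbaseSymm (c.base x)) (fun i => ebasis i) = 0 :=
      h0
    rw [this, zero_smul]
  ext v
  have h2 := DFunLike.congr_fun h1 (fun i => c.dbase x (v i))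
  refine Eq.trans (congrArg (η.toFun x) ?_) h2
  ext1 i
  exact (c.dbaseSymm_dbase_apply h (v i)).symm

omit [IsFibration m F EE π] in
lemma FiberedChart.volumeForm_comp_dbaseSymm (c : FiberedChart m F EE π) (η : VolumeForm m M)
    (x : M) (v : Fin m → Base m) :
    η.toFun x (fun i => c.dbaseSymm (c.base x) (v i)) = c.density η x * stdVol m v :=
  DFunLike.congr_fun (form_eq_smul_stdVol
    ((η.toFun x).compContinuousLinearMap (c.dbaseSymm (c.base x)))) v

omit [IsFibration m F EE π] in
/-- A map into a normed space, in a fibered chart, is smooth if and only if it is so on the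
manifold. -/
lemma FiberedChart.contDiffOn_comp_symm (c : FiberedChart m F EE π) {X : Type*}
    [NormedAddCommGroup X] [NormedSpace ℝ X] {f : E → X}
    (hf : ContMDiffOn 𝓘(ℝ, EE) 𝓘(ℝ, X) ∞ f c.tot.source) :
    ContDiffOn ℝ ∞ (f ∘ c.tot.symm) c.tot.target := by
  rw [← contMDiffOn_iff_contDiffOn]
  exact hf.comp c.contMDiffOn_tot_symm c.tot.mapsTo_symm

variable [IsManifold 𝓘(ℝ, Base m) ∞ M]

-- Smoothness of `η` is given only in charts of the atlas. The coefficient in an arbitrary fibered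
-- chart is locally the coefficient in an atlas chart times a smooth Jacobian.
omit [IsFibration m F EE π] in
lemma FiberedChart.contDiffOn_density (c : FiberedChart m F EE π) (η : VolumeForm m M) :
    ContDiffOn ℝ ∞ (fun y => η.toFun (c.base.symm y) (fun i => c.dbaseSymm y (ebasis i)))
      c.base.target := by
  intro y₀ hy₀
  set b := chartAt (Base m) (c.base.symm y₀) with hb
  have hbm : b ∈ IsManifold.maximalAtlas 𝓘(ℝ, Base m) ∞ M :=
    IsManifold.chart_mem_maximalAtlas _
  set S := c.base.target ∩ c.base.symm ⁻¹' b.source with hS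
  have hSo : IsOpen S := c.base.isOpen_inter_preimage_symm b.open_source
  have hmem : y₀ ∈ S := ⟨hy₀, mem_chart_source _ _⟩
  have hT : ContDiffOn ℝ ∞ (fun y => b (c.base.symm y)) S := by
    rw [← contMDiffOn_iff_contDiffOn]
    exact (contMDiffOn_of_mem_maximalAtlas hbm).comp
      (c.contMDiffOn_base_symm.mono Set.inter_subset_left) Set.inter_subset_right
  have hη := η.smooth b (chart_mem_atlas _ _)
  have h1 : ContDiffOn ℝ ∞ (fun y => η.toFun (b.symm (b (c.base.symm y))) (fun i =>
      (mfderiv 𝓘(ℝ, Base m) 𝓘(ℝ, Base m) b.symm (b (c.base.symm y)) (ebasis i) : Base m))) S :=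
    hη.comp hT fun y hy => b.map_source hy.2
  have h2 : ContDiffOn ℝ ∞ (fun y => stdVol m (fun i =>
      fderiv ℝ (fun y => b (c.base.symm y)) y (ebasis i))) S := by
    refine (ContinuousMultilinearMap.contDiff
      (stdVol m).toContinuousMultilinearMap).comp_contDiffOn (contDiffOn_pi.2 fun i => ?_)
    exact (hT.fderiv_of_isOpen hSo (m := ∞) (by simp)).clm_apply contDiffOn_const
  refine (((h1.mul h2).congr fun y hy => ?_).contDiffAt
    (hSo.mem_nhds hmem)).contDiffWithinAt
  have hx : b.symm (b (c.base.symm y)) = c.base.symm y := b.left_inv hy.2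
  have hd : (mfderiv 𝓘(ℝ, Base m) 𝓘(ℝ, Base m) b.symm (b (c.base.symm y)) :
      Base m →L[ℝ] Base m).comp (fderiv ℝ (fun y => b (c.base.symm y)) y) = c.dbaseSymm y := by
    have hbd : b.MDifferentiable 𝓘(ℝ, Base m) 𝓘(ℝ, Base m) :=
      ⟨(contMDiffOn_of_mem_maximalAtlas hbm).mdifferentiableOn (by simp),
        (contMDiffOn_symm_of_mem_maximalAtlas hbm).mdifferentiableOn (by simp)⟩
    have d1 : MDifferentiableAt 𝓘(ℝ, Base m) 𝓘(ℝ, Base m) b.symm (b (c.base.symm y)) :=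
      hbd.mdifferentiableAt_symm (b.map_source hy.2)
    have d2 : MDifferentiableAt 𝓘(ℝ, Base m) 𝓘(ℝ, Base m) (fun y => b (c.base.symm y)) y :=
      ((hT.contDiffAt (hSo.mem_nhds hy)).differentiableAt (by simp)).mdifferentiableAt
    have d3 := mfderiv_comp y d1 d2
    have e : (b.symm ∘ fun y => b (c.base.symm y)) =ᶠ[𝓝 y] c.base.symm := by
      filter_upwards [hSo.mem_nhds hy] with t ht using b.left_inv ht.2
    rw [e.mfderiv_eq] at d3
    exact (d3.trans (congrArg (fun L : Base m →L[ℝ] Base m => ContinuousLinearMap.comp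
      (mfderiv 𝓘(ℝ, Base m) 𝓘(ℝ, Base m) b.symm (b (c.base.symm y)) : Base m →L[ℝ] Base m) L)
      mfderiv_eq_fderiv)).symm
  rw [← hd, hx]
  exact DFunLike.congr_fun (form_eq_smul_stdVol
    ((η.toFun (c.base.symm y)).compContinuousLinearMap
      (mfderiv 𝓘(ℝ, Base m) 𝓘(ℝ, Base m) b.symm (b (c.base.symm y)))))
    (fun i => fderiv ℝ (fun y => b (c.base.symm y)) y (ebasis i))

omit [IsManifold 𝓘(ℝ, Base m) ∞ M] in
/-- The coordinate expression of `α ∧ π₁^*η` in a fibered chart of the jet bundle. -/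
lemma formCoord_wedgeVol (C : FiberedChart m (F × (Base m →L[ℝ] F)) (JModel m F)
    (jetProj m F EE π)) (η : VolumeForm m M) {z : J1 m F EE π} (h : z ∈ C.tot.source)
    (α : JModel m F →L[ℝ] ℝ) : (C.formCoord (wedgeVol η z α)).2.2 =
      wedgeFst (C.density η (π z.pt) • stdVol m) (α.comp (C.dtotSymm (C.tot z))) := by
  apply Subtype.ext
  refine (C.formCoord_coe (wedgeVol η z α) h).trans ?_
  ext v
  rw [wedgeFst_apply, ContinuousAlternatingMap.compContinuousLinearMap_apply]
  refine (ContinuousAlternatingMap.alternatizeUncurryFin_apply _ _).trans ?_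
  refine Finset.sum_congr rfl fun i _ => congrArg _ (congrArg (α (C.dtotSymm (C.tot z) (v i)) * ·) ?_)
  refine Eq.trans ?_ (C.volumeForm_comp_dbaseSymm η (jetProj m F EE π z) _)
  refine congrArg (η.toFun (jetProj m F EE π z)) ?_
  ext1 j
  exact C.dproj_dtotSymm_apply h (v (i.succAbove j))

omit [IsManifold 𝓘(ℝ, Base m) ∞ M] in
lemma vertPart_wedgeVol (C : FiberedChart m (F × (Base m →L[ℝ] F)) (JModel m F)
    (jetProj m F EE π)) (η : VolumeForm m M) {z : J1 m F EE π} (h : z ∈ C.tot.source)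
    (α : JModel m F →L[ℝ] ℝ) : HFib.vertPart (C.formCoord (wedgeVol η z α)).2.2 =
      C.density η (π z.pt) • (α.comp (C.dtotSymm (C.tot z))).comp
        (ContinuousLinearMap.inr ℝ (Base m) (F × (Base m →L[ℝ] F))) := by
  rw [formCoord_wedgeVol C η h, vertPart_wedgeFst, ContinuousAlternatingMap.smul_apply,
    stdVol_ebasis, smul_eq_mul, mul_one]

omit [IsFibration m F EE π] [IsManifold 𝓘(ℝ, Base m) ∞ M] in
lemma FiberedChart.form_eq_of_vertPart (c : FiberedChart m F EE π) {p q : HForm m F EE π (m + 1)}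
    (hp : p.pt ∈ c.tot.source) (h : p.pt = q.pt)
    (hv : HFib.vertPart (c.formCoord p).2.2 = HFib.vertPart (c.formCoord q).2.2) : p = q := by
  have h1 : (c.formCoord p).1 = (c.formCoord q).1 := congrArg (fun u => (c.tot u).1) h
  have h2 : (c.formCoord p).2.1 = (c.formCoord q).2.1 := congrArg (fun u => (c.tot u).2) h
  refine (c.formEquiv (m + 1)).injOn hp ?_ (Prod.ext h1 (Prod.ext h2 (HFib.ext_vertPart hv)))
  change q.pt ∈ c.tot.source
  rwa [← h]

-- The wedge product with `η` sees only the restriction of the linear form to vertical vectors,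
-- since a horizontal part would give an `(m+1)`-form on the base.
omit [IsManifold 𝓘(ℝ, Base m) ∞ M] in
lemma wedgeVol_congr (C : FiberedChart m (F × (Base m →L[ℝ] F)) (JModel m F)
    (jetProj m F EE π)) (η : VolumeForm m M) {z : J1 m F EE π} (h : z ∈ C.tot.source)
    {α β : JModel m F →L[ℝ] ℝ}
    (hαβ : ∀ g, α (C.dtotSymm (C.tot z) (0, g)) = β (C.dtotSymm (C.tot z) (0, g))) :
    wedgeVol η z α = wedgeVol η z β := by
  refine C.form_eq_of_vertPart (p := wedgeVol η z α) (q := wedgeVol η z β) h rfl ?_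
  refine (vertPart_wedgeVol C η h α).trans (Eq.trans ?_ (vertPart_wedgeVol C η h β).symm)
  refine congrArg _ (ContinuousLinearMap.ext fun g => ?_)
  exact hαβ g

variable [FiniteDimensional ℝ F]

/-- The Tulczyjew morphism may be evaluated in any fibered chart. -/
lemma FiberedChart.tulczyjew_eq (c : FiberedChart m F EE π) (η : VolumeForm m M)
    {z : JMom m F EE π} (h : z.pt.pt ∈ c.tot.source) :
    tulczyjew η z = wedgeVol η (j1nu m F EE π z)
      ((c.density η (π z.pt.pt))⁻¹ • c.momentumForm z) := by
  have h₀ := mem_fiberedChartAt (m := m) (F := F) (EE := EE) (π := π) z.pt.pt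
  refine wedgeVol_congr c.jet η (z := j1nu m F EE π z) h fun g => ?_
  set c₀ := fiberedChartAt m F EE π z.pt.pt with hc₀
  set v := c.jet.dtotSymm (c.jet.tot (j1nu m F EE π z)) (0, g) with hv
  have hv0 : (c₀.jet.dtot (j1nu m F EE π z) v).1 = 0 := by
    rw [c₀.jet.fst_eq_zero_iff (u := j1nu m F EE π z) h₀]
    refine (c.jet.dproj_dtotSymm_apply (u := j1nu m F EE π z) h (0, g)).trans ?_
    exact map_zero _
  -- The Jacobian acquired by the momentum form is the one acquired by the density of `η`, and the
  -- quotient does not change.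
  have h1 := c₀.momentumForm_trans c h₀ h hv0
  have h2 := c₀.density_trans c η (c₀.map_source _ h₀) (c.map_source _ h)
  have h3 := c.density_ne_zero η (c.map_source _ h)
  have h4 := c₀.density_ne_zero η (c₀.map_source _ h₀)
  simp only [smul_apply, smul_eq_mul]
  rw [h1, h2]
  have h5 : (fderiv ℝ (c.baseTrans c₀) (c.base (π z.pt.pt))).det ≠ 0 := by
    intro h5
    rw [h5, zero_mul] at h2
    exact h3 h2
  field_simp

/-- Writing `η = ρ dᵐx`, the factor `ρ` of the wedge product cancels the inverse density in the
morphism. -/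
lemma FiberedChart.vertPart_tulczyjew (c : FiberedChart m F EE π) (η : VolumeForm m M)
    {z : JMom m F EE π} (h : z.pt.pt ∈ c.tot.source) :
    HFib.vertPart (c.jet.formCoord (tulczyjew η z)).2.2 = momPair ((c.forms m).jetCoord z) := by
  rw [c.tulczyjew_eq η h]
  refine (vertPart_wedgeVol c.jet η (z := j1nu m F EE π z) h _).trans ?_
  refine ContinuousLinearMap.ext fun g => ?_
  change c.density η (π z.pt.pt) * ((c.density η (π z.pt.pt))⁻¹ * c.momentumForm z _) = _
  rw [mul_inv_cancel_left₀ (c.density_ne_zero η (c.map_source _ h)), c.momentumForm_apply]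
  exact congrArg (fun t : JModel m F => momPair ((c.forms m).jetCoord z) t.2)
    (c.jet.dtot_dtotSymm_apply (u := j1nu m F EE π z) h (0, g))

end Coordinates

/-! ### The local Lagrangian and the vertical part of its differential -/

section LocalLagrangian

variable {m : ℕ} {F EE : Type*} [NormedAddCommGroup F] [NormedSpace ℝ F]
  [NormedAddCommGroup EE] [NormedSpace ℝ EE]
  {M E : Type*} [TopologicalSpace M] [ChartedSpace (Base m) M]
  [TopologicalSpace E] [ChartedSpace EE E]

lemma FiberedChart.mfderiv_comp_dtotSymm {π : E → M} (C : FiberedChart m F EE π) {f : E → ℝ}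
    {u : E} (h : u ∈ C.tot.source) (hf : ContMDiff 𝓘(ℝ, EE) 𝓘(ℝ, ℝ) ∞ f) :
    (mfderiv 𝓘(ℝ, EE) 𝓘(ℝ, ℝ) f u : EE →L[ℝ] ℝ).comp (C.dtotSymm (C.tot u)) =
      fderiv ℝ (f ∘ C.tot.symm) (C.tot u) := by
  have ht := C.tot.map_source h
  have h1 : MDifferentiableAt 𝓘(ℝ, EE) 𝓘(ℝ, ℝ) f (C.tot.symm (C.tot u)) :=
    (hf _).mdifferentiableAt (by simp)
  have h2 := mfderiv_comp (C.tot u) h1 (C.mdiff_tot.mdifferentiableAt_symm ht)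
  rw [C.tot.left_inv h] at h2
  exact (h2.symm.trans mfderiv_eq_fderiv)

lemma FiberedChart.fst_mem_target {π : E → M} (C : FiberedChart m F EE π) {y : Base m × F}
    (hy : y ∈ C.tot.target) : y.1 ∈ C.base.target := by
  have h := C.fst_tot _ (C.tot.map_target hy)
  rw [C.tot.right_inv hy] at h
  rw [h]
  exact C.base.map_source (C.map_source _ (C.tot.map_target hy))

lemma FiberedChart.contDiffOn_density_fst {π : E → M} [IsManifold 𝓘(ℝ, Base m) ∞ M]
    (C : FiberedChart m F EE π) (η : VolumeForm m M) :
    ContDiffOn ℝ ∞ (fun y : Base m × F =>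
      η.toFun (C.base.symm y.1) (fun i => C.dbaseSymm y.1 (ebasis i))) C.tot.target :=
  (C.contDiffOn_density η).comp contDiff_fst.contDiffOn fun _ hy => C.fst_mem_target hy

lemma FiberedChart.density_eq {π : E → M} (C : FiberedChart m F EE π) (η : VolumeForm m M) {u : E}
    (h : u ∈ C.tot.source) : C.density η (π u) =
      η.toFun (C.base.symm (C.tot u).1) (fun i => C.dbaseSymm (C.tot u).1 (ebasis i)) := by
  rw [C.fst_tot u h, C.base.left_inv (C.map_source u h)]
  rfl

/-- A factor that depends on the base alone is constant for vertical derivatives. -/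
lemma fderiv_mul_comp_fst {A B : Type*} [NormedAddCommGroup A] [NormedSpace ℝ A]
    [NormedAddCommGroup B] [NormedSpace ℝ B] {f : A × B → ℝ} {ρ : A → ℝ} {y : A × B}
    (hf : DifferentiableAt ℝ f y) (hρ : DifferentiableAt ℝ ρ y.1) :
    (fderiv ℝ (fun y => f y * ρ y.1) y).comp (ContinuousLinearMap.inr ℝ A B) =
      ρ y.1 • (fderiv ℝ f y).comp (ContinuousLinearMap.inr ℝ A B) := by
  have h : HasFDerivAt (fun y => f y * ρ y.1) _ y :=
    hf.hasFDerivAt.mul (hρ.hasFDerivAt.comp y (hasFDerivAt_fst (𝕜 := ℝ) (p := y)))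
  rw [h.fderiv]
  ext g
  simp

section DensityCoefficient

variable {π : E → M} [IsFibration m F EE π] (η : VolumeForm m M) {𝓛 : LagrangianDensity m F EE π}
  (C : FiberedChart m (F × (Base m →L[ℝ] F)) (JModel m F) (jetProj m F EE π))

/-- The coefficient of the Lagrangian density in a fibered chart of the jet bundle. -/
def densityCoeff (𝓛 : LagrangianDensity m F EE π) (y : JModel m F) : ℝ :=
  lagrangianFunction η 𝓛 (C.tot.symm y) *
    η.toFun (C.base.symm y.1) (fun i => C.dbaseSymm y.1 (ebasis i))

variable [IsManifold 𝓘(ℝ, Base m) ∞ M]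
  (h𝓛 : ContMDiff 𝓘(ℝ, JModel m F) 𝓘(ℝ, ℝ) ∞ (lagrangianFunction η 𝓛))
include h𝓛

lemma contDiffOn_densityCoeff : ContDiffOn ℝ ∞ (densityCoeff η C 𝓛) C.tot.target :=
  (C.contDiffOn_comp_symm h𝓛.contMDiffOn).mul (C.contDiffOn_density_fst η)

lemma contDiffAt_densityCoeff {z : J1 m F EE π} (h : z ∈ C.tot.source) :
    ContDiffAt ℝ ∞ (densityCoeff η C 𝓛) (C.tot z) :=
  (contDiffOn_densityCoeff η C h𝓛).contDiffAt (C.tot.open_target.mem_nhds (C.tot.map_source h))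

/-- With `η = ρ dᵐx`, the forms `dL ∧ η` and `d(Lρ) ∧ dᵐx` coincide, because `dρ` is horizontal. Any
fibered chart of `J¹π` over `M` is allowed, not just those induced from `E`; the preferred chart is
needed later. -/
lemma vertPart_formCoord_dLagrangian {z : J1 m F EE π} (h : z ∈ C.tot.source) :
    HFib.vertPart (C.formCoord (dLagrangian η 𝓛 z)).2.2 =
      (fderiv ℝ (densityCoeff η C 𝓛) (C.tot z)).comp
        (ContinuousLinearMap.inr ℝ (Base m) (F × (Base m →L[ℝ] F))) := by
  have ht := C.tot.map_source h
  have hd : C.density η (π z.pt) = _ := C.density_eq η h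
  have h1 := fderiv_mul_comp_fst (f := lagrangianFunction η 𝓛 ∘ C.tot.symm)
    (ρ := fun y => η.toFun (C.base.symm y) (fun i => C.dbaseSymm y (ebasis i))) (y := C.tot z)
    (((C.contDiffOn_comp_symm h𝓛.contMDiffOn).contDiffAt
      (C.tot.open_target.mem_nhds ht)).differentiableAt (by simp))
    (((C.contDiffOn_density η).contDiffAt (C.base.open_target.mem_nhds
      (C.fst_mem_target ht))).differentiableAt (by simp))
  refine (vertPart_wedgeVol C η h _).trans (Eq.trans ?_ h1.symm)
  rw [hd]
  exact congrArg (fun α => _ • ContinuousLinearMap.comp α _) (C.mfderiv_comp_dtotSymm h h𝓛)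

end DensityCoefficient

variable {n : ℕ} {π : E → M} [IsFibration m (Base n) EE π]
  (c : FiberedChart m (Base n) EE π) (η : VolumeForm m M)
  (𝓛 : LagrangianDensity m (Base n) EE π)

lemma FiberedChart.localLagrangian_eq {y : JModel m (Base n)} (hy : y ∈ c.jet.tot.target) :
    c.localLagrangian 𝓛 y = densityCoeff η c.jet 𝓛 y := by
  have h1 := lagrangianFunction_smul η 𝓛 (c.jetOfCoord y)
  have h2 : jetProj m (Base n) EE π (c.jetOfCoord y) = c.base.symm y.1 := by
    have hy' : (y.1, y.2.1) ∈ c.tot.target := hy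
    refine (c.proj_eqOn (c.tot.map_target hy')).trans ?_
    rw [c.tot.right_inv hy']
  rw [h2] at h1
  exact (DFunLike.congr_fun h1 (fun i => c.dbaseSymm y.1 (ebasis i))).symm

variable {𝓛}
variable (h𝓛 : ContMDiff 𝓘(ℝ, JModel m (Base n)) 𝓘(ℝ, ℝ) ∞ (lagrangianFunction η 𝓛))
include h𝓛

lemma FiberedChart.contDiffOn_lagrangianFunction :
    ContDiffOn ℝ ∞ (lagrangianFunction η 𝓛 ∘ c.jet.tot.symm) c.jet.tot.target :=
  c.jet.contDiffOn_comp_symm h𝓛.contMDiffOn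

variable [IsManifold 𝓘(ℝ, Base m) ∞ M]

lemma FiberedChart.contDiffOn_localLagrangian :
    ContDiffOn ℝ ∞ (c.localLagrangian 𝓛) c.jet.tot.target :=
  (contDiffOn_densityCoeff η c.jet h𝓛).congr fun _ hy => c.localLagrangian_eq η 𝓛 hy

omit h𝓛 [IsManifold 𝓘(ℝ, Base m) ∞ M] in
lemma FiberedChart.fderiv_localLagrangian {y : JModel m (Base n)} (hy : y ∈ c.jet.tot.target) :
    fderiv ℝ (c.localLagrangian 𝓛) y = fderiv ℝ (densityCoeff η c.jet 𝓛) y :=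
  Filter.EventuallyEq.fderiv_eq (Filter.eventuallyEq_of_mem (c.jet.tot.open_target.mem_nhds hy)
    fun _ hy => c.localLagrangian_eq η 𝓛 hy)

lemma FiberedChart.vertPart_dLagrangian {z : J1 m (Base n) EE π} (h : z.pt ∈ c.tot.source) :
    HFib.vertPart (c.jet.formCoord (dLagrangian η 𝓛 z)).2.2 =
      (fderiv ℝ (c.localLagrangian 𝓛) (c.jetCoord z)).comp
        (ContinuousLinearMap.inr ℝ (Base m) (Base n × (Base m →L[ℝ] Base n))) := by
  have ht : c.jetCoord z ∈ c.jet.tot.target := c.jet.tot.map_source (x := z) h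
  rw [c.fderiv_localLagrangian η ht]
  exact vertPart_formCoord_dLagrangian η c.jet h𝓛 h

end LocalLagrangian

/-! ### Components of vertical covectors -/

section EulerLagrangeEquations

variable {m n : ℕ}

variable (m) in
/-- The dual of the model of the vertical vectors of the jet bundle. -/
abbrev VertDual (F : Type*) [NormedAddCommGroup F] [NormedSpace ℝ F] : Type _ :=
  F × (Base m →L[ℝ] F) →L[ℝ] ℝ

variable (m n) in
/-- The components of a linear form on the model of the vertical vectors of the jet bundle. -/
def fiberDual : VertDual m (Base n) ≃ₗ[ℝ]
    (Fin m → Fin n → ℝ) × (Fin n → ℝ) where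
  toFun α := (fun i a => α (0, (EuclideanSpace.proj i).smulRight (ebasis a)),
    fun a => α (ebasis a, 0))
  map_add' α β := by ext <;> simp
  map_smul' t α := by ext <;> simp
  invFun q := ∑ a, q.2 a • (EuclideanSpace.proj a : Base n →L[ℝ] ℝ).comp
      (ContinuousLinearMap.fst ℝ (Base n) (Base m →L[ℝ] Base n)) +
    ∑ i, ∑ a, q.1 i a • (EuclideanSpace.proj a : Base n →L[ℝ] ℝ).comp
      ((ContinuousLinearMap.apply ℝ (Base n) (ebasis i)).comp
        (ContinuousLinearMap.snd ℝ (Base n) (Base m →L[ℝ] Base n)))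
  left_inv α := by
    have hu : ∀ u : Base n, u = ∑ a, u a • ebasis a := fun u => by
      have := (EuclideanSpace.basisFun (Fin n) ℝ).sum_repr u
      simpa using this.symm
    have hx : ∀ x : Base m, x = ∑ a, x a • ebasis a := fun u => by
      have := (EuclideanSpace.basisFun (Fin m) ℝ).sum_repr u
      simpa using this.symm
    have hw : ∀ w : Base m →L[ℝ] Base n, w = ∑ i, ∑ a, (w (ebasis i) a) •
        (EuclideanSpace.proj i : Base m →L[ℝ] ℝ).smulRight (ebasis a) := fun w => by
      refine ContinuousLinearMap.ext fun x => ?_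
      conv_lhs => rw [hx x, map_sum]
      rw [sum_apply]
      refine Finset.sum_congr rfl fun i _ => ?_
      rw [map_smul, hu (w (ebasis i)), Finset.smul_sum, sum_apply]
      refine Finset.sum_congr rfl fun a _ => ?_
      rw [← hu (w (ebasis i))]
      simp [smul_smul, mul_comm]
    refine ContinuousLinearMap.ext fun v => ?_
    obtain ⟨u, w⟩ := v
    have h1 : α (u, w) = α (u, 0) + α (0, w) := by rw [← map_add]; simp
    have h2 : α (u, 0) = ∑ a, u a * α (ebasis a, 0) := by
      have := congrArg (α.comp (ContinuousLinearMap.inl ℝ (Base n) (Base m →L[ℝ] Base n))) (hu u)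
      rw [map_sum] at this
      simpa using this
    have h3 : α (0, w) = ∑ i, ∑ a, w (ebasis i) a *
        α (0, (EuclideanSpace.proj i).smulRight (ebasis a)) := by
      have := congrArg (α.comp (ContinuousLinearMap.inr ℝ (Base n) (Base m →L[ℝ] Base n))) (hw w)
      simp only [map_sum, map_smul] at this
      simpa using this
    rw [h1, h2, h3]
    simp [mul_comm]
  right_inv q := by
    ext i a
    · have : ∀ j, (((EuclideanSpace.proj i : Base m →L[ℝ] ℝ).smulRight (ebasis a)) (ebasis j) :
          Base n) = if i = j then ebasis a else 0 := fun j => by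
        by_cases h : i = j
        · subst h; simp
        · simp [h]
      simp only [add_apply, sum_apply, smul_apply, ContinuousLinearMap.comp_apply,
        ContinuousLinearMap.coe_fst', ContinuousLinearMap.coe_snd', ContinuousLinearMap.apply_apply,
        map_zero, smul_zero, Finset.sum_const_zero, zero_add, this]
      rw [Finset.sum_eq_single i (fun j _ hj => by simp [hj.symm]) (by simp)]
      simp
    · simp

end EulerLagrangeEquations

/-! ### Differentials of maps with known chart expressions -/

section ChartExpressions

variable {m : ℕ} {F EE : Type*} [NormedAddCommGroup F] [NormedSpace ℝ F]
  [NormedAddCommGroup EE] [NormedSpace ℝ EE]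
  {M E : Type*} [TopologicalSpace M] [ChartedSpace (Base m) M]
  [TopologicalSpace E] [ChartedSpace EE E] {π : E → M}
  {F' EE' : Type*} [NormedAddCommGroup F'] [NormedSpace ℝ F']
  [NormedAddCommGroup EE'] [NormedSpace ℝ EE']
  {E' : Type*} [TopologicalSpace E'] [ChartedSpace EE' E'] {π' : E' → M}
  {X : Type*} [NormedAddCommGroup X] [NormedSpace ℝ X]

namespace FiberedChart
variable (C : FiberedChart m F EE π) (C' : FiberedChart m F' EE' π')

lemma contMDiffOn_of_eq {f : E → X} {G : Base m × F → X}
    (hf : ∀ u ∈ C.tot.source, f u = G (C.tot u)) (hG : ContDiffOn ℝ ∞ G C.tot.target) :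
    ContMDiffOn 𝓘(ℝ, EE) 𝓘(ℝ, X) ∞ f C.tot.source :=
  (hG.contMDiffOn.comp C.contMDiffOn_tot C.tot.mapsTo).congr hf

lemma mfderiv_of_eq {f : E → X} {G : Base m × F → X} {u : E} (hu : u ∈ C.tot.source)
    (hf : ∀ u ∈ C.tot.source, f u = G (C.tot u)) (hG : DifferentiableAt ℝ G (C.tot u)) :
    (mfderiv 𝓘(ℝ, EE) 𝓘(ℝ, X) f u : EE →L[ℝ] X) = (fderiv ℝ G (C.tot u)).comp (C.dtot u) := by
  have e : f =ᶠ[𝓝 u] G ∘ C.tot := by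
    filter_upwards [C.tot.open_source.mem_nhds hu] with t ht using hf t ht
  have h1 := e.mfderiv_eq (I := 𝓘(ℝ, EE)) (I' := 𝓘(ℝ, X))
  have h2 := mfderiv_comp u hG.mdifferentiableAt (C.mdiff_tot.mdifferentiableAt hu)
  rw [mfderiv_eq_fderiv] at h2
  exact h1.trans h2

lemma mfderiv_apply_of_eq {f : E → X} {G : Base m × F → X} {u : E} (hu : u ∈ C.tot.source)
    (hf : ∀ u ∈ C.tot.source, f u = G (C.tot u)) {G' : Base m × F →L[ℝ] X}
    (hG : HasFDerivAt G G' (C.tot u)) (v : EE) :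
    (mfderiv 𝓘(ℝ, EE) 𝓘(ℝ, X) f u : EE →L[ℝ] X) v = G' (C.dtot u v) := by
  rw [C.mfderiv_of_eq hu hf hG.differentiableAt, hG.fderiv]
  rfl

lemma mdifferentiableAt_of_eq {f : E → E'} {G : Base m × F → Base m × F'} {u : E}
    (hu : u ∈ C.tot.source) (hf : ∀ u ∈ C.tot.source, f u ∈ C'.tot.source)
    (hfG : ∀ u ∈ C.tot.source, C'.tot (f u) = G (C.tot u))
    (hG : DifferentiableAt ℝ G (C.tot u)) : MDifferentiableAt 𝓘(ℝ, EE) 𝓘(ℝ, EE') f u := by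
  have e : f =ᶠ[𝓝 u] C'.tot.symm ∘ G ∘ C.tot := by
    filter_upwards [C.tot.open_source.mem_nhds hu] with t ht
    change f t = C'.tot.symm (G (C.tot t))
    rw [← hfG t ht, C'.tot.left_inv (hf t ht)]
  have h1 : MDifferentiableAt 𝓘(ℝ, EE) 𝓘(ℝ, Base m × F') (G ∘ C.tot) u :=
    MDifferentiableAt.comp u hG.mdifferentiableAt (C.mdiff_tot.mdifferentiableAt hu)
  have h2 : MDifferentiableAt 𝓘(ℝ, Base m × F') 𝓘(ℝ, EE') C'.tot.symm ((G ∘ C.tot) u) := by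
    refine C'.mdiff_tot.mdifferentiableAt_symm ?_
    change G (C.tot u) ∈ _
    rw [← hfG u hu]
    exact C'.tot.map_source (hf u hu)
  exact (MDifferentiableAt.comp u h2 h1).congr_of_eventuallyEq e

lemma dtot_mfderiv_of_eq {f : E → E'} {G : Base m × F → Base m × F'} {u : E}
    (hu : u ∈ C.tot.source) (hf : ∀ u ∈ C.tot.source, f u ∈ C'.tot.source)
    (hfG : ∀ u ∈ C.tot.source, C'.tot (f u) = G (C.tot u))
    (hG : DifferentiableAt ℝ G (C.tot u)) (v : EE) :
    C'.dtot (f u) ((mfderiv 𝓘(ℝ, EE) 𝓘(ℝ, EE') f u : EE →L[ℝ] EE') v) =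
      fderiv ℝ G (C.tot u) (C.dtot u v) := by
  have h1 := mfderiv_comp u (C'.mdiff_tot.mdifferentiableAt (hf u hu))
    (C.mdifferentiableAt_of_eq C' hu hf hfG hG)
  have h2 := C.mfderiv_of_eq (f := C'.tot ∘ f) hu hfG hG
  exact DFunLike.congr_fun (h1.symm.trans h2) v

lemma dtot_mfderiv_apply_of_eq {f : E → E'} {G : Base m × F → Base m × F'} {u : E}
    (hu : u ∈ C.tot.source) (hf : ∀ u ∈ C.tot.source, f u ∈ C'.tot.source)
    (hfG : ∀ u ∈ C.tot.source, C'.tot (f u) = G (C.tot u))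
    {G' : Base m × F →L[ℝ] Base m × F'} (hG : HasFDerivAt G G' (C.tot u)) (v : EE) :
    C'.dtot (f u) ((mfderiv 𝓘(ℝ, EE) 𝓘(ℝ, EE') f u : EE →L[ℝ] EE') v) = G' (C.dtot u v) := by
  rw [C.dtot_mfderiv_of_eq C' hu hf hfG hG.differentiableAt, hG.fderiv]

lemma dtot_surjective {u : E} (hu : u ∈ C.tot.source) : Function.Surjective (C.dtot u) :=
  fun v => ⟨_, C.dtot_dtotSymm_apply hu v⟩

lemma dtot_injective {u : E} (hu : u ∈ C.tot.source) : Function.Injective (C.dtot u) :=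
  Function.LeftInverse.injective (g := C.dtotSymm (C.tot u)) (C.dtotSymm_dtot_apply hu)

end FiberedChart
end ChartExpressions

lemma surjective_of_comp_eq {X Y Z : Type*} {f : Y → Z} {g : X → Y} {h : X → Z}
    (hf : Function.Injective f) (e : ∀ x, f (g x) = h x) (hh : Function.Surjective h) :
    Function.Surjective g := fun y => by
  obtain ⟨x, hx⟩ := hh (f y)
  exact ⟨x, hf ((e x).trans hx)⟩

/-! ### Linear maps composed with differentiable ones -/

section AffineComposition

variable {A B C X : Type*} [NormedAddCommGroup A] [NormedSpace ℝ A] [NormedAddCommGroup B]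
  [NormedSpace ℝ B] [NormedAddCommGroup C] [NormedSpace ℝ C] [NormedAddCommGroup X]
  [NormedSpace ℝ X] (L : C →L[ℝ] X) (P : A →L[ℝ] C) (J : A →L[ℝ] B) {H : B → C}

lemma hasFDerivAt_sub_comp {y : A} (hH : DifferentiableAt ℝ H (J y)) :
    HasFDerivAt (fun y => L (P y - H (J y))) (L.comp (P - (fderiv ℝ H (J y)).comp J)) y :=
  L.hasFDerivAt.comp y (P.hasFDerivAt.sub (hH.hasFDerivAt.comp y J.hasFDerivAt))

lemma hasFDerivAt_clm_comp {f : B → C} {y : B} (hf : DifferentiableAt ℝ f y) :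
    HasFDerivAt (fun y => L (f y)) (L.comp (fderiv ℝ f y)) y :=
  L.hasFDerivAt.comp y hf.hasFDerivAt

lemma contDiffOn_sub_comp {S : Set B} (hH : ContDiffOn ℝ ∞ H S) :
    ContDiffOn ℝ ∞ (fun y => L (P y - H (J y))) (J ⁻¹' S) :=
  L.contDiff.comp_contDiffOn (P.contDiff.contDiffOn.sub
    (hH.comp J.contDiff.contDiffOn fun _ hy => hy))

end AffineComposition

/-! ### Momenta as coordinates and the coordinate expression of the equations -/

section Momenta

variable {m : ℕ} {F : Type*} [NormedAddCommGroup F] [NormedSpace ℝ F]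

/-- The form `∑ pⁱ_α duᵅ ∧ dᵐ⁻¹xᵢ` with given momenta. -/
def HFib.ofMom (a : Fin m → F →L[ℝ] ℝ) : HFib m F m :=
  ⟨(stdVol m).fderivCompContinuousLinearMap (ContinuousLinearMap.fst ℝ (Base m) F)
    ((∑ i, (a i).smulRight (ebasis i)).comp (ContinuousLinearMap.snd ℝ (Base m) F)), by
    intro v i j hij hi hj
    rw [ContinuousAlternatingMap.fderivCompContinuousLinearMap_apply]
    refine Finset.sum_eq_zero fun k _ => ?_
    by_cases hk : i = k
    · refine (stdVol m).map_coord_zero j ?_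
      rw [Function.update_of_ne (by rintro rfl; exact hij hk)]
      exact hj
    · refine (stdVol m).map_coord_zero i ?_
      rw [Function.update_of_ne hk]
      exact hi⟩

/-- Expand `w` in the standard basis: all terms but the `i`-th repeat a basis vector. -/
lemma stdVol_update_ebasis (i : Fin m) (w : Base m) :
    stdVol m (Function.update (fun k => ebasis k) i w) = w i := by
  have hx : w = ∑ a, w a • ebasis a := by
    have := (EuclideanSpace.basisFun (Fin m) ℝ).sum_repr w
    simpa using this.symm
  have h := congrArg ((stdVol m).toContinuousMultilinearMap.toContinuousLinearMap
    (fun k => ebasis k) i) hx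
  rw [map_sum, Finset.sum_eq_single i] at h
  · refine h.trans ?_
    rw [map_smul]
    have : (stdVol m).toContinuousMultilinearMap.toContinuousLinearMap (fun k => ebasis k) i
        (ebasis i) = 1 := by
      change stdVol m (Function.update (fun k => ebasis k) i (ebasis i)) = 1
      rw [Function.update_eq_self i (fun k : Fin m => (ebasis k : Base m)), stdVol_ebasis]
    rw [this, smul_eq_mul, mul_one]
  · intro j _ hj
    rw [map_smul]
    have : (stdVol m).toContinuousMultilinearMap.toContinuousLinearMap (fun k => ebasis k) i
        (ebasis j) = 0 := by
      refine (stdVol m).map_eq_zero_of_eq _ ?_ hj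
      rw [Function.update_self, Function.update_of_ne hj]
    rw [this, smul_zero]
  · simp

/-- Only the summand that applies the linear map to the vertical slot survives; in the others the
vertical vector is projected to zero. -/
lemma HFib.mom_ofMom (a : Fin m → F →L[ℝ] ℝ) (i : Fin m) : HFib.mom (HFib.ofMom a) i = a i := by
  ext g
  rw [HFib.mom_apply]
  refine (ContinuousAlternatingMap.fderivCompContinuousLinearMap_apply _ _ _ _).trans ?_
  rw [Finset.sum_eq_single i]
  · have e : (fun l => Function.update (fun _ => ContinuousLinearMap.fst ℝ (Base m) F) i
        ((∑ i, (a i).smulRight (ebasis i)).comp (ContinuousLinearMap.snd ℝ (Base m) F)) l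
        (Function.update (fun k => ((ebasis k, 0) : Base m × F)) i (0, g) l)) =
        Function.update (fun k => ebasis k) i (∑ i, a i g • ebasis i) := by
      ext1 l
      by_cases hl : l = i
      · subst hl; simp
      · simp [hl]
    refine (congrArg (stdVol m) e).trans ?_
    rw [stdVol_update_ebasis]
    simp [Finset.sum_apply, Pi.single_apply]
  · intro j _ hj
    refine (stdVol m).map_coord_zero i ?_
    rw [Function.update_of_ne hj.symm, Function.update_self]
    rfl
  · simp

variable [FiniteDimensional ℝ F]

variable (m F) in
/-- `momPair` as a continuous linear map. -/
def momPairL : JModel m (F × HFib m F m) →L[ℝ] VertDual m F :=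
  LinearMap.toContinuousLinearMap
    { toFun := momPair
      map_add' y y' := ContinuousLinearMap.ext fun V => by
        rw [add_apply, momPair_apply, momPair_apply, momPair_apply, ← Finset.sum_add_distrib]
        refine Finset.sum_congr rfl fun i _ => ?_
        rw [add_add_add_comm]
        rfl
      map_smul' t y := ContinuousLinearMap.ext fun V => by
        rw [smul_apply, momPair_apply, momPair_apply, Finset.smul_sum]
        refine Finset.sum_congr rfl fun i _ => ?_
        rw [smul_add]
        rfl }

omit [FiniteDimensional ℝ F] in
/-- The differential of a function along the vertical vectors. -/
def fiberwiseFDeriv (f : JModel m F → ℝ) (y : JModel m F) : VertDual m F :=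
  (fderiv ℝ f y).comp (ContinuousLinearMap.inr ℝ (Base m) (F × (Base m →L[ℝ] F)))

omit [FiniteDimensional ℝ F] in
lemma contDiffOn_fiberwiseFDeriv {f : JModel m F → ℝ} {S : Set (JModel m F)}
    (hf : ContDiffOn ℝ ∞ f S) (hS : IsOpen S) : ContDiffOn ℝ ∞ (fiberwiseFDeriv f) S :=
  (hf.fderiv_of_isOpen hS (m := ∞) (by simp)).clm_comp contDiffOn_const

lemma momPairL_apply (y : JModel m (F × HFib m F m)) : momPairL m F y = momPair y := rfl

variable (m F) in
/-- The coordinate expression of `j¹ν`. -/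
def jnuL : JModel m (F × HFib m F m) →L[ℝ] JModel m F :=
  (ContinuousLinearMap.fst ℝ (Base m) ((F × HFib m F m) × (Base m →L[ℝ] F × HFib m F m))).prod
    (((ContinuousLinearMap.fst ℝ F (HFib m F m)).comp
      ((ContinuousLinearMap.fst ℝ (F × HFib m F m) (Base m →L[ℝ] F × HFib m F m)).comp
        (ContinuousLinearMap.snd ℝ (Base m)
          ((F × HFib m F m) × (Base m →L[ℝ] F × HFib m F m))))).prod
    ((ContinuousLinearMap.compL ℝ (Base m) (F × HFib m F m) F
        (ContinuousLinearMap.fst ℝ F (HFib m F m))).comp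
      ((ContinuousLinearMap.snd ℝ (F × HFib m F m) (Base m →L[ℝ] F × HFib m F m)).comp
        (ContinuousLinearMap.snd ℝ (Base m)
          ((F × HFib m F m) × (Base m →L[ℝ] F × HFib m F m))))))

omit [FiniteDimensional ℝ F] in
lemma jnuL_apply (y : JModel m (F × HFib m F m)) : jnuL m F y =
    (y.1, y.2.1.1, (ContinuousLinearMap.fst ℝ F (HFib m F m)).comp y.2.2) := rfl

/-- Vectors with prescribed image under `j¹ν` and prescribed momenta. -/
lemma exists_jnuL_momPairL (hm : 1 ≤ m) (x : JModel m F) (α : VertDual m F) :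
    ∃ y, jnuL m F y = x ∧ momPairL m F y = α := by
  -- Only the trace of the derivatives of the momenta is prescribed, so it can be carried by a
  -- single index; such an index exists because `m ≥ 1`.
  let i₀ : Fin m := ⟨0, hm⟩
  let a : Fin m → F →L[ℝ] ℝ := fun i => α.comp ((ContinuousLinearMap.inr ℝ F (Base m →L[ℝ] F)).comp
    (ContinuousLinearMap.smulRightL ℝ (Base m) F (EuclideanSpace.proj i)))
  let b : Fin m → F →L[ℝ] ℝ := fun i =>
    if i = i₀ then α.comp (ContinuousLinearMap.inl ℝ F (Base m →L[ℝ] F)) else 0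
  refine ⟨(x.1, (x.2.1, HFib.ofMom a), x.2.2.prod
    ((EuclideanSpace.proj i₀ : Base m →L[ℝ] ℝ).smulRight (HFib.ofMom b))), ?_, ?_⟩
  · rw [jnuL_apply]
    rfl
  · rw [momPairL_apply]
    refine ContinuousLinearMap.ext fun v => ?_
    rw [momPair_apply, Finset.sum_add_distrib]
    have h1 : ∀ i : Fin m, HFib.mom (((EuclideanSpace.proj i₀ : Base m →L[ℝ] ℝ).smulRight
        (HFib.ofMom b)) (ebasis i)) i v.1 = if i = i₀ then α (v.1, 0) else 0 := fun i => by
      rw [ContinuousLinearMap.smulRight_apply, HFib.mom_smul, HFib.mom_ofMom]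
      by_cases hi : i = i₀
      · simp [b, hi]
      · simp [b, hi]
    have h2 : v.2 = ∑ i, (EuclideanSpace.proj i : Base m →L[ℝ] ℝ).smulRight (v.2 (ebasis i)) := by
      refine ContinuousLinearMap.ext fun t => ?_
      have ht : t = ∑ a, t a • ebasis a := by
        have := (EuclideanSpace.basisFun (Fin m) ℝ).sum_repr t
        simpa using this.symm
      conv_lhs => rw [ht, map_sum]
      simp [sum_apply]
    have h3 : ∑ i, HFib.mom (HFib.ofMom a) i (v.2 (ebasis i)) = α (0, v.2) := by
      have := congrArg (α.comp (ContinuousLinearMap.inr ℝ F (Base m →L[ℝ] F))) h2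
      rw [map_sum] at this
      simp only [HFib.mom_ofMom]
      exact this.symm
    have h4 : α v = α (v.1, 0) + α (0, v.2) := by rw [← map_add]; simp
    rw [h4]
    refine congrArg₂ (· + ·) ?_ h3
    refine (Finset.sum_congr rfl fun i _ => h1 i).trans ?_
    simp

variable {X : Type*} [NormedAddCommGroup X] [NormedSpace ℝ X]

/-- The function `L (p - H(x))`, where `p` are the momenta and `x` the coordinates in `J¹π`. -/
def momentumDefect (L : VertDual m F →L[ℝ] X) (H : JModel m F → VertDual m F)
    (y : JModel m (F × HFib m F m)) : X := L (momPairL m F y - H (jnuL m F y))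

/-- The differential of `momentumDefect`. -/
def momentumDefectDeriv (L : VertDual m F →L[ℝ] X) (H' : JModel m F →L[ℝ] VertDual m F) :
    JModel m (F × HFib m F m) →L[ℝ] X := L.comp (momPairL m F - H'.comp (jnuL m F))

lemma hasFDerivAt_momentumDefect (L : VertDual m F →L[ℝ] X) {H : JModel m F → VertDual m F}
    {y : JModel m (F × HFib m F m)} (hH : DifferentiableAt ℝ H (jnuL m F y)) :
    HasFDerivAt (momentumDefect L H) (momentumDefectDeriv L (fderiv ℝ H (jnuL m F y))) y := by
  have h := hasFDerivAt_sub_comp (H := H) (y := y) L (momPairL m F) (jnuL m F) hH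
  unfold momentumDefect momentumDefectDeriv
  exact h

lemma contDiffOn_momentumDefect (L : VertDual m F →L[ℝ] X) {H : JModel m F → VertDual m F}
    {S : Set (JModel m F)} (hH : ContDiffOn ℝ ∞ H S) :
    ContDiffOn ℝ ∞ (momentumDefect L H) (jnuL m F ⁻¹' S) :=
  contDiffOn_sub_comp L (momPairL m F) (jnuL m F) hH

end Momenta

/-! ### Local equations of the Lagrangian set -/

section EulerLagrangeEquations

variable (m n : ℕ) in
/-- `fiberDual` as a continuous linear map. -/
def fiberDualL : VertDual m (Base n) →L[ℝ] (Fin m → Fin n → ℝ) × (Fin n → ℝ) :=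
  (fiberDual m n).toLinearMap.toContinuousLinearMap

lemma fiberDualL_apply {m n : ℕ} (α : VertDual m (Base n)) :
    fiberDualL m n α = fiberDual m n α := rfl

variable {m n : ℕ} {EE : Type*} [NormedAddCommGroup EE] [NormedSpace ℝ EE]
  {M E : Type*} [TopologicalSpace M] [ChartedSpace (Base m) M]
  [TopologicalSpace E] [ChartedSpace EE E] {π : E → M} [IsFibration m (Base n) EE π]
  [IsManifold 𝓘(ℝ, Base m) ∞ M]
  (c : FiberedChart m (Base n) EE π) (η : VolumeForm m M)
  {𝓛 : LagrangianDensity m (Base n) EE π}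

namespace FiberedChart

variable (𝓛) in
/-- The differential of the local Lagrangian along the fibres. -/
def vertDeriv (y : JModel m (Base n)) : VertDual m (Base n) :=
  fiberwiseFDeriv (c.localLagrangian 𝓛) y

omit [IsManifold 𝓘(ℝ, Base m) ∞ M] in
lemma fiberDual_vertDeriv (y : JModel m (Base n)) :
    fiberDual m n (c.vertDeriv 𝓛 y) = (fun i α => c.dLdv 𝓛 α i y, fun α => c.dLdu 𝓛 α y) := rfl

lemma fiberDual_momPair (y : JModel m (Base n × HFib m (Base n) m)) :
    fiberDual m n (momPair y) = (fun i α => HFib.mom y.2.1.2 i (ebasis α),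
      fun α => ∑ i, HFib.mom (y.2.2 (ebasis i)).2 i (ebasis α)) := by
  refine Prod.ext ?_ ?_
  · ext i α
    change momPair y _ = _
    rw [momPair_apply, Finset.sum_eq_single i]
    · simp
    · intro j _ hj
      simp [hj.symm]
    · simp
  · ext α
    change momPair y _ = _
    rw [momPair_apply]
    simp

/-- In natural coordinates the equations are a linear image of the momenta minus the fibre
derivative of the Lagrangian. This shape gives their smoothness and their differential. -/
lemma elEquations_eq {z : JMom m (Base n) EE π} (h : z.pt.pt ∈ c.tot.source) :
    c.elEquations 𝓛 z =
      momentumDefect (fiberDualL m n) (c.vertDeriv 𝓛) ((c.forms m).jet.tot z) := by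
  rw [momentumDefect, fiberDualL_apply, map_sub, momPairL_apply, fiberDual_momPair, fiberDual_vertDeriv]
  have h1 : jnuL m (Base n) ((c.forms m).jet.tot z) = c.jetCoord (j1nu m (Base n) EE π z) :=
    (c.jetCoord_j1nu h).symm
  rw [h1]
  rfl

end FiberedChart

/-- The morphism covers `j¹ν`, so the jet at which `d𝓛` is taken is forced. -/
lemma mem_lagrangianSet_iff {z : JMom m (Base n) EE π} : z ∈ lagrangianSet η 𝓛 ↔
    tulczyjew η z = dLagrangian η 𝓛 (j1nu m (Base n) EE π z) := by
  constructor
  · rintro ⟨w, hw⟩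
    have : w = j1nu m (Base n) EE π z := congrArg HForm.pt hw
    rw [← hw, this]
  · intro h
    exact ⟨_, h.symm⟩

variable (h𝓛 : ContMDiff 𝓘(ℝ, JModel m (Base n)) 𝓘(ℝ, ℝ) ∞ (lagrangianFunction η 𝓛))
include h𝓛

/-- Both forms lie over the same jet, so they agree if and only if their vertical parts do, and
`fiberDual` lists the components of the difference. -/
lemma FiberedChart.tulczyjew_eq_dLagrangian_iff {z : JMom m (Base n) EE π}
    (h : z.pt.pt ∈ c.tot.source) :
    tulczyjew η z = dLagrangian η 𝓛 (j1nu m (Base n) EE π z) ↔ c.elEquations 𝓛 z = 0 := by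
  have h1 := c.vertPart_tulczyjew η h
  have h2 := c.vertPart_dLagrangian η h𝓛 (z := j1nu m (Base n) EE π z) h
  rw [c.elEquations_eq h, momentumDefect, fiberDualL_apply, LinearEquiv.map_eq_zero_iff, sub_eq_zero]
  have h3 : jnuL m (Base n) ((c.forms m).jet.tot z) = c.jetCoord (j1nu m (Base n) EE π z) :=
    (c.jetCoord_j1nu h).symm
  rw [h3]
  constructor
  · intro h0
    rw [h0] at h1
    exact h1.symm.trans h2
  · intro h0
    have e1 : (tulczyjew η z).pt = j1nu m (Base n) EE π z := rfl
    have e2 : (dLagrangian η 𝓛 (j1nu m (Base n) EE π z)).pt = j1nu m (Base n) EE π z := rfl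
    refine c.jet.form_eq_of_vertPart h (e1.trans e2.symm) ?_
    exact (h1.trans h0).trans h2.symm

namespace FiberedChart

lemma contDiffOn_vertDeriv : ContDiffOn ℝ ∞ (c.vertDeriv 𝓛) c.jet.tot.target :=
  contDiffOn_fiberwiseFDeriv (c.contDiffOn_localLagrangian η h𝓛) c.jet.tot.open_target

lemma differentiableAt_vertDeriv {y : JModel m (Base n)} (hy : y ∈ c.jet.tot.target) :
    DifferentiableAt ℝ (c.vertDeriv 𝓛) y :=
  ((c.contDiffOn_vertDeriv η h𝓛).contDiffAt
    (c.jet.tot.open_target.mem_nhds hy)).differentiableAt (by simp)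

omit h𝓛 in
lemma jnuL_tot_mem {z : JMom m (Base n) EE π} (h : z.pt.pt ∈ c.tot.source) :
    jnuL m (Base n) ((c.forms m).jet.tot z) ∈ c.jet.tot.target :=
  c.tot.map_source h

lemma mfderiv_elEquations {z : JMom m (Base n) EE π} (h : z.pt.pt ∈ c.tot.source)
    (v : JModel m (Base n × HFib m (Base n) m)) :
    (mfderiv 𝓘(ℝ, JModel m (Base n × HFib m (Base n) m))
        𝓘(ℝ, (Fin m → Fin n → ℝ) × (Fin n → ℝ)) (c.elEquations 𝓛) z :
      JModel m (Base n × HFib m (Base n) m) →L[ℝ] (Fin m → Fin n → ℝ) × (Fin n → ℝ)) v =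
    momentumDefectDeriv (fiberDualL m n) (fderiv ℝ (c.vertDeriv 𝓛)
      (jnuL m (Base n) ((c.forms m).jet.tot z))) ((c.forms m).jet.dtot z v) :=
  (c.forms m).jet.mfderiv_apply_of_eq (f := c.elEquations 𝓛)
    (G := momentumDefect (fiberDualL m n) (c.vertDeriv 𝓛)) (u := z) h
    (fun _ hu => c.elEquations_eq hu)
    (hasFDerivAt_momentumDefect (fiberDualL m n)
      (c.differentiableAt_vertDeriv η h𝓛 (c.jnuL_tot_mem h))) v

-- Vectors annihilated by `j¹ν` make the Lagrangian term vanish, and their momenta are still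
-- arbitrary.
omit h𝓛 in
lemma momentumDefectDeriv_surjective (hm : 1 ≤ m)
    (H' : JModel m (Base n) →L[ℝ] VertDual m (Base n)) :
    Function.Surjective (momentumDefectDeriv (fiberDualL m n) H') := by
  intro q
  obtain ⟨y, hy, hy'⟩ := exists_jnuL_momPairL hm 0 ((fiberDual m n).symm q)
  refine ⟨y, ?_⟩
  change fiberDualL m n (momPairL m (Base n) y - H' (jnuL m (Base n) y)) = q
  rw [hy, hy', map_zero, sub_zero, fiberDualL_apply, LinearEquiv.apply_symm_apply]

lemma mfderiv_elEquations_surjective (hm : 1 ≤ m) {z : JMom m (Base n) EE π}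
    (h : z.pt.pt ∈ c.tot.source) :
    Function.Surjective (mfderiv 𝓘(ℝ, JModel m (Base n × HFib m (Base n) m))
        𝓘(ℝ, (Fin m → Fin n → ℝ) × (Fin n → ℝ)) (c.elEquations 𝓛) z :
      JModel m (Base n × HFib m (Base n) m) →L[ℝ] (Fin m → Fin n → ℝ) × (Fin n → ℝ)) := by
  exact surjective_of_comp_eq Function.injective_id (c.mfderiv_elEquations η h𝓛 h)
    ((momentumDefectDeriv_surjective hm _).comp ((c.forms m).jet.dtot_surjective (u := z) h))

lemma contMDiffOn_elEquations :
    ContMDiffOn 𝓘(ℝ, JModel m (Base n × HFib m (Base n) m))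
        𝓘(ℝ, (Fin m → Fin n → ℝ) × (Fin n → ℝ)) ∞ (c.elEquations 𝓛)
      {z : JMom m (Base n) EE π | z.pt.pt ∈ c.tot.source} :=
  (c.forms m).jet.contMDiffOn_of_eq (f := c.elEquations 𝓛)
    (G := momentumDefect (fiberDualL m n) (c.vertDeriv 𝓛)) (fun _ hu => c.elEquations_eq hu)
    (contDiffOn_momentumDefect (fiberDualL m n) (c.contDiffOn_vertDeriv η h𝓛))

lemma isLocalEquations_elEquations (hm : 1 ≤ m) :
    IsLocalEquations (JModel m (Base n × HFib m (Base n) m))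
      {z : JMom m (Base n) EE π | z.pt.pt ∈ c.tot.source} (c.elEquations 𝓛)
      (lagrangianSet η 𝓛) where
  isOpen := (c.forms m).jet.tot.open_source
  contMDiffOn := c.contMDiffOn_elEquations η h𝓛
  mem_iff _ hz := (mem_lagrangianSet_iff η).trans (c.tulczyjew_eq_dLagrangian_iff η h𝓛 hz)
  surjective _ hz := c.mfderiv_elEquations_surjective η h𝓛 hm hz.1

end FiberedChart
end EulerLagrangeEquations

/-! ### Linear algebra of Lagrangian subspaces -/

section LagrangianSubspaces

variable {V V' B : Type*} [NormedAddCommGroup V] [NormedSpace ℝ V] [AddCommGroup V'] [Module ℝ V']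
  [NormedAddCommGroup B] [NormedSpace ℝ B] {k : ℕ}

/-- The pullback by `D` of a canonical multisymplectic form, restricted to vectors which are
tangent to the image of a closed section with linearization `s`: the tangent space is
Lagrangian. -/
lemma isLagrangianSubspace_of_section {Ω : V [⋀^Fin (k + 1)]→L[ℝ] ℝ} {D : V →ₗ[ℝ] V'}
    {T : V' →ₗ[ℝ] B} {s : B →ₗ[ℝ] V'} {Q : V' →ₗ[ℝ] B [⋀^Fin k]→L[ℝ] ℝ}
    (hΩ : ∀ v, Ω v = -∑ i : Fin (k + 1), (-1) ^ (i : ℕ) •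
      Q (D (v i)) (fun j => T (D (v (i.succAbove j)))))
    (hD : Function.Surjective D) (hs : ∀ x, T (s x) = x)
    (hTQ : ∀ y, T y = 0 → Q y = 0 → y = 0)
    (hclosed : ∀ U : Fin (k + 1) → B, ∑ i : Fin (k + 1), (-1) ^ (i : ℕ) •
      Q (s (U i)) (fun j => U (i.succAbove j)) = 0)
    {W : Submodule ℝ V} (hW : ∀ v, v ∈ W ↔ D v = s (T (D v))) :
    IsLagrangianSubspace Ω k W := by
  -- Subtract the closedness identity for the base components. A slot filled from `W` then
  -- contributes zero, since its image under `D` is on the section, and only the slot of `v` is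
  -- left.
  have key : ∀ v (w : Fin k → V), (∀ i, w i ∈ W) →
      flat Ω v w = -Q (D v - s (T (D v))) (fun j => T (D (w j))) := by
    intro v w hw
    set x : Fin (k + 1) → V := Fin.cons v w with hx
    have h1 : flat Ω v w = Ω x := rfl
    have h2 := hclosed (fun i => T (D (x i)))
    rw [h1, hΩ, neg_inj, ← sub_zero (∑ i : Fin (k + 1), _), ← h2, ← Finset.sum_sub_distrib,
      Finset.sum_eq_single 0]
    · simp [hx, map_sub]
    · intro i _ hi
      obtain ⟨j, rfl⟩ := Fin.exists_succ_eq.2 hi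
      have : x j.succ = w j := rfl
      rw [this, ← (hW _).1 (hw j), sub_self]
    · simp
  have hlt : ∀ i : Fin k, (i : ℕ) < k := fun i => i.2
  have h1 : W ≤ orthogonal Ω W k := by
    intro v hv w hw
    rw [key v w fun i => hw i (hlt i), ← (hW v).1 hv, sub_self, map_zero]
    simp
  have h2 : LinearMap.ker (flat Ω) ≤ orthogonal Ω W k := by
    intro v hv w _
    rw [LinearMap.mem_ker.1 hv]
    rfl
  have h3 : orthogonal Ω W k ≤ W := by
    intro v hv
    rw [hW, ← sub_eq_zero]
    refine hTQ _ (by rw [map_sub, hs, sub_self]) ?_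
    ext U
    -- Surjectivity of `D` lifts the tangent vectors `s (U i)`; the lifts lie in `W` and have
    -- arbitrary base components, so the deviation of `v` is annihilated by all test vectors.
    choose w hw using fun i => hD (s (U i))
    have hwW : ∀ i, w i ∈ W := fun i => by rw [hW, hw, hs]
    have := hv w fun i _ => hwW i
    rw [key v w hwW, neg_eq_zero] at this
    simpa [hw, hs] using this
  exact le_antisymm (sup_le h1 h2) (h3.trans le_sup_left)

end LagrangianSubspaces

/-! ### The tautological form on a vector space -/

section TautologicalForm

variable {A G K : Type*} [NormedAddCommGroup A] [NormedSpace ℝ A] [NormedAddCommGroup G]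
  [NormedSpace ℝ G] [NormedAddCommGroup K] [NormedSpace ℝ K] {k : ℕ}

variable (A G K) in
/-- The projection to the base of the coordinate expression of a bundle. -/
def prL : A × (G × K) →L[ℝ] A × G :=
  (ContinuousLinearMap.fst ℝ A (G × K)).prod
    ((ContinuousLinearMap.fst ℝ G K).comp (ContinuousLinearMap.snd ℝ A (G × K)))

/-- The differential of the section `y ↦ (y, b y)`, where `b'` is the differential of `b`. -/
def graphL (b' : A × G →L[ℝ] K) : A × G →L[ℝ] A × (G × K) :=
  (ContinuousLinearMap.fst ℝ A G).prod ((ContinuousLinearMap.snd ℝ A G).prod b')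

lemma hasFDerivAt_graph {b : A × G → K} {y : A × G} (hb : DifferentiableAt ℝ b y) :
    HasFDerivAt (fun y : A × G => (y.1, (y.2, b y))) (graphL (fderiv ℝ b y)) y :=
  hasFDerivAt_fst.prodMk (hasFDerivAt_snd.prodMk hb.hasFDerivAt)

lemma prL_graphL (b' : A × G →L[ℝ] K) (y : A × G) : prL A G K (graphL b' y) = y := rfl

lemma eq_zero_of_prL {y : A × (G × K)} (h : prL A G K y = 0) (h' : y.2.2 = 0) : y = 0 := by
  have h1 := congrArg Prod.fst h
  have h2 := congrArg Prod.snd h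
  exact Prod.ext h1 (Prod.ext h2 h')

/-- The form depends linearly on the point, so its derivative is constant and only has to be
alternated. -/
lemma extDeriv_tautological (q : K →L[ℝ] (A × G) [⋀^Fin k]→L[ℝ] ℝ) (y : A × (G × K))
    (v : Fin (k + 1) → A × (G × K)) :
    extDeriv (fun y : A × (G × K) => (q y.2.2).compContinuousLinearMap (prL A G K)) y v =
      ∑ i : Fin (k + 1), (-1) ^ (i : ℕ) •
        q (v i).2.2 (fun j => prL A G K (v (i.succAbove j))) := by
  set Λ : A × (G × K) →L[ℝ] (A × (G × K)) [⋀^Fin k]→L[ℝ] ℝ :=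
    (ContinuousAlternatingMap.compContinuousLinearMapCLM (prL A G K)).comp
      (q.comp ((ContinuousLinearMap.snd ℝ G K).comp (ContinuousLinearMap.snd ℝ A (G × K)))) with hΛ
  have e : (fun y : A × (G × K) => (q y.2.2).compContinuousLinearMap (prL A G K)) = Λ := rfl
  rw [e, extDeriv, ContinuousLinearMap.fderiv, ContinuousAlternatingMap.alternatizeUncurryFin_apply]
  rfl

end TautologicalForm

/-! ### The canonical multisymplectic form in coordinates -/

section CanonicalForm

variable {m : ℕ} {F EE : Type*} [NormedAddCommGroup F] [NormedSpace ℝ F] [FiniteDimensional ℝ F]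
  [NormedAddCommGroup EE] [NormedSpace ℝ EE]
  {M E : Type*} [TopologicalSpace M] [ChartedSpace (Base m) M]
  [TopologicalSpace E] [ChartedSpace EE E] {π : E → M} [IsFibration m F EE π] {k : ℕ}

/-- In natural coordinates the tautological form at `(x, u, q)` is `q` pulled back along `(x, u, q)
↦ (x, u)`. -/
lemma FiberedChart.tautologicalForm_comp_dtotSymm (c : FiberedChart m F EE π) {y : HModel m F k}
    (hy : (y.1, y.2.1) ∈ c.tot.target) :
    (tautologicalForm (π := π) ((c.forms k).tot.symm y)).compContinuousLinearMap
      ((c.forms k).dtotSymm y) =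
      ((HFib m F k).subtypeL y.2.2).compContinuousLinearMap (prL (Base m) F (HFib m F k)) := by
  have hs : (c.formOfCoord y).pt ∈ c.tot.source := c.tot.map_target hy
  have h1 := c.formOfCoord_form y hy
  ext v
  change (c.formOfCoord y).form (fun i => (c.formOfCoord y).dpt ((c.forms k).dtotSymm y (v i))) = _
  rw [h1]
  refine congrArg y.2.2.1 (funext fun i => ?_)
  have h2 := c.dtot_dpt (p := c.formOfCoord y) hs ((c.forms k).dtotSymm y (v i))
  refine h2.trans ?_
  have h3 := DFunLike.congr_fun ((c.forms k).dtot_comp_dtotSymm (y := y) hy) (v i)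
  exact congrArg (prL (Base m) F (HFib m F k)) h3

/-- The canonical multisymplectic form in natural coordinates. -/
lemma multisymplecticForm_apply (p : HForm m F EE π k) (v : Fin (k + 1) → HModel m F k) :
    multisymplecticForm p v = -∑ i : Fin (k + 1), (-1) ^ (i : ℕ) •
      (HFib m F k).subtypeL (((fiberedChartAt m F EE π p.pt).forms k).dtot p (v i)).2.2
        (fun j => prL (Base m) F (HFib m F k)
          (((fiberedChartAt m F EE π p.pt).forms k).dtot p (v (i.succAbove j)))) := by
  have hp := mem_fiberedChartAt (m := m) (F := F) (EE := EE) (π := π) p.pt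
  set c := fiberedChartAt m F EE π p.pt with hc
  -- The preferred chart at `p`, used by `mextDeriv`, is by construction the one induced by the
  -- chosen fibered chart.
  have h1 : mextDeriv (V := HModel m F k) (tautologicalForm (π := π) (k := k)) p =
      (extDeriv (fun y : HModel m F k => (tautologicalForm (π := π)
        ((c.forms k).tot.symm y)).compContinuousLinearMap ((c.forms k).dtotSymm y))
        ((c.forms k).tot p)).compContinuousLinearMap ((c.forms k).dtot p) := rfl
  have h2 : (fun y : HModel m F k => (tautologicalForm (π := π)
        ((c.forms k).tot.symm y)).compContinuousLinearMap ((c.forms k).dtotSymm y)) =ᶠ[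
        𝓝 ((c.forms k).tot p)] fun y => ((HFib m F k).subtypeL y.2.2).compContinuousLinearMap
          (prL (Base m) F (HFib m F k)) := by
    filter_upwards [(c.forms k).tot.open_target.mem_nhds ((c.forms k).tot.map_source (x := p) hp)]
      with y hy using c.tautologicalForm_comp_dtotSymm hy
  rw [multisymplecticForm, h1, h2.extDeriv_eq]
  refine congrArg Neg.neg ?_
  exact extDeriv_tautological _ _ _

end CanonicalForm

/-! ### Closedness of the section given by a differential -/

section ClosedSections

variable {m : ℕ} {F : Type*} [NormedAddCommGroup F] [NormedSpace ℝ F] [FiniteDimensional ℝ F]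

variable (m F) in
/-- The linear map `α ↦ α ∧ dᵐx`. -/
def wedgeStdL : (Base m × F →L[ℝ] ℝ) →L[ℝ] HFib m F (m + 1) :=
  LinearMap.toContinuousLinearMap
    { toFun := fun α => wedgeFst (stdVol m) α
      map_add' α β := (HFib.dualEquiv m F).injective (by
        rw [map_add]
        simp only [HFib.dualEquiv_apply, vertPart_wedgeFst, ContinuousLinearMap.add_comp, smul_add])
      map_smul' t α := (HFib.dualEquiv m F).injective (by
        rw [map_smul]
        simp only [HFib.dualEquiv_apply, vertPart_wedgeFst, ContinuousLinearMap.smul_comp,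
          smul_comm t, RingHom.id_apply]) }

lemma extDeriv_smul_stdVol {f : Base m × F → ℝ} {y : Base m × F} (hf : DifferentiableAt ℝ f y) :
    extDeriv (fun y => f y • (stdVol m).compContinuousLinearMap
      (ContinuousLinearMap.fst ℝ (Base m) F)) y = (wedgeStdL m F (fderiv ℝ f y)).1 := by
  have h := hf.hasFDerivAt.smul_const ((stdVol m).compContinuousLinearMap
    (ContinuousLinearMap.fst ℝ (Base m) F))
  exact congrArg ContinuousAlternatingMap.alternatizeUncurryFin h.fderiv

lemma contDiffAt_wedgeStdL_fderiv {f : Base m × F → ℝ} {y : Base m × F}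
    (hf : ContDiffAt ℝ ∞ f y) : ContDiffAt ℝ ∞ (fun y => wedgeStdL m F (fderiv ℝ f y)) y :=
  (wedgeStdL m F).contDiff.contDiffAt.comp y (hf.fderiv_right (m := ∞) (by simp))

/-- This is `d(d(f dᵐx)) = 0` evaluated on `U`, where the inner derivative is the wedge of the
differential of `f` with `dᵐx`. It is the closedness condition of `isLagrangianSubspace_of_section`.
-/
lemma sum_fderiv_wedgeStdL {f : Base m × F → ℝ} {y : Base m × F} (hf : ContDiffAt ℝ ∞ f y)
    (U : Fin (m + 1 + 1) → Base m × F) :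
    ∑ i : Fin (m + 1 + 1), (-1) ^ (i : ℕ) •
      (HFib m F (m + 1)).subtypeL (fderiv ℝ (fun y => wedgeStdL m F (fderiv ℝ f y)) y (U i))
        (fun j => U (i.succAbove j)) = 0 := by
  have hd := contDiffAt_wedgeStdL_fderiv hf
  have h1 : extDeriv (extDeriv fun y => f y • (stdVol m).compContinuousLinearMap
      (ContinuousLinearMap.fst ℝ (Base m) F)) y = 0 := by
    refine extDeriv_extDeriv_apply (r := ∞) (hf.smul contDiffAt_const) ?_
    rw [minSmoothness_of_isRCLikeNormedField]
    exact WithTop.coe_le_coe.2 le_top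
  have h2 : (extDeriv fun y => f y • (stdVol m).compContinuousLinearMap
      (ContinuousLinearMap.fst ℝ (Base m) F)) =ᶠ[𝓝 y]
      fun y => (HFib m F (m + 1)).subtypeL (wedgeStdL m F (fderiv ℝ f y)) := by
    filter_upwards [(hf.of_le (m := 1) (by simp)).eventually (by simp)] with t ht
      using extDeriv_smul_stdVol (ht.differentiableAt (by simp))
  rw [h2.extDeriv_eq, extDeriv] at h1
  have h3 : fderiv ℝ (fun y => (HFib m F (m + 1)).subtypeL (wedgeStdL m F (fderiv ℝ f y))) y =
      (HFib m F (m + 1)).subtypeL.comp (fderiv ℝ (fun y => wedgeStdL m F (fderiv ℝ f y)) y) :=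
    ((HFib m F (m + 1)).subtypeL.hasFDerivAt.comp y
      (hd.differentiableAt (by simp)).hasFDerivAt).fderiv
  rw [h3] at h1
  have h4 := DFunLike.congr_fun h1 U
  rw [ContinuousAlternatingMap.alternatizeUncurryFin_apply] at h4
  exact h4

end ClosedSections

/-! ### Local equations with values in a finite-dimensional space -/

section EquationTransport

variable {V P P' : Type*} [NormedAddCommGroup V] [NormedSpace ℝ V]
  [NormedAddCommGroup P] [NormedSpace ℝ P] [NormedAddCommGroup P'] [NormedSpace ℝ P']
  {X : Type*} [TopologicalSpace X] [ChartedSpace V X]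

lemma mem_kerDeriv_iff_of_eq {f : X → P} {x : X} {v : V} {w : P}
    (h : (mfderiv 𝓘(ℝ, V) 𝓘(ℝ, P) f x : V →L[ℝ] P) v = w) : v ∈ kerDeriv V f x ↔ w = 0 := by
  rw [← h]
  exact Iff.rfl

lemma mfderiv_equiv_comp (e : P ≃L[ℝ] P') {f : X → P} {x : X}
    (hf : MDifferentiableAt 𝓘(ℝ, V) 𝓘(ℝ, P) f x) :
    (mfderiv 𝓘(ℝ, V) 𝓘(ℝ, P') (e ∘ f) x : V →L[ℝ] P') =
      (e : P →L[ℝ] P').comp (mfderiv 𝓘(ℝ, V) 𝓘(ℝ, P) f x : V →L[ℝ] P) := by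
  have h := mfderiv_comp (I := 𝓘(ℝ, V)) (I' := 𝓘(ℝ, P)) (I'' := 𝓘(ℝ, P')) x
    (e.differentiableAt (x := f x)).mdifferentiableAt hf
  rw [mfderiv_eq_fderiv, e.fderiv] at h
  exact h

lemma kerDeriv_equiv_comp (e : P ≃L[ℝ] P') {f : X → P} {x : X}
    (hf : MDifferentiableAt 𝓘(ℝ, V) 𝓘(ℝ, P) f x) : kerDeriv V (e ∘ f) x = kerDeriv V f x := by
  ext v
  rw [kerDeriv, kerDeriv, mfderiv_equiv_comp e hf]
  exact e.map_eq_zero_iff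

lemma IsLocalEquations.equiv_comp {O S : Set X} {f : X → P} (h : IsLocalEquations V O f S)
    (e : P ≃L[ℝ] P') : IsLocalEquations V O (e ∘ f) S where
  isOpen := h.isOpen
  contMDiffOn := (e.contDiff.contMDiff (n := ∞)).comp_contMDiffOn h.contMDiffOn
  mem_iff x hx := (h.mem_iff x hx).trans e.map_eq_zero_iff.symm
  surjective x hx := by
    have hf : MDifferentiableAt 𝓘(ℝ, V) 𝓘(ℝ, P) f x :=
      (h.contMDiffOn.contMDiffAt (h.isOpen.mem_nhds hx.1)).mdifferentiableAt (by simp)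
    rw [mfderiv_equiv_comp e hf]
    exact e.surjective.comp (h.surjective x hx)

/-- A linear isomorphism of the target with a Euclidean space changes neither the zero set nor the
kernel of the differential. -/
lemma isLagrangianSubmanifold_of_localEquations [FiniteDimensional ℝ P] {k l : ℕ}
    {Ω : X → V [⋀^Fin (k + 1)]→L[ℝ] ℝ} {S : Set X}
    (h : ∀ x ∈ S, ∃ (O : Set X) (f : X → P), x ∈ O ∧ IsLocalEquations V O f S ∧
      IsLagrangianSubspace (Ω x) l (kerDeriv V f x)) : IsLagrangianSubmanifold V Ω l S := by
  intro x hx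
  obtain ⟨O, f, hxO, hf, hL⟩ := h x hx
  have e : P ≃L[ℝ] EuclideanSpace ℝ (Fin (Module.finrank ℝ P)) :=
    ContinuousLinearEquiv.ofFinrankEq (by simp)
  refine ⟨_, O, e ∘ f, hxO, hf.equiv_comp e, ?_⟩
  rwa [kerDeriv_equiv_comp e ((hf.contMDiffOn.contMDiffAt
    (hf.isOpen.mem_nhds hxO)).mdifferentiableAt (by simp))]

end EquationTransport

/-- The model of the fibres of the jet bundle over the base. -/
abbrev JFib (m : ℕ) (F : Type*) [NormedAddCommGroup F] [NormedSpace ℝ F] : Type _ :=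
  F × (Base m →L[ℝ] F)

/-! ### The differentials of the Tulczyjew morphism and of the Lagrangian section -/

section TangentSpaces

variable {m : ℕ} {F EE : Type*} [NormedAddCommGroup F] [NormedSpace ℝ F]
  [FiniteDimensional ℝ F] [NormedAddCommGroup EE] [NormedSpace ℝ EE]
  {M E : Type*} [TopologicalSpace M] [ChartedSpace (Base m) M]
  [TopologicalSpace E] [ChartedSpace EE E] {π : E → M} [IsFibration m F EE π]
  [IsManifold 𝓘(ℝ, Base m) ∞ M] (η : VolumeForm m M)
  {𝓛 : LagrangianDensity m F EE π}

variable (m F) in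
/-- The vertical part as a continuous linear map. -/
def vertPartL : HFib m (JFib m F) (m + 1) →L[ℝ] VertDual m F :=
  (HFib.dualEquiv m (JFib m F)).toLinearMap.toContinuousLinearMap

variable (m F) in
/-- The form with given vertical part, as a continuous linear map. -/
def ofVertPartL : VertDual m F →L[ℝ] HFib m (JFib m F) (m + 1) :=
  (HFib.dualEquiv m (JFib m F)).symm.toLinearMap.toContinuousLinearMap

lemma vertPartL_ofVertPartL (α : VertDual m F) : vertPartL m F (ofVertPartL m F α) = α :=
  (HFib.dualEquiv m (JFib m F)).apply_symm_apply α

lemma vertPartL_injective : Function.Injective (vertPartL m F) :=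
  (HFib.dualEquiv m (JFib m F)).injective

variable (m F) in
/-- The coordinate expression of the Tulczyjew morphism. -/
def tulL : JModel m (F × HFib m F m) →L[ℝ] HModel m (JFib m F) (m + 1) :=
  ((ContinuousLinearMap.fst ℝ (Base m) (JFib m F)).comp (jnuL m F)).prod
    (((ContinuousLinearMap.snd ℝ (Base m) (JFib m F)).comp (jnuL m F)).prod
      ((ofVertPartL m F).comp (momPairL m F)))

lemma tulL_apply (y : JModel m (F × HFib m F m)) : tulL m F y =
    ((jnuL m F y).1, ((jnuL m F y).2, ofVertPartL m F (momPairL m F y))) := rfl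

/-- The image under `j¹ν` and the paired momenta can be prescribed independently, and the latter
exhaust the vertical covectors. -/
lemma tulL_surjective (hm : 1 ≤ m) : Function.Surjective (tulL m F) := by
  intro q
  obtain ⟨y, hy, hy'⟩ := exists_jnuL_momPairL hm (q.1, q.2.1) (vertPartL m F q.2.2)
  refine ⟨y, ?_⟩
  rw [tulL_apply, hy, hy']
  refine Prod.ext rfl (Prod.ext rfl (vertPartL_injective ?_))
  exact vertPartL_ofVertPartL _

/-- In induced charts the morphism is linear, hence it is its own differential. -/
lemma FiberedChart.tot_tulczyjew (c : FiberedChart m F EE π) {z : JMom m F EE π}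
    (h : z.pt.pt ∈ c.tot.source) :
    (c.jet.forms (m + 1)).tot (tulczyjew η z) = tulL m F ((c.forms m).jet.tot z) := by
  have h1 : c.jet.tot (j1nu m F EE π z) = jnuL m F ((c.forms m).jet.tot z) :=
    c.jetCoord_j1nu h
  have e1 := congrArg Prod.fst h1
  have e2 := congrArg Prod.snd h1
  refine Prod.ext e1 (Prod.ext e2 (vertPartL_injective ?_))
  exact (c.vertPart_tulczyjew η h).trans (vertPartL_ofVertPartL _).symm

/-- The differential of the Tulczyjew morphism. -/
def dtulczyjew (z : JMom m F EE π) :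
    JModel m (F × HFib m F m) →L[ℝ] HModel m (JFib m F) (m + 1) :=
  mfderiv 𝓘(ℝ, JModel m (F × HFib m F m)) 𝓘(ℝ, HModel m (JFib m F) (m + 1))
    (tulczyjew (π := π) η) z

lemma FiberedChart.dtot_dtulczyjew (c : FiberedChart m F EE π)
    {z : JMom m F EE π} (h : z.pt.pt ∈ c.tot.source)
    (v : JModel m (F × HFib m F m)) :
    (c.jet.forms (m + 1)).dtot (tulczyjew η z) (dtulczyjew η z v) =
      tulL m F ((c.forms m).jet.dtot z v) :=
  (c.forms m).jet.dtot_mfderiv_apply_of_eq (c.jet.forms (m + 1)) (f := tulczyjew (π := π) η)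
    (G := tulL m F) (u := z) h (fun _ hu => hu) (fun _ hu => c.tot_tulczyjew η hu)
    (tulL m F).hasFDerivAt v

lemma dtulczyjew_surjective (hm : 1 ≤ m) (z : JMom m F EE π) :
    Function.Surjective (dtulczyjew η z) := by
  obtain ⟨c, h⟩ := exists_fiberedChart m F EE π z.pt.pt
  exact surjective_of_comp_eq ((c.jet.forms (m + 1)).dtot_injective (u := tulczyjew η z) h)
    (c.dtot_dtulczyjew η h)
    ((tulL_surjective hm).comp ((c.forms m).jet.dtot_surjective (u := z) h))

/-- The differential of `d𝓛`. -/
def ddLagrangian (𝓛 : LagrangianDensity m F EE π) (z : J1 m F EE π) :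
    JModel m F →L[ℝ] HModel m (JFib m F) (m + 1) :=
  mfderiv 𝓘(ℝ, JModel m F) 𝓘(ℝ, HModel m (JFib m F) (m + 1)) (dLagrangian η 𝓛) z

variable (C : FiberedChart m (JFib m F) (JModel m F) (jetProj m F EE π))

/-- The fibre component of the coordinate expression of `d𝓛`. -/
def dLagrangianCoeff (𝓛 : LagrangianDensity m F EE π) (y : JModel m F) :
    HFib m (JFib m F) (m + 1) :=
  wedgeStdL m (JFib m F) (fderiv ℝ (densityCoeff η C 𝓛) y)

/-- The differential of the coordinate expression of `d𝓛`. -/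
def sectionDeriv (𝓛 : LagrangianDensity m F EE π) (y : JModel m F) :
    JModel m F →L[ℝ] HModel m (JFib m F) (m + 1) :=
  graphL (fderiv ℝ (dLagrangianCoeff η C 𝓛) y)

variable (h𝓛 : ContMDiff 𝓘(ℝ, JModel m F) 𝓘(ℝ, ℝ) ∞ (lagrangianFunction η 𝓛))
include h𝓛

/-- Equality of vertical parts suffices, and those are the vertical derivatives of the coefficient
of the density. -/
lemma formCoord_dLagrangian_eq {z : J1 m F EE π} (h : z ∈ C.tot.source) :
    (C.formCoord (dLagrangian η 𝓛 z)).2.2 = dLagrangianCoeff η C 𝓛 (C.tot z) := by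
  refine HFib.ext_vertPart ((vertPart_formCoord_dLagrangian η C h𝓛 h).trans (Eq.symm ?_))
  refine (vertPart_wedgeFst _ _).trans ?_
  rw [stdVol_ebasis, one_smul]

lemma differentiableAt_dLagrangianCoeff {z : J1 m F EE π} (h : z ∈ C.tot.source) :
    DifferentiableAt ℝ (dLagrangianCoeff η C 𝓛) (C.tot z) :=
  (contDiffAt_wedgeStdL_fderiv (contDiffAt_densityCoeff η C h𝓛 h)).differentiableAt (by simp)

lemma dtot_ddLagrangian {z : J1 m F EE π} (h : z ∈ C.tot.source) (v : JModel m F) :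
    (C.forms (m + 1)).dtot (dLagrangian η 𝓛 z) (ddLagrangian η 𝓛 z v) =
      sectionDeriv η C 𝓛 (C.tot z) (C.dtot z v) := by
  exact C.dtot_mfderiv_apply_of_eq (C.forms (m + 1)) (f := dLagrangian η 𝓛)
    (G := fun y : JModel m F => (y.1, (y.2, dLagrangianCoeff η C 𝓛 y))) (u := z) h
    (fun _ hu => hu)
    (fun _ hu => Prod.ext rfl (Prod.ext rfl (formCoord_dLagrangian_eq η C h𝓛 hu)))
    (hasFDerivAt_graph (differentiableAt_dLagrangianCoeff η C h𝓛 h)) v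

/-- The left-hand condition is tangency to the image of `d𝓛` as seen in the chart `C`; the
right-hand one does not involve `C`. Hence tangency may be tested in any fibered chart of `J¹π`. -/
lemma dtot_eq_sectionDeriv_iff {z : J1 m F EE π} (h : z ∈ C.tot.source)
    {p : HForm m (JFib m F) (JModel m F) (jetProj m F EE π) (m + 1)}
    (hp : p = dLagrangian η 𝓛 z) (a : HModel m (JFib m F) (m + 1)) :
    (C.forms (m + 1)).dtot p a = sectionDeriv η C 𝓛 (C.tot z)
      (prL (Base m) (JFib m F) (HFib m (JFib m F) (m + 1)) ((C.forms (m + 1)).dtot p a)) ↔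
      a = ddLagrangian η 𝓛 z (p.dpt a) := by
  subst hp
  have h1 : C.dtot z ((dLagrangian η 𝓛 z).dpt a) =
      prL (Base m) (JFib m F) (HFib m (JFib m F) (m + 1))
        ((C.forms (m + 1)).dtot (dLagrangian η 𝓛 z) a) :=
    C.dtot_dpt (p := dLagrangian η 𝓛 z) h a
  rw [← h1, ← dtot_ddLagrangian η C h𝓛 h]
  exact ((C.forms (m + 1)).dtot_injective (u := dLagrangian η 𝓛 z) h).eq_iff

end TangentSpaces

/-! ### Tangent vectors of the Lagrangian set in induced coordinates -/

section LocalLagrangianDifferential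

variable {m n : ℕ} {EE : Type*} [NormedAddCommGroup EE] [NormedSpace ℝ EE]
  {M E : Type*} [TopologicalSpace M] [ChartedSpace (Base m) M]
  [TopologicalSpace E] [ChartedSpace EE E] {π : E → M} [IsFibration m (Base n) EE π]
  [IsManifold 𝓘(ℝ, Base m) ∞ M] (η : VolumeForm m M)
  {𝓛 : LagrangianDensity m (Base n) EE π}
  (h𝓛 : ContMDiff 𝓘(ℝ, JModel m (Base n)) 𝓘(ℝ, ℝ) ∞ (lagrangianFunction η 𝓛))
include h𝓛

omit h𝓛 [IsManifold 𝓘(ℝ, Base m) ∞ M] in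
lemma FiberedChart.vertPartL_dLagrangianCoeff (c : FiberedChart m (Base n) EE π)
    {y : JModel m (Base n)} (hy : y ∈ c.jet.tot.target) :
    vertPartL m (Base n) (dLagrangianCoeff η c.jet 𝓛 y) = c.vertDeriv 𝓛 y := by
  rw [FiberedChart.vertDeriv, fiberwiseFDeriv, c.fderiv_localLagrangian η hy]
  refine (vertPart_wedgeFst _ _).trans ?_
  rw [stdVol_ebasis, one_smul]

lemma FiberedChart.vertPartL_fderiv_dLagrangianCoeff (c : FiberedChart m (Base n) EE π)
    {z : J1 m (Base n) EE π} (h : z ∈ c.jet.tot.source) (v : JModel m (Base n)) :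
    vertPartL m (Base n) (fderiv ℝ (dLagrangianCoeff η c.jet 𝓛) (c.jet.tot z) v) =
      fderiv ℝ (c.vertDeriv 𝓛) (c.jet.tot z) v := by
  have h1 := hasFDerivAt_clm_comp (X := VertDual m (Base n)) (vertPartL m (Base n))
    (differentiableAt_dLagrangianCoeff η c.jet h𝓛 h)
  have h2 : c.vertDeriv 𝓛 =ᶠ[𝓝 (c.jet.tot z)]
      fun y => vertPartL m (Base n) (dLagrangianCoeff η c.jet 𝓛 y) := by
    filter_upwards [c.jet.tot.open_target.mem_nhds (c.jet.tot.map_source h)] with y hy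
      using (c.vertPartL_dLagrangianCoeff η hy).symm
  exact (DFunLike.congr_fun (h2.fderiv_eq.trans h1.fderiv) v).symm

/-- The linearized equations compare the vertical parts of the two sides; the components along the
jet bundle agree automatically. -/
lemma FiberedChart.momentumDefectDeriv_eq_zero_iff (c : FiberedChart m (Base n) EE π)
    {z : J1 m (Base n) EE π} (h : z ∈ c.jet.tot.source)
    (y : JModel m (Base n × HFib m (Base n) m)) :
    momentumDefectDeriv (fiberDualL m n) (fderiv ℝ (c.vertDeriv 𝓛) (c.jet.tot z)) y = 0 ↔
      tulL m (Base n) y = sectionDeriv η c.jet 𝓛 (c.jet.tot z) (jnuL m (Base n) y) := by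
  have h2 : momentumDefectDeriv (fiberDualL m n) (fderiv ℝ (c.vertDeriv 𝓛)
        (c.jet.tot z)) y =
      fiberDual m n (momPairL m (Base n) y - fderiv ℝ (c.vertDeriv 𝓛)
        (c.jet.tot z) (jnuL m (Base n) y)) := rfl
  have h3 := c.vertPartL_fderiv_dLagrangianCoeff η h𝓛 h (jnuL m (Base n) y)
  rw [h2]
  refine ((fiberDual m n).map_eq_zero_iff.trans sub_eq_zero).trans ⟨fun h4 => ?_, fun h4 => ?_⟩
  · refine Prod.ext rfl (Prod.ext rfl (vertPartL_injective ?_))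
    exact (vertPartL_ofVertPartL _).trans (h4.trans h3.symm)
  · have h5 := congrArg (fun q : HModel m (JFib m (Base n)) (m + 1) => vertPartL m (Base n) q.2.2) h4
    exact (vertPartL_ofVertPartL _).symm.trans (h5.trans h3)

lemma FiberedChart.mem_kerDeriv_elEquations_iff (c : FiberedChart m (Base n) EE π)
    {z : JMom m (Base n) EE π} (h : z.pt.pt ∈ c.tot.source)
    (v : JModel m (Base n × HFib m (Base n) m)) :
    v ∈ kerDeriv (JModel m (Base n × HFib m (Base n) m)) (c.elEquations 𝓛) z ↔
      (c.jet.forms (m + 1)).dtot (tulczyjew η z) (dtulczyjew η z v) =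
        sectionDeriv η c.jet 𝓛 (c.jet.tot (j1nu m (Base n) EE π z))
          (prL (Base m) (JFib m (Base n)) (HFib m (JFib m (Base n)) (m + 1))
            ((c.jet.forms (m + 1)).dtot (tulczyjew η z) (dtulczyjew η z v))) := by
  have h0 : jnuL m (Base n) ((c.forms m).jet.tot z) = c.jet.tot (j1nu m (Base n) EE π z) :=
    (c.jetCoord_j1nu h).symm
  have h1 := mem_kerDeriv_iff_of_eq (c.mfderiv_elEquations η h𝓛 h v)
  rw [h0] at h1
  have h2 := c.momentumDefectDeriv_eq_zero_iff η h𝓛 (z := j1nu m (Base n) EE π z) h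
    ((c.forms m).jet.dtot z v)
  refine h1.trans (h2.trans (iff_of_eq ?_))
  exact congrArg (fun a => a = sectionDeriv η c.jet 𝓛 (c.jet.tot (j1nu m (Base n) EE π z))
    (prL (Base m) (JFib m (Base n)) (HFib m (JFib m (Base n)) (m + 1)) a)) (c.dtot_dtulczyjew η h v).symm

end LocalLagrangianDifferential

/-! ### The premultisymplectic form in the preferred chart -/

section PremultisymplecticForm

variable {m : ℕ} {F EE : Type*} [NormedAddCommGroup F] [NormedSpace ℝ F]
  [FiniteDimensional ℝ F] [NormedAddCommGroup EE] [NormedSpace ℝ EE]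
  {M E : Type*} [TopologicalSpace M] [ChartedSpace (Base m) M]
  [TopologicalSpace E] [ChartedSpace EE E] {π : E → M} [IsFibration m F EE π]
  [IsManifold 𝓘(ℝ, Base m) ∞ M] (η : VolumeForm m M)

lemma premultisymplecticForm_apply (z : JMom m F EE π)
    (C : FiberedChart m (JFib m F) (JModel m F) (jetProj m F EE π))
    (hC : fiberedChartAt m (JFib m F) (JModel m F) (jetProj m F EE π)
      (j1nu m F EE π z) = C)
    (v : Fin (m + 1 + 1) → JModel m (F × HFib m F m)) :
    premultisymplecticForm (π := π) η z v = -∑ i : Fin (m + 1 + 1), (-1) ^ (i : ℕ) •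
      (HFib m (JFib m F) (m + 1)).subtypeL
        ((C.forms (m + 1)).dtot (tulczyjew η z) (dtulczyjew η z (v i))).2.2
        (fun j => prL (Base m) (JFib m F) (HFib m (JFib m F) (m + 1))
          ((C.forms (m + 1)).dtot (tulczyjew η z) (dtulczyjew η z (v (i.succAbove j))))) := by
  subst hC
  exact multisymplecticForm_apply (tulczyjew η z) fun i => dtulczyjew η z (v i)

end PremultisymplecticForm

/-! ### The Lagrangian property -/

section LagrangianSubmanifold

variable {m n : ℕ} {EE : Type*} [NormedAddCommGroup EE] [NormedSpace ℝ EE]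
  {M E : Type*} [TopologicalSpace M] [ChartedSpace (Base m) M]
  [TopologicalSpace E] [ChartedSpace EE E] {π : E → M} [IsFibration m (Base n) EE π]
  [IsManifold 𝓘(ℝ, Base m) ∞ M] (η : VolumeForm m M)
  {𝓛 : LagrangianDensity m (Base n) EE π}

variable (h𝓛 : ContMDiff 𝓘(ℝ, JModel m (Base n)) 𝓘(ℝ, ℝ) ∞ (lagrangianFunction η 𝓛))
include h𝓛

/-- The equations are written in the chart induced by `c`, the canonical form in the preferred chart
of `J¹π`. The chart-free description of tangency passes from one to the other. -/
lemma FiberedChart.kerDeriv_elEquations_iff (c : FiberedChart m (Base n) EE π)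
    (C : FiberedChart m (JFib m (Base n)) (JModel m (Base n)) (jetProj m (Base n) EE π))
    {z : JMom m (Base n) EE π} (h : z.pt.pt ∈ c.tot.source)
    (hC : j1nu m (Base n) EE π z ∈ C.tot.source)
    (hz : tulczyjew η z = dLagrangian η 𝓛 (j1nu m (Base n) EE π z))
    (v : JModel m (Base n × HFib m (Base n) m)) :
    v ∈ kerDeriv (JModel m (Base n × HFib m (Base n) m)) (c.elEquations 𝓛) z ↔
      (C.forms (m + 1)).dtot (tulczyjew η z) (dtulczyjew η z v) =
        sectionDeriv η C 𝓛 (C.tot (j1nu m (Base n) EE π z))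
          (prL (Base m) (JFib m (Base n)) (HFib m (JFib m (Base n)) (m + 1))
            ((C.forms (m + 1)).dtot (tulczyjew η z) (dtulczyjew η z v))) := by
  refine (c.mem_kerDeriv_elEquations_iff η h𝓛 h v).trans ?_
  exact (dtot_eq_sectionDeriv_iff η c.jet h𝓛 (z := j1nu m (Base n) EE π z) h hz _).trans
    (dtot_eq_sectionDeriv_iff η C h𝓛 hC hz _).symm

/-- The data for `isLagrangianSubspace_of_section`: `D` is the differential of the Tulczyjew
morphism in coordinates, `T` the projection to `J¹π`, `s` the linearization of the section `d𝓛` and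
`Q` the fibre component. -/
lemma FiberedChart.isLagrangianSubspace_kerDeriv (hm : 1 ≤ m) (c : FiberedChart m (Base n) EE π)
    {z : JMom m (Base n) EE π} (h : z.pt.pt ∈ c.tot.source)
    (hz : tulczyjew η z = dLagrangian η 𝓛 (j1nu m (Base n) EE π z)) :
    IsLagrangianSubspace (premultisymplecticForm (π := π) η z) (m + 1)
      (kerDeriv (JModel m (Base n × HFib m (Base n) m)) (c.elEquations 𝓛) z) := by
  obtain ⟨C, hC⟩ : ∃ C, fiberedChartAt m (JFib m (Base n)) (JModel m (Base n))
    (jetProj m (Base n) EE π) (j1nu m (Base n) EE π z) = C := ⟨_, rfl⟩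
  have hs : j1nu m (Base n) EE π z ∈ C.tot.source := by
    rw [← hC]
    exact mem_fiberedChartAt _
  refine isLagrangianSubspace_of_section
    (D := (((C.forms (m + 1)).dtot (tulczyjew η z)).comp (dtulczyjew η z)).toLinearMap)
    (T := (prL (Base m) (JFib m (Base n)) (HFib m (JFib m (Base n)) (m + 1))).toLinearMap)
    (s := (sectionDeriv η C 𝓛 (C.tot (j1nu m (Base n) EE π z))).toLinearMap)
    (Q := (HFib m (JFib m (Base n)) (m + 1)).subtype.comp
      ((LinearMap.snd ℝ (JFib m (Base n)) (HFib m (JFib m (Base n)) (m + 1))).comp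
        (LinearMap.snd ℝ (Base m) (JFib m (Base n) × HFib m (JFib m (Base n)) (m + 1)))))
    (premultisymplecticForm_apply η z C hC) ?_ (fun x => prL_graphL _ x) ?_ ?_
    (c.kerDeriv_elEquations_iff η h𝓛 C h hs hz)
  · exact ((C.forms (m + 1)).dtot_surjective (u := tulczyjew η z) hs).comp
      (dtulczyjew_surjective η hm z)
  · exact fun y hy hy' => eq_zero_of_prL hy (Subtype.ext hy')
  · exact sum_fderiv_wedgeStdL (contDiffAt_densityCoeff η C h𝓛 hs)

lemma isLagrangianSubmanifold_lagrangianSet (hm : 1 ≤ m) :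
    IsLagrangianSubmanifold (JModel m (Base n × HFib m (Base n) m))
      (premultisymplecticForm (π := π) η) (m + 1) (lagrangianSet η 𝓛) := by
  refine isLagrangianSubmanifold_of_localEquations (P := (Fin m → Fin n → ℝ) × (Fin n → ℝ))
    fun z hz => ?_
  obtain ⟨c, hc⟩ := exists_fiberedChart m (Base n) EE π z.pt.pt
  exact ⟨_, c.elEquations 𝓛, hc, c.isLocalEquations_elEquations η h𝓛 hm,
    c.isLagrangianSubspace_kerDeriv η h𝓛 hm hc ((mem_lagrangianSet_iff η).1 hz)⟩

end LagrangianSubmanifold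

/-! ### The Poincaré-Cartan form in coordinates -/

section ContactForms

variable {m : ℕ} {F : Type*} [NormedAddCommGroup F] [NormedSpace ℝ F]

variable (m F) in
/-- The pullback of `dᵐx`. -/
def HFib.volFst : HFib m F m :=
  ⟨(stdVol m).compContinuousLinearMap (ContinuousLinearMap.fst ℝ (Base m) F), by
    intro v i _ _ hi _
    exact (stdVol m).map_coord_zero i hi⟩

lemma HFib.volFst_apply (v : Fin m → Base m × F) :
    (HFib.volFst m F).1 v = stdVol m (fun i => (v i).1) := rfl

lemma HFib.mom_volFst (i : Fin m) : HFib.mom (HFib.volFst m F) i = 0 := by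
  ext g
  rw [HFib.mom_apply, HFib.volFst_apply]
  refine (stdVol m).map_coord_zero i ?_
  rw [Function.update_self]

lemma HFib.volFst_ebasis : (HFib.volFst m F).1 (fun i => (ebasis i, 0)) = 1 := by
  rw [HFib.volFst_apply, stdVol_ebasis]

/-- A 2-horizontal `m`-form without momenta has only the coordinate `p` left. -/
lemma HFib.eq_smul_volFst {q : HFib m F m} (h : ∀ i, HFib.mom q i = 0) :
    q = q.1 (fun i => (ebasis i, 0)) • HFib.volFst m F := by
  rw [← sub_eq_zero]
  refine HFib.eq_zero_of_mom ?_ fun i => ?_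
  · change q.1 _ - q.1 _ * (HFib.volFst m F).1 _ = 0
    rw [HFib.volFst_ebasis, mul_one, sub_self]
  · rw [HFib.mom_sub, HFib.mom_smul, HFib.mom_volFst, h i, smul_zero, sub_zero]

variable [FiniteDimensional ℝ F]

variable (m F) in
/-- The form with the values `∑ₖ dᵐx(X₁, …, a(Xₖ), …, Xₘ)`, for a linear map `a` to the base. -/
def HFib.ofContact : (Base m × F →L[ℝ] Base m) →L[ℝ] HFib m F m :=
  LinearMap.toContinuousLinearMap
    { toFun := fun a => ⟨(stdVol m).fderivCompContinuousLinearMap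
          (ContinuousLinearMap.fst ℝ (Base m) F) a, by
        intro v i j hij hi hj
        rw [ContinuousAlternatingMap.fderivCompContinuousLinearMap_apply]
        refine Finset.sum_eq_zero fun k _ => ?_
        by_cases hk : i = k
        · refine (stdVol m).map_coord_zero j ?_
          rw [Function.update_of_ne (by rintro rfl; exact hij hk)]
          exact hj
        · refine (stdVol m).map_coord_zero i ?_
          rw [Function.update_of_ne hk]
          exact hi⟩
      map_add' a b := Subtype.ext (map_add _ a b)
      map_smul' t a := Subtype.ext (map_smul _ t a) }

lemma HFib.ofContact_apply (a : Base m × F →L[ℝ] Base m) (v : Fin m → Base m × F) :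
    (HFib.ofContact m F a).1 v = ∑ k, stdVol m (fun j =>
      Function.update (fun _ => ContinuousLinearMap.fst ℝ (Base m) F) k a j (v j)) :=
  ContinuousAlternatingMap.fderivCompContinuousLinearMap_apply _ _ _ _

/-- Only the summand that applies `a` to the vertical slot survives, and replacing the `i`-th basis
vector in the determinant by `w` gives the coordinate `w i`. -/
lemma HFib.mom_ofContact (a : Base m × F →L[ℝ] Base m) (i : Fin m) (g : F) :
    HFib.mom (HFib.ofContact m F a) i g = a (0, g) i := by
  rw [HFib.mom_apply, HFib.ofContact_apply, Finset.sum_eq_single i]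
  · have e : (fun l => Function.update (fun _ => ContinuousLinearMap.fst ℝ (Base m) F) i a l
        (Function.update (fun k => ((ebasis k, 0) : Base m × F)) i (0, g) l)) =
        Function.update (fun k => ebasis k) i (a (0, g)) := by
      ext1 l
      by_cases hl : l = i
      · subst hl; simp
      · simp [hl]
    rw [e, stdVol_update_ebasis]
  · intro j _ hj
    refine (stdVol m).map_coord_zero i ?_
    rw [Function.update_of_ne hj.symm, Function.update_self]
    rfl
  · simp

omit [FiniteDimensional ℝ F] in
/-- The linear map `X ↦ ∑ᵢ bᵢ(θ(X)) ∂/∂xⁱ` with the contact form `θ(x, u) = u - V x`, where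
`bᵢ(g) = b(dxⁱ ⊗ g)`. -/
def contactL (b : VertDual m F) (V : Base m →L[ℝ] F) : Base m × F →L[ℝ] Base m :=
  ∑ i, (ContinuousLinearMap.toSpanSingleton ℝ (ebasis i : Base m)).comp
    ((b.comp ((ContinuousLinearMap.inr ℝ F (Base m →L[ℝ] F)).comp
      (ContinuousLinearMap.smulRightL ℝ (Base m) F (EuclideanSpace.proj i)))).comp
      (ContinuousLinearMap.snd ℝ (Base m) F - V.comp (ContinuousLinearMap.fst ℝ (Base m) F)))

omit [FiniteDimensional ℝ F] in
lemma contactL_apply (b : VertDual m F) (V : Base m →L[ℝ] F) (v : Base m × F) :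
    contactL b V v = ∑ i, b (0, (EuclideanSpace.proj i : Base m →L[ℝ] ℝ).smulRight
      (v.2 - V v.1)) • ebasis i := by
  rw [contactL, sum_apply]
  rfl

omit [FiniteDimensional ℝ F] in
lemma contactL_smul (t : ℝ) (b : VertDual m F) (V : Base m →L[ℝ] F) :
    contactL (t • b) V = t • contactL b V := by
  refine ContinuousLinearMap.ext fun v => ?_
  rw [smul_apply, contactL_apply, contactL_apply, Finset.smul_sum]
  exact Finset.sum_congr rfl fun i _ => mul_smul _ _ _

/-- The coordinate expression of the Poincaré-Cartan form. -/
def legFib (r : ℝ) (b : VertDual m F) (V : Base m →L[ℝ] F) : HFib m F m :=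
  r • HFib.volFst m F + HFib.ofContact m F (contactL b V)

lemma smul_legFib (t r : ℝ) (b : VertDual m F) (V : Base m →L[ℝ] F) :
    t • legFib r b V = legFib (t * r) (t • b) V := by
  rw [legFib, legFib, smul_add, smul_smul, contactL_smul, map_smul]

/-- The volume term has no momenta, and on vertical vectors the contact form is `du`, independently
of `V`. -/
lemma mom_legFib (r : ℝ) (b : VertDual m F) (V : Base m →L[ℝ] F) (i : Fin m) (g : F) :
    HFib.mom (legFib r b V) i g = b (0, (EuclideanSpace.proj i : Base m →L[ℝ] ℝ).smulRight g) := by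
  rw [legFib, HFib.mom_add, HFib.mom_smul, HFib.mom_volFst, smul_zero, zero_add,
    HFib.mom_ofContact, contactL_apply]
  simp [Finset.sum_apply, Pi.single_apply]

lemma legFib_apply (r : ℝ) (b : VertDual m F) (V : Base m →L[ℝ] F) (v : Fin m → Base m × F) :
    (legFib r b V).1 v = r * stdVol m (fun i => (v i).1) + ∑ k, stdVol m (fun j =>
      Function.update (fun _ => ContinuousLinearMap.fst ℝ (Base m) F) k (contactL b V) j (v j)) :=
  congrArg (r * stdVol m (fun i => (v i).1) + ·) (HFib.ofContact_apply _ _)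

variable {X : Type*} [NormedAddCommGroup X] [NormedSpace ℝ X] {S : Set X}

omit [FiniteDimensional ℝ F] in
lemma contDiffOn_contactL {b : X → VertDual m F} {V : X → Base m →L[ℝ] F}
    (hb : ContDiffOn ℝ ∞ b S) (hV : ContDiffOn ℝ ∞ V S) :
    ContDiffOn ℝ ∞ (fun y => contactL (b y) (V y)) S := by
  unfold contactL
  refine ContDiffOn.sum fun i _ => ?_
  exact contDiffOn_const.clm_comp ((hb.clm_comp contDiffOn_const).clm_comp
    (contDiffOn_const.sub (hV.clm_comp contDiffOn_const)))

lemma contDiffOn_legFib {r : X → ℝ} {b : X → VertDual m F} {V : X → Base m →L[ℝ] F}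
    (hr : ContDiffOn ℝ ∞ r S) (hb : ContDiffOn ℝ ∞ b S) (hV : ContDiffOn ℝ ∞ V S) :
    ContDiffOn ℝ ∞ (fun y => legFib (r y) (b y) (V y)) S :=
  (hr.smul contDiffOn_const).add
    ((HFib.ofContact m F).contDiff.comp_contDiffOn (contDiffOn_contactL hb hV))

end ContactForms

/-! ### The Legendre transform in coordinates -/

section LegendreTransform

variable {m : ℕ} {F EE : Type*} [NormedAddCommGroup F] [NormedSpace ℝ F]
  [NormedAddCommGroup EE] [NormedSpace ℝ EE]
  {M E : Type*} [TopologicalSpace M] [ChartedSpace (Base m) M]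
  [TopologicalSpace E] [ChartedSpace EE E] {π : E → M}

/-- The sum over dual bases does not depend on the basis. This lets `contactMap`, defined with the
standard basis of the model, be computed with the coordinate vectors of a chart. -/
lemma sum_comp_smul_ebasis (φ : (Base m →L[ℝ] ℝ) →ₗ[ℝ] ℝ) (B : Base m →L[ℝ] Base m) :
    ∑ i, φ ((EuclideanSpace.proj i : Base m →L[ℝ] ℝ).comp B) • (ebasis i : Base m) =
      B (∑ i, φ (EuclideanSpace.proj i) • ebasis i) := by
  have h : ∀ i : Fin m, (EuclideanSpace.proj i : Base m →L[ℝ] ℝ).comp B =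
      ∑ j, B (ebasis j) i • (EuclideanSpace.proj j : Base m →L[ℝ] ℝ) := fun i => by
    refine ContinuousLinearMap.ext fun x => ?_
    have hx : x = ∑ a, x a • ebasis a := by
      have := (EuclideanSpace.basisFun (Fin m) ℝ).sum_repr x
      simpa using this.symm
    have h1 := congrArg ((EuclideanSpace.proj i : Base m →L[ℝ] ℝ).comp B) hx
    rw [h1, map_sum, sum_apply]
    refine Finset.sum_congr rfl fun j _ => ?_
    simp [mul_comm]
  have h2 : ∀ v : Base m, v = ∑ a, v a • ebasis a := fun v => by
    have := (EuclideanSpace.basisFun (Fin m) ℝ).sum_repr v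
    simpa using this.symm
  simp only [h, map_sum, map_smul, Finset.sum_smul]
  rw [Finset.sum_comm]
  refine Finset.sum_congr rfl fun j _ => ?_
  conv_rhs => rw [h2 (B (ebasis j)), Finset.smul_sum]
  refine Finset.sum_congr rfl fun i _ => ?_
  rw [smul_smul, smul_eq_mul, mul_comm]

namespace FiberedChart
variable (c : FiberedChart m F EE π)

/-- The action of jets on the derivative coordinates: the coordinate expression of `w` minus its
horizontal part. -/
def translateL (z : J1 m F EE π) : (Base m →L[ℝ] EE) →L[ℝ] (Base m →L[ℝ] F) :=
  (ContinuousLinearMap.compL ℝ (Base m) EE F ((ContinuousLinearMap.snd ℝ (Base m) F -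
      (c.jetCoord z).2.2.comp (ContinuousLinearMap.fst ℝ (Base m) F)).comp (c.dtot z.pt))).comp
    ((ContinuousLinearMap.compL ℝ (Base m) (Base m) EE).flip (c.dbaseSymm (c.base (π z.pt))))

lemma translateL_apply (z : J1 m F EE π) (w : Base m →L[ℝ] EE) (x : Base m) :
    c.translateL z w x = (c.dtot z.pt (w (c.dbaseSymm (c.base (π z.pt)) x))).2 -
      (c.jetCoord z).2.2 (c.dtot z.pt (w (c.dbaseSymm (c.base (π z.pt)) x))).1 := rfl

/-- Translation along the fibre changes the derivative coordinates only, and linearly in `w`; the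
fibre derivative therefore becomes an ordinary partial derivative. -/
lemma jetCoord_translate {z : J1 m F EE π} (h : z.pt ∈ c.tot.source) (w : Base m →L[ℝ] EE) :
    c.jetCoord (z.translate w) = c.jetCoord z + (0, (0, c.translateL z w)) := by
  refine Prod.ext (add_zero _).symm (Prod.ext (add_zero _).symm (ContinuousLinearMap.ext fun x => ?_))
  change (c.dtot z.pt (z.lin (c.dbaseSymm (c.base (π z.pt)) x) +
    (w (c.dbaseSymm (c.base (π z.pt)) x) -
      z.lin (dproj π z.pt (w (c.dbaseSymm (c.base (π z.pt)) x)))))).2 =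
    (c.dtot z.pt (z.lin (c.dbaseSymm (c.base (π z.pt)) x))).2 + c.translateL z w x
  rw [map_add, map_sub, c.dtot_lin_apply z h (dproj π z.pt _), c.translateL_apply, c.fst_dtot_apply h]
  rfl

variable [IsFibration m F EE π]

lemma fiberDeriv_eq {L : J1 m F EE π → ℝ} {z : J1 m F EE π} (h : z.pt ∈ c.tot.source)
    (hL : DifferentiableAt ℝ (L ∘ c.jet.tot.symm) (c.jetCoord z)) (w : Base m →L[ℝ] EE) :
    fiberDeriv L z w = fderiv ℝ (L ∘ c.jet.tot.symm) (c.jetCoord z) (0, (0, c.translateL z w)) := by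
  have e : (fun w => L (z.translate w)) = fun w => (L ∘ c.jet.tot.symm)
      (c.jetCoord z + (ContinuousLinearMap.inr ℝ (Base m) (F × (Base m →L[ℝ] F))).comp
        ((ContinuousLinearMap.inr ℝ F (Base m →L[ℝ] F)).comp (c.translateL z)) w) := by
    funext w
    have h1 : c.jet.tot.symm (c.jet.tot (z.translate w)) = z.translate w :=
      c.jet.tot.left_inv (x := z.translate w) h
    have h2 : c.jet.tot (z.translate w) = _ := c.jetCoord_translate h w
    rw [h2] at h1
    exact (congrArg L h1).symm
  set J := (ContinuousLinearMap.inr ℝ (Base m) (F × (Base m →L[ℝ] F))).comp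
        ((ContinuousLinearMap.inr ℝ F (Base m →L[ℝ] F)).comp (c.translateL z)) with hJ
  have h3 : HasFDerivAt (fun w => c.jetCoord z + J w) J 0 := J.hasFDerivAt.const_add _
  have h4 : HasFDerivAt (L ∘ c.jet.tot.symm) (fderiv ℝ (L ∘ c.jet.tot.symm) (c.jetCoord z))
      (c.jetCoord z + J 0) := by
    rw [map_zero, add_zero]
    exact hL.hasFDerivAt
  have h5 : HasFDerivAt (fun w => (L ∘ c.jet.tot.symm) (c.jetCoord z + J w)) _ 0 :=
    HasFDerivAt.comp (f := fun w => c.jetCoord z + J w) 0 h4 h3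
  rw [fiberDeriv, e, h5.fderiv]
  rfl

lemma contactMap_dtotSymm {L : J1 m F EE π → ℝ} {z : J1 m F EE π} (h : z.pt ∈ c.tot.source)
    (hL : DifferentiableAt ℝ (L ∘ c.jet.tot.symm) (c.jetCoord z)) (v : Base m × F) :
    contactMap L z (c.dtotSymm (c.tot z.pt) v) = c.dbaseSymm (c.base (π z.pt))
      (contactL (fiberwiseFDeriv (L ∘ c.jet.tot.symm) (c.jetCoord z)) (c.jetCoord z).2.2 v) := by
  rw [contactMap, sum_apply, contactL_apply]
  let φ : (Base m →L[ℝ] ℝ) →ₗ[ℝ] ℝ :=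
    { toFun := fun ψ => fiberwiseFDeriv (L ∘ c.jet.tot.symm) (c.jetCoord z)
        (0, ψ.smulRight (v.2 - (c.jetCoord z).2.2 v.1))
      map_add' := fun ψ ψ' => by
        rw [← map_add, Prod.mk_add_mk, add_zero]
        congr 2
        ext x
        simp [add_smul]
      map_smul' := fun t ψ => by
        rw [RingHom.id_apply, ← map_smul, Prod.smul_mk, smul_zero]
        congr 2
        ext x
        simp [smul_smul] }
  refine Eq.trans (Finset.sum_congr rfl fun i _ => ?_) (sum_comp_smul_ebasis φ _)
  refine congrArg (fun t : ℝ => t • (ebasis i : Base m)) ?_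
  refine (c.fiberDeriv_eq h hL _).trans ?_
  refine congrArg (fun w => fderiv ℝ (L ∘ c.jet.tot.symm) (c.jetCoord z) (0, (0, w))) ?_
  refine ContinuousLinearMap.ext fun x => ?_
  rw [c.translateL_apply]
  change (c.dtot z.pt (c.dbaseSymm (c.base (π z.pt)) x i • c.dtotSymm (c.tot z.pt) v)).2 -
    (c.jetCoord z).2.2 (c.dtot z.pt (c.dbaseSymm (c.base (π z.pt)) x i •
      c.dtotSymm (c.tot z.pt) v)).1 = c.dbaseSymm (c.base (π z.pt)) x i •
        (v.2 - (c.jetCoord z).2.2 v.1)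
  rw [map_smul, c.dtot_dtotSymm_apply h, smul_sub, Prod.smul_fst, Prod.smul_snd, map_smul]

variable [FiniteDimensional ℝ F]

/-- Each term of the Poincaré-Cartan form is `η` applied to vectors of the form `dbaseSymm (…)`, so
`η` can be replaced throughout by its density times the standard volume form. -/
lemma formCoord_Leg (η : VolumeForm m M) {𝓛 : LagrangianDensity m F EE π} {z : J1 m F EE π}
    (h : z.pt ∈ c.tot.source)
    (hL : DifferentiableAt ℝ (lagrangianFunction η 𝓛 ∘ c.jet.tot.symm) (c.jetCoord z)) :
    (c.formCoord (Leg η 𝓛 z)).2.2 = c.density η (π z.pt) • legFib (lagrangianFunction η 𝓛 z)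
      (fiberwiseFDeriv (lagrangianFunction η 𝓛 ∘ c.jet.tot.symm) (c.jetCoord z))
      (c.jetCoord z).2.2 := by
  apply Subtype.ext
  refine (c.formCoord_coe (Leg η 𝓛 z) h).trans ?_
  ext v
  have hd : ∀ j, (dproj π z.pt (c.dtotSymm (c.tot z.pt) (v j)) : Base m) =
      c.dbaseSymm (c.base (π z.pt)) (v j).1 := fun j => c.dproj_dtotSymm_apply h (v j)
  have h1 : η.toFun (π z.pt) (fun j => dproj π z.pt (c.dtotSymm (c.tot z.pt) (v j))) =
      c.density η (π z.pt) * stdVol m (fun j => (v j).1) := by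
    rw [funext hd, c.volumeForm_comp_dbaseSymm]
  have h2 : ∀ k, η.toFun (π z.pt) (fun j => Function.update (fun _ => dproj π z.pt) k
      (contactMap (lagrangianFunction η 𝓛) z) j (c.dtotSymm (c.tot z.pt) (v j))) =
      c.density η (π z.pt) * stdVol m (fun j =>
        Function.update (fun _ => ContinuousLinearMap.fst ℝ (Base m) F) k
          (contactL (fiberwiseFDeriv (lagrangianFunction η 𝓛 ∘ c.jet.tot.symm) (c.jetCoord z))
            (c.jetCoord z).2.2) j (v j)) := fun k => by
    rw [← c.volumeForm_comp_dbaseSymm]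
    refine congrArg (η.toFun (π z.pt)) (funext fun j => ?_)
    by_cases hj : j = k
    · subst hj
      rw [Function.update_self, Function.update_self]
      exact c.contactMap_dtotSymm h hL (v j)
    · rw [Function.update_of_ne hj, Function.update_of_ne hj]
      exact hd j
  have h3 : (Leg η 𝓛 z).form (fun j => c.dtotSymm (c.tot z.pt) (v j)) =
      lagrangianFunction η 𝓛 z * η.toFun (π z.pt)
        (fun j => dproj π z.pt (c.dtotSymm (c.tot z.pt) (v j))) +
      ∑ k, η.toFun (π z.pt) (fun j => Function.update (fun _ => dproj π z.pt) k
        (contactMap (lagrangianFunction η 𝓛) z) j (c.dtotSymm (c.tot z.pt) (v j))) :=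
    congrArg (fun t => lagrangianFunction η 𝓛 z * η.toFun (π z.pt)
        (fun j => dproj π z.pt (c.dtotSymm (c.tot z.pt) (v j))) + t)
      (ContinuousAlternatingMap.fderivCompContinuousLinearMap_apply (η.toFun (π z.pt))
        (dproj π z.pt) (contactMap (lagrangianFunction η 𝓛) z)
        (fun j => c.dtotSymm (c.tot z.pt) (v j)))
  refine h3.trans ?_
  rw [h1, Finset.sum_congr rfl fun k _ => h2 k, ← Finset.mul_sum, mul_left_comm, ← mul_add]
  exact congrArg (c.density η (π z.pt) * ·) (legFib_apply _ _ _ _).symm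

end FiberedChart
end LegendreTransform

/-! ### Sections, their jets and translations by the volume form in coordinates -/

section SectionsInCoordinates

variable {m : ℕ} {F EE : Type*} [NormedAddCommGroup F] [NormedSpace ℝ F]
  [NormedAddCommGroup EE] [NormedSpace ℝ EE]
  {M E : Type*} [TopologicalSpace M] [ChartedSpace (Base m) M]
  [TopologicalSpace E] [ChartedSpace EE E] {π : E → M} {U : Set M} {σ : M → E}

lemma IsLocalSection.inter_preimage (h : IsLocalSection m EE π U σ) {O : Set E} (hO : IsOpen O) :
    IsLocalSection m EE π (U ∩ σ ⁻¹' O) σ where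
  isOpen := h.contMDiffOn.continuousOn.isOpen_inter_preimage h.isOpen hO
  contMDiffOn := h.contMDiffOn.mono Set.inter_subset_left
  proj_eq x hx := h.proj_eq x hx.1

lemma IsLocalSection.mdifferentiableAt (h : IsLocalSection m EE π U σ) {x : M} (hx : x ∈ U) :
    MDifferentiableAt 𝓘(ℝ, Base m) 𝓘(ℝ, EE) σ x :=
  (h.contMDiffOn.contMDiffAt (h.isOpen.mem_nhds hx)).mdifferentiableAt (by simp)

namespace FiberedChart
variable (c : FiberedChart m F EE π)

/-- The set of the coordinates of the points of `U`. -/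
def baseImage (U : Set M) : Set (Base m) := c.base.target ∩ c.base.symm ⁻¹' U

lemma isOpen_baseImage (hU : IsOpen U) : IsOpen (c.baseImage U) :=
  c.base.isOpen_inter_preimage_symm hU

lemma mem_base_source (h : IsLocalSection m EE π U σ) {x : M} (hx : x ∈ U)
    (hs : σ x ∈ c.tot.source) : x ∈ c.base.source := by
  have := c.map_source _ hs
  rwa [h.proj_eq x hx] at this

lemma base_mem_baseImage (h : IsLocalSection m EE π U σ) {x : M} (hx : x ∈ U)
    (hs : σ x ∈ c.tot.source) : c.base x ∈ c.baseImage U := by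
  have hb := c.mem_base_source h hx hs
  refine ⟨c.base.map_source hb, ?_⟩
  change c.base.symm (c.base x) ∈ U
  rwa [c.base.left_inv hb]

lemma tot_section_fst (h : IsLocalSection m EE π U σ) {x : M} (hx : x ∈ U)
    (hs : σ x ∈ c.tot.source) : (c.tot (σ x)).1 = c.base x := by
  rw [c.fst_tot _ hs, h.proj_eq x hx]

lemma hasFDerivAt_section (h : IsLocalSection m EE π U σ) {x : M} (hx : x ∈ U)
    (hs : σ x ∈ c.tot.source) : HasFDerivAt (fun y => c.tot (σ (c.base.symm y)))
      ((c.dtot (σ x)).comp ((mfderiv 𝓘(ℝ, Base m) 𝓘(ℝ, EE) σ x : Base m →L[ℝ] EE).comp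
        (c.dbaseSymm (c.base x)))) (c.base x) := by
  have hb := c.mem_base_source h hx hs
  have e := c.base.left_inv hb
  have h1 : HasMFDerivAt 𝓘(ℝ, Base m) 𝓘(ℝ, Base m) c.base.symm (c.base x)
      (c.dbaseSymm (c.base x)) :=
    (c.mdiff_base.mdifferentiableAt_symm (c.base.map_source hb)).hasMFDerivAt
  have h2 : HasMFDerivAt 𝓘(ℝ, Base m) 𝓘(ℝ, EE) σ (c.base.symm (c.base x))
      (mfderiv 𝓘(ℝ, Base m) 𝓘(ℝ, EE) σ x) := by
    rw [e]
    exact (h.mdifferentiableAt hx).hasMFDerivAt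
  have h3 : HasMFDerivAt 𝓘(ℝ, EE) 𝓘(ℝ, Base m × F) c.tot ((σ ∘ c.base.symm) (c.base x))
      (c.dtot (σ x)) := by
    change HasMFDerivAt 𝓘(ℝ, EE) 𝓘(ℝ, Base m × F) c.tot (σ (c.base.symm (c.base x))) _
    rw [e]
    exact (c.mdiff_tot.mdifferentiableAt hs).hasMFDerivAt
  exact hasMFDerivAt_iff_hasFDerivAt.1 (HasMFDerivAt.comp _ h3 (HasMFDerivAt.comp _ h2 h1))

lemma contDiffOn_section (h : IsLocalSection m EE π U σ) (hs : ∀ x ∈ U, σ x ∈ c.tot.source) :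
    ContDiffOn ℝ ∞ (fun y => c.tot (σ (c.base.symm y))) (c.baseImage U) := by
  rw [← contMDiffOn_iff_contDiffOn]
  exact c.contMDiffOn_tot.comp (h.contMDiffOn.comp
    (c.contMDiffOn_base_symm.mono Set.inter_subset_left) fun _ hy => hy.2) fun _ hy => hs _ hy.2

/-- The natural coordinates of the first jet of a section. -/
lemma jetCoord_jet [IsFibration m F EE π] (h : IsLocalSection m EE π U σ) {x : M} (hx : x ∈ U)
    (hs : σ x ∈ c.tot.source) : c.jetCoord (Tulczyjew.jet m F EE π σ x) =
      (c.base x, (c.tot (σ x)).2, fderiv ℝ (fun y => (c.tot (σ (c.base.symm y))).2) (c.base x)) := by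
  refine Prod.ext (c.tot_section_fst h hx hs) (Prod.ext rfl ?_)
  have h1 : HasFDerivAt (fun y => (c.tot (σ (c.base.symm y))).2) _ (c.base x) :=
    (c.hasFDerivAt_section h hx hs).snd
  refine ContinuousLinearMap.ext fun v => ?_
  rw [c.jetCoord_eq, jet_lin h hx]
  change (c.dtot (σ x) (mfderiv 𝓘(ℝ, Base m) 𝓘(ℝ, EE) σ x
    (c.dbaseSymm (c.base (π (σ x))) v))).2 = fderiv ℝ _ (c.base x) v
  rw [h1.fderiv, h.proj_eq x hx]
  rfl

end FiberedChart

variable [IsFibration m F EE π] [FiniteDimensional ℝ F] [IsManifold 𝓘(ℝ, Base m) ∞ M]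
  {τ : M → HForm m F EE π m}

lemma IsLocalSection.pt (h : IsLocalSection m (HModel m F m) (formProj m F EE π m) U τ) :
    IsLocalSection m EE π U (fun x => (τ x).pt) where
  isOpen := h.isOpen
  contMDiffOn x hx :=
    (contMDiffAt_pt (τ x)).comp_contMDiffWithinAt x (h.contMDiffOn x hx)
  proj_eq := h.proj_eq

/-- The chain rule for `ν ∘ τ`. -/
lemma j1nu_jetMom (h : IsLocalSection m (HModel m F m) (formProj m F EE π m) U τ) {x : M}
    (hx : x ∈ U) : j1nu m F EE π (jetMom τ x) = jet m F EE π (fun x => (τ x).pt) x := by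
  refine J1.ext' rfl ?_
  have h1 : (jetMom τ x).lin = mfderiv 𝓘(ℝ, Base m) 𝓘(ℝ, HModel m F m) τ x :=
    jet_lin (F := F × HFib m F m) h hx
  have h2 := mfderiv_comp x ((contMDiffAt_pt (τ x)).mdifferentiableAt (by simp))
    (h.mdifferentiableAt hx)
  have h3 : (j1nu m F EE π (jetMom τ x)).lin = (τ x).dpt.comp (jetMom τ x).lin := rfl
  rw [h3, h1, jet_lin h.pt hx]
  exact h2.symm

namespace FiberedChart
variable (c : FiberedChart m F EE π)

omit [IsFibration m F EE π] [FiniteDimensional ℝ F] [IsManifold 𝓘(ℝ, Base m) ∞ M] in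
lemma formCoord_addVol (η : VolumeForm m M) (t : ℝ) {q : HForm m F EE π m}
    (h : q.pt ∈ c.tot.source) : (c.formCoord (q.addVol η t)).2.2 =
      (t * c.density η (π q.pt)) • HFib.volFst m F + (c.formCoord q).2.2 := by
  apply Subtype.ext
  refine (c.formCoord_coe (q.addVol η t) h).trans ?_
  ext v
  have hd : ∀ j, (dproj π q.pt (c.dtotSymm (c.tot q.pt) (v j)) : Base m) =
      c.dbaseSymm (c.base (π q.pt)) (v j).1 := fun j => c.dproj_dtotSymm_apply h (v j)
  have h1 : η.toFun (π q.pt) (fun j => dproj π q.pt (c.dtotSymm (c.tot q.pt) (v j))) =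
      c.density η (π q.pt) * stdVol m (fun j => (v j).1) := by
    rw [funext hd, c.volumeForm_comp_dbaseSymm]
  have h2 : q.form (fun j => c.dtotSymm (c.tot q.pt) (v j)) = (c.formCoord q).2.2.1 v :=
    (DFunLike.congr_fun (c.formCoord_coe q h) v).symm
  change t * η.toFun (π q.pt) (fun j => dproj π q.pt (c.dtotSymm (c.tot q.pt) (v j))) +
    q.form (fun j => c.dtotSymm (c.tot q.pt) (v j)) =
      (t * c.density η (π q.pt)) * stdVol m (fun j => (v j).1) + (c.formCoord q).2.2.1 v
  rw [h1, h2, mul_assoc]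

omit [IsFibration m F EE π] [FiniteDimensional ℝ F] [IsManifold 𝓘(ℝ, Base m) ∞ M] in
/-- Two forms at the same point have the same momenta if and only if they differ by a multiple of
the volume form. -/
lemma mom_formCoord_eq_iff (η : VolumeForm m M) {p q : HForm m F EE π m} (hpq : p.pt = q.pt)
    (h : q.pt ∈ c.tot.source) :
    (∀ i, HFib.mom (c.formCoord p).2.2 i = HFib.mom (c.formCoord q).2.2 i) ↔
      ∃ t : ℝ, p = q.addVol η t := by
  constructor
  · intro hm
    have h1 := HFib.eq_smul_volFst (q := (c.formCoord p).2.2 - (c.formCoord q).2.2)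
      fun i => by rw [HFib.mom_sub, hm i, sub_self]
    set s := ((c.formCoord p).2.2 - (c.formCoord q).2.2).1 (fun i => (ebasis i, 0))
    have hρ : c.density η (π q.pt) ≠ 0 := c.density_ne_zero η (c.map_source _ h)
    refine ⟨s / c.density η (π q.pt), ?_⟩
    have hp : p.pt ∈ c.tot.source := hpq ▸ h
    refine (c.formEquiv m).injOn hp h (Prod.ext (congrArg (fun u => (c.tot u).1) hpq)
      (Prod.ext (congrArg (fun u => (c.tot u).2) hpq) ?_))
    refine Eq.trans ?_ (c.formCoord_addVol η _ h).symm
    rw [div_mul_cancel₀ _ hρ, ← h1, sub_add_cancel]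
    rfl
  · rintro ⟨t, rfl⟩ i
    rw [c.formCoord_addVol η t h, HFib.mom_add, HFib.mom_smul, HFib.mom_volFst, smul_zero, zero_add]

end FiberedChart
end SectionsInCoordinates

/-! ### The Legendre transform of a section -/

section EulerLagrangeSections

variable {m n : ℕ} {EE : Type*} [NormedAddCommGroup EE] [NormedSpace ℝ EE]
  {M E : Type*} [TopologicalSpace M] [ChartedSpace (Base m) M]
  [TopologicalSpace E] [ChartedSpace EE E] {π : E → M} [IsFibration m (Base n) EE π]
  {U : Set M}

namespace FiberedChart
variable (c : FiberedChart m (Base n) EE π)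

lemma jetCoord_jet_eq_coordJet {σ : M → E} (h : IsLocalSection m EE π U σ) {x : M} (hx : x ∈ U)
    (hs : σ x ∈ c.tot.source) :
    c.jetCoord (Tulczyjew.jet m (Base n) EE π σ x) = c.coordJet σ (c.base x) := by
  refine (c.jetCoord_jet h hx hs).trans (Prod.ext rfl (Prod.ext ?_ rfl))
  change _ = (c.tot (σ (c.base.symm (c.base x)))).2
  rw [c.base.left_inv (c.mem_base_source h hx hs)]

omit [IsFibration m (Base n) EE π] in
lemma coordSection_mem_target {σ : M → E} (h : IsLocalSection m EE π U σ)
    (hs : ∀ x ∈ U, σ x ∈ c.tot.source) {y : Base m} (hy : y ∈ c.baseImage U) :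
    (y, c.coordSection σ y) ∈ c.tot.target := by
  have h1 := c.tot.map_source (hs _ hy.2)
  have h2 := c.tot_section_fst h hy.2 (hs _ hy.2)
  rw [c.base.right_inv hy.1] at h2
  rwa [show (y, c.coordSection σ y) = c.tot (σ (c.base.symm y)) from Prod.ext h2.symm rfl]

omit [IsFibration m (Base n) EE π] in
lemma contDiffOn_coordSection {σ : M → E} (h : IsLocalSection m EE π U σ)
    (hs : ∀ x ∈ U, σ x ∈ c.tot.source) : ContDiffOn ℝ ∞ (c.coordSection σ) (c.baseImage U) :=
  contDiff_snd.comp_contDiffOn (c.contDiffOn_section h hs)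

omit [IsFibration m (Base n) EE π] in
lemma contDiffOn_coordJet {σ : M → E} (h : IsLocalSection m EE π U σ)
    (hs : ∀ x ∈ U, σ x ∈ c.tot.source) : ContDiffOn ℝ ∞ (c.coordJet σ) (c.baseImage U) := by
  have h1 := c.contDiffOn_coordSection h hs
  exact contDiffOn_id.prodMk (h1.prodMk
    (h1.fderiv_of_isOpen (c.isOpen_baseImage h.isOpen) (m := ∞) (by simp)))

end FiberedChart

variable [IsManifold 𝓘(ℝ, Base m) ∞ M] (c : FiberedChart m (Base n) EE π)
  (η : VolumeForm m M) {𝓛 : LagrangianDensity m (Base n) EE π}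

section Legendre

variable (h𝓛 : ContMDiff 𝓘(ℝ, JModel m (Base n)) 𝓘(ℝ, ℝ) ∞ (lagrangianFunction η 𝓛))
include h𝓛

/-- The vertical part of `d𝓛` computed in two ways: from `dL ∧ η`, and from the local Lagrangian. -/
lemma FiberedChart.density_smul_fiberwiseFDeriv {z : J1 m (Base n) EE π}
    (h : z.pt ∈ c.tot.source) : c.density η (π z.pt) •
      fiberwiseFDeriv (lagrangianFunction η 𝓛 ∘ c.jet.tot.symm) (c.jetCoord z) =
        c.vertDeriv 𝓛 (c.jetCoord z) := by
  refine Eq.trans ?_ ((vertPart_wedgeVol c.jet η (z := z) h _).symm.trans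
    (c.vertPart_dLagrangian η h𝓛 h))
  exact congrArg (fun α => _ • ContinuousLinearMap.comp α _)
    (c.jet.mfderiv_comp_dtotSymm (u := z) h h𝓛).symm

omit h𝓛 [IsManifold 𝓘(ℝ, Base m) ∞ M] in
lemma FiberedChart.density_mul_lagrangianFunction {z : J1 m (Base n) EE π}
    (h : z.pt ∈ c.tot.source) : c.density η (π z.pt) * lagrangianFunction η 𝓛 z =
      c.localLagrangian 𝓛 (c.jetCoord z) := by
  have ht : c.jetCoord z ∈ c.jet.tot.target := c.jet.tot.map_source (x := z) h
  rw [c.localLagrangian_eq η 𝓛 ht, densityCoeff, mul_comm]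
  have h1 : c.jet.tot.symm (c.jetCoord z) = z := c.jet.tot.left_inv (x := z) h
  rw [h1, c.density_eq η h]
  rfl

/-- The extended Legendre transform in coordinates. -/
lemma FiberedChart.formCoord_Leg_eq {z : J1 m (Base n) EE π} (h : z.pt ∈ c.tot.source) :
    (c.formCoord (Leg η 𝓛 z)).2.2 = legFib (c.localLagrangian 𝓛 (c.jetCoord z))
      (c.vertDeriv 𝓛 (c.jetCoord z)) (c.jetCoord z).2.2 := by
  have hL : DifferentiableAt ℝ (lagrangianFunction η 𝓛 ∘ c.jet.tot.symm) (c.jetCoord z) :=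
    ((c.contDiffOn_lagrangianFunction η h𝓛).contDiffAt (c.jet.tot.open_target.mem_nhds
      (c.jet.tot.map_source (x := z) h))).differentiableAt (by simp)
  rw [c.formCoord_Leg η h hL, smul_legFib, c.density_mul_lagrangianFunction η h,
    c.density_smul_fiberwiseFDeriv η h𝓛 h]

lemma FiberedChart.mom_formCoord_Leg {z : J1 m (Base n) EE π} (h : z.pt ∈ c.tot.source)
    (i : Fin m) (α : Fin n) :
    HFib.mom (c.formCoord (Leg η 𝓛 z)).2.2 i (ebasis α) = c.dLdv 𝓛 α i (c.jetCoord z) := by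
  rw [c.formCoord_Leg_eq η h𝓛 h, mom_legFib]
  rfl

/-- `Leg_𝓛 ∘ j¹σ` is a local section of the extended multimomentum bundle. -/
lemma IsLocalSection.legJet {σ : M → E} (h : IsLocalSection m EE π U σ) :
    IsLocalSection m (HModel m (Base n) m) (formProj m (Base n) EE π m) U (legJet η 𝓛 σ) := by
  refine ⟨h.isOpen, fun x₀ hx₀ => ContMDiffAt.contMDiffWithinAt ?_, h.proj_eq⟩
  obtain ⟨c, hc⟩ := exists_fiberedChart m (Base n) EE π (σ x₀)
  have h' := h.inter_preimage c.tot.open_source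
  have hs : ∀ x ∈ U ∩ σ ⁻¹' c.tot.source, σ x ∈ c.tot.source := fun x hx => hx.2
  have hx₀' : x₀ ∈ U ∩ σ ⁻¹' c.tot.source := ⟨hx₀, hc⟩
  have hJ := c.contDiffOn_coordJet h' hs
  have hJt : ∀ y ∈ c.baseImage (U ∩ σ ⁻¹' c.tot.source), c.coordJet σ y ∈ c.jet.tot.target :=
    fun y hy => c.coordSection_mem_target h' hs hy
  have h1 : ContDiffOn ℝ ∞ (fun Y => legFib (c.localLagrangian 𝓛 Y) (c.vertDeriv 𝓛 Y) Y.2.2)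
      c.jet.tot.target :=
    contDiffOn_legFib (c.contDiffOn_localLagrangian η h𝓛) (c.contDiffOn_vertDeriv η h𝓛)
      (contDiff_snd.snd.contDiffOn)
  have h2 := (contDiffOn_id (𝕜 := ℝ) (n := ∞)).prodMk
    ((c.contDiffOn_coordSection h' hs).prodMk (h1.comp hJ hJt))
  have hy₀ := c.base_mem_baseImage h' hx₀' hc
  have h3 := (h2.contDiffAt ((c.isOpen_baseImage h'.isOpen).mem_nhds hy₀)).contMDiffAt
  have h4 := h3.comp x₀ (c.contMDiffOn_base.contMDiffAt
    (c.base.open_source.mem_nhds (c.mem_base_source h hx₀ hc)))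
  -- Smoothness is read off from this coordinate expression, which combines the smooth local
  -- Lagrangian and its fibre derivative with the smooth jet of the section.
  have key : ∀ x ∈ U ∩ σ ⁻¹' c.tot.source, (c.forms m).tot (Tulczyjew.legJet η 𝓛 σ x) =
      (c.base x, (c.coordSection σ (c.base x), legFib (c.localLagrangian 𝓛 (c.coordJet σ (c.base x)))
        (c.vertDeriv 𝓛 (c.coordJet σ (c.base x))) (c.coordJet σ (c.base x)).2.2)) := fun x hx => by
    have e := c.jetCoord_jet_eq_coordJet h hx.1 hx.2
    refine Prod.ext (c.tot_section_fst h hx.1 hx.2) (Prod.ext (congrArg (fun t => t.2.1) e) ?_)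
    refine (c.formCoord_Leg_eq η h𝓛 (z := jet m (Base n) EE π σ x) hx.2).trans ?_
    rw [e]
  have h5 := (c.forms m).contMDiffOn_tot_symm.contMDiffAt ((c.forms m).tot.open_target.mem_nhds
    ((c.forms m).tot.map_source (x := Tulczyjew.legJet η 𝓛 σ x₀) hc))
  rw [key x₀ hx₀'] at h5
  refine (ContMDiffAt.comp x₀ h5 h4).congr_of_eventuallyEq ?_
  filter_upwards [h'.isOpen.mem_nhds hx₀'] with x hx
  refine ((c.forms m).tot.left_inv (x := Tulczyjew.legJet η 𝓛 σ x) hx.2).symm.trans ?_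
  rw [key x hx]
  rfl

end Legendre

namespace FiberedChart

variable {τ : M → HForm m (Base n) EE π m}

lemma formCoord_jetMom (h : IsLocalSection m (HModel m (Base n) m) (formProj m (Base n) EE π m) U τ)
    {x : M} (hx : x ∈ U) (hs : (τ x).pt ∈ c.tot.source) :
    (c.forms m).jetCoord (jetMom τ x) = (c.base x, ((c.forms m).tot (τ x)).2,
      fderiv ℝ (fun y => ((c.forms m).tot (τ (c.base.symm y))).2) (c.base x)) :=
  (c.forms m).jetCoord_jet h hx hs

/-- The divergence of the momenta along a section. -/
lemma mom_jetCoord_jetMom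
    (h : IsLocalSection m (HModel m (Base n) m) (formProj m (Base n) EE π m) U τ)
    {x : M} (hx : x ∈ U) (hs : (τ x).pt ∈ c.tot.source) (i j : Fin m) (g : Base n) :
    HFib.mom (((c.forms m).jetCoord (jetMom τ x)).2.2 (ebasis j)).2 i g =
      fderiv ℝ (fun y => HFib.mom (c.formCoord (τ (c.base.symm y))).2.2 i g) (c.base x)
        (ebasis j) := by
  have h1 : HasFDerivAt (fun y => ((c.forms m).tot (τ (c.base.symm y))).2) _ (c.base x) :=
    ((c.forms m).hasFDerivAt_section h hx hs).snd
  have h2 : HasFDerivAt (fun y => (c.formCoord (τ (c.base.symm y))).2.2)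
      ((ContinuousLinearMap.snd ℝ (Base n) (HFib m (Base n) m)).comp
        (fderiv ℝ (fun y => ((c.forms m).tot (τ (c.base.symm y))).2) (c.base x))) (c.base x) :=
    h1.differentiableAt.hasFDerivAt.snd
  have h3 := fderiv_mom_apply h2.differentiableAt (differentiableAt_const g) i (ebasis j)
  rw [h3, c.formCoord_jetMom h hx hs, h2.fderiv]
  simp

end FiberedChart
end EulerLagrangeSections

/-! ### The Euler-Lagrange equations along sections -/

section EulerLagrangeSections

variable {m n : ℕ} {EE : Type*} [NormedAddCommGroup EE] [NormedSpace ℝ EE]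
  {M E : Type*} [TopologicalSpace M] [ChartedSpace (Base m) M]
  [TopologicalSpace E] [ChartedSpace EE E] {π : E → M} [IsFibration m (Base n) EE π]
  {U : Set M} [IsManifold 𝓘(ℝ, Base m) ∞ M] (c : FiberedChart m (Base n) EE π)
  {𝓛 : LagrangianDensity m (Base n) EE π} {τ : M → HForm m (Base n) EE π m}

namespace FiberedChart

/-- Along a holonomic jet the coordinates `pⁱ_αⱼ` are derivatives of the momenta of `τ`, so their
trace is a divergence. -/
lemma elEquations_jetMom
    (h : IsLocalSection m (HModel m (Base n) m) (formProj m (Base n) EE π m) U τ)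
    {x : M} (hx : x ∈ U) (hs : (τ x).pt ∈ c.tot.source) :
    c.elEquations 𝓛 (jetMom τ x) =
      (fun i α => HFib.mom (c.formCoord (τ x)).2.2 i (ebasis α) -
          c.dLdv 𝓛 α i (c.coordJet (fun x => (τ x).pt) (c.base x)),
        fun α => ∑ i, fderiv ℝ (fun y => HFib.mom (c.formCoord (τ (c.base.symm y))).2.2 i (ebasis α))
            (c.base x) (ebasis i) -
          c.dLdu 𝓛 α (c.coordJet (fun x => (τ x).pt) (c.base x))) := by
  have h1 : c.jetCoord (j1nu m (Base n) EE π (jetMom τ x)) =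
      c.coordJet (fun x => (τ x).pt) (c.base x) := by
    rw [j1nu_jetMom h hx]
    exact c.jetCoord_jet_eq_coordJet h.pt hx hs
  refine Prod.ext ?_ ?_
  · funext i α
    change HFib.mom (c.formCoord (τ x)).2.2 i (ebasis α) - c.dLdv 𝓛 α i _ = _
    rw [h1]
  · funext α
    change ∑ i, HFib.mom (((c.forms m).jetCoord (jetMom τ x)).2.2 (ebasis i)).2 i (ebasis α) -
      c.dLdu 𝓛 α _ = _
    rw [h1]
    simp only [c.mom_jetCoord_jetMom h hx hs]

/-- If the momenta of a section are given by the Legendre transform, the remaining equations are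
the Euler-Lagrange equations. -/
lemma elEquations_jetMom_eq_zero_iff
    (h : IsLocalSection m (HModel m (Base n) m) (formProj m (Base n) EE π m) U τ)
    (hs : ∀ x ∈ U, (τ x).pt ∈ c.tot.source)
    (hm : ∀ x ∈ U, ∀ i α, HFib.mom (c.formCoord (τ x)).2.2 i (ebasis α) =
      c.dLdv 𝓛 α i (c.coordJet (fun x => (τ x).pt) (c.base x))) {x : M} (hx : x ∈ U) :
    c.elEquations 𝓛 (jetMom τ x) = 0 ↔ ∀ α,
      c.dLdu 𝓛 α (c.coordJet (fun x => (τ x).pt) (c.base x)) -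
        ∑ i, fderiv ℝ (fun y => c.dLdv 𝓛 α i (c.coordJet (fun x => (τ x).pt) y)) (c.base x)
          (ebasis i) = 0 := by
  have h1 : ∀ i α, fderiv ℝ (fun y => HFib.mom (c.formCoord (τ (c.base.symm y))).2.2 i (ebasis α))
      (c.base x) = fderiv ℝ (fun y => c.dLdv 𝓛 α i (c.coordJet (fun x => (τ x).pt) y))
        (c.base x) := fun i α => by
    -- The identity of momenta holds on the open set `U`, not just at `x`, so it may be
    -- differentiated.
    refine Filter.EventuallyEq.fderiv_eq ?_
    filter_upwards [(c.isOpen_baseImage h.isOpen).mem_nhds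
      (c.base_mem_baseImage h.pt hx (hs x hx))] with y hy
    rw [hm _ hy.2, c.base.right_inv hy.1]
  rw [c.elEquations_jetMom h hx (hs x hx), Prod.mk_eq_zero]
  constructor
  · intro h0 α
    have h2 := congrFun h0.2 α
    simp only [h1, Pi.zero_apply] at h2
    linarith
  · intro h0
    refine ⟨?_, ?_⟩
    · funext i α
      rw [hm x hx, sub_self]
      rfl
    · funext α
      simp only [h1, Pi.zero_apply]
      linarith [h0 α]

end FiberedChart

variable (η : VolumeForm m M)
  (h𝓛 : ContMDiff 𝓘(ℝ, JModel m (Base n)) 𝓘(ℝ, ℝ) ∞ (lagrangianFunction η 𝓛))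
include h𝓛

lemma FiberedChart.mom_formCoord_legJet {σ : M → E} (h : IsLocalSection m EE π U σ)
    {x : M} (hx : x ∈ U) (hs : σ x ∈ c.tot.source) (i : Fin m) (α : Fin n) :
    HFib.mom (c.formCoord (legJet η 𝓛 σ x)).2.2 i (ebasis α) =
      c.dLdv 𝓛 α i (c.coordJet σ (c.base x)) := by
  refine (c.mom_formCoord_Leg η h𝓛 (z := Tulczyjew.jet m (Base n) EE π σ x) hs i α).trans ?_
  rw [c.jetCoord_jet_eq_coordJet h hx hs]

lemma FiberedChart.mom_eq_iff_exists_addVol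
    (h : IsLocalSection m (HModel m (Base n) m) (formProj m (Base n) EE π m) U τ)
    {x : M} (hx : x ∈ U) (hs : (τ x).pt ∈ c.tot.source) :
    (∀ i α, HFib.mom (c.formCoord (τ x)).2.2 i (ebasis α) =
      c.dLdv 𝓛 α i (c.coordJet (fun x => (τ x).pt) (c.base x))) ↔
      ∃ t : ℝ, τ x = (legJet η 𝓛 (fun y => (τ y).pt) x).addVol η t := by
  rw [← c.mom_formCoord_eq_iff η (p := τ x) (q := legJet η 𝓛 (fun y => (τ y).pt) x) rfl hs]
  refine forall_congr' fun i => ?_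
  simp only [← c.mom_formCoord_legJet η h𝓛 h.pt hx hs]
  constructor
  · intro h0
    refine ContinuousLinearMap.coe_injective
      ((EuclideanSpace.basisFun (Fin n) ℝ).toBasis.ext fun α => ?_)
    have e : (EuclideanSpace.basisFun (Fin n) ℝ).toBasis α = ebasis α := by simp
    rw [e]
    exact h0 α
  · intro h0 α
    rw [h0]

/-- A section solves the Euler-Lagrange equations if and only if the first jet of its Legendre
transform is mapped to `d𝓛` by the Tulczyjew morphism. -/
lemma isEulerLagrange_iff_tulczyjew_eq {σ : M → E} (h : IsLocalSection m EE π U σ) :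
    IsEulerLagrange 𝓛 U σ ↔ ∀ x ∈ U, tulczyjew η (jetMom (legJet η 𝓛 σ) x) =
      dLagrangian η 𝓛 (jet m (Base n) EE π σ x) := by
  have key : ∀ (c : FiberedChart m (Base n) EE π), ∀ x ∈ U, σ x ∈ c.tot.source →
      (tulczyjew η (jetMom (legJet η 𝓛 σ) x) = dLagrangian η 𝓛 (jet m (Base n) EE π σ x) ↔
        ∀ α, c.dLdu 𝓛 α (c.coordJet σ (c.base x)) - ∑ i : Fin m,
          fderiv ℝ (fun y => c.dLdv 𝓛 α i (c.coordJet σ y)) (c.base x) (ebasis i) = 0) := by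
    intro c x hx hs
    -- The chart covers only part of the section; since all conditions are local, the section is
    -- restricted to the points over the chart domain.
    have h' := h.inter_preimage c.tot.open_source
    have hτ := h'.legJet η h𝓛
    have hx' : x ∈ U ∩ σ ⁻¹' c.tot.source := ⟨hx, hs⟩
    have e : j1nu m (Base n) EE π (jetMom (legJet η 𝓛 σ) x) = jet m (Base n) EE π σ x :=
      j1nu_jetMom hτ hx'
    rw [← e]
    exact (c.tulczyjew_eq_dLagrangian_iff η h𝓛 (z := jetMom (legJet η 𝓛 σ) x) hs).trans
      (c.elEquations_jetMom_eq_zero_iff hτ (fun _ hy => hy.2)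
        (fun _ hy => c.mom_formCoord_legJet η h𝓛 h' hy hy.2) hx')
  -- The Tulczyjew side involves no choice of chart: one chart around each point yields it, and it
  -- yields the equations in every chart.
  constructor
  · intro hEL x hx
    obtain ⟨c, hc⟩ := exists_fiberedChart m (Base n) EE π (σ x)
    exact (key c x hx hc).2 (hEL c x hx hc)
  · intro hA c x hx hs
    exact (key c x hx hs).1 (hA x hx)

/-- The sections whose first jets take their values in `S_𝓛` are the solutions of the
Euler-Lagrange equations, lifted by the Legendre transform up to a multiple of the volume form. -/
lemma jetMom_mem_lagrangianSet_iff
    (h : IsLocalSection m (HModel m (Base n) m) (formProj m (Base n) EE π m) U τ) :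
    (∀ x ∈ U, jetMom τ x ∈ lagrangianSet η 𝓛) ↔ IsEulerLagrange 𝓛 U (fun x => (τ x).pt) ∧
      ∀ x ∈ U, ∃ t : ℝ, τ x = (legJet η 𝓛 (fun y => (τ y).pt) x).addVol η t := by
  have hmem : ∀ (c : FiberedChart m (Base n) EE π) (x : M), (τ x).pt ∈ c.tot.source →
      (jetMom τ x ∈ lagrangianSet η 𝓛 ↔ c.elEquations 𝓛 (jetMom τ x) = 0) := fun c x hs =>
    (mem_lagrangianSet_iff η).trans
      (c.tulczyjew_eq_dLagrangian_iff η h𝓛 (z := jetMom τ x) hs)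
  have hres : ∀ c : FiberedChart m (Base n) EE π,
      IsLocalSection m (HModel m (Base n) m) (formProj m (Base n) EE π m)
        (U ∩ τ ⁻¹' (c.forms m).tot.source) τ :=
    fun c => h.inter_preimage (c.forms m).tot.open_source
  constructor
  · intro hS
    -- The first half of the equations fixes the momenta at every point of `U`. This makes the
    -- divergence in the second half that of the Legendre momenta, and it yields the multiple of
    -- `η`.
    have hmom : ∀ (c : FiberedChart m (Base n) EE π), ∀ x ∈ U, (τ x).pt ∈ c.tot.source →
        ∀ i α, HFib.mom (c.formCoord (τ x)).2.2 i (ebasis α) =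
          c.dLdv 𝓛 α i (c.coordJet (fun x => (τ x).pt) (c.base x)) := by
      intro c x hx hs i α
      have h0 := (hmem c x hs).1 (hS x hx)
      rw [c.elEquations_jetMom h hx hs] at h0
      exact sub_eq_zero.1 (congrFun (congrFun (congrArg Prod.fst h0) i) α)
    refine ⟨fun c x hx hs => ?_, fun x hx => ?_⟩
    · exact (c.elEquations_jetMom_eq_zero_iff (hres c) (fun _ hy => hy.2)
        (fun y hy => hmom c y hy.1 hy.2) ⟨hx, hs⟩).1 ((hmem c x hs).1 (hS x hx))
    · obtain ⟨c, hc⟩ := exists_fiberedChart m (Base n) EE π (τ x).pt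
      exact (c.mom_eq_iff_exists_addVol η h𝓛 h hx hc).1 (hmom c x hx hc)
  · rintro ⟨hEL, ht⟩ x hx
    obtain ⟨c, hc⟩ := exists_fiberedChart m (Base n) EE π (τ x).pt
    exact (hmem c x hc).2 ((c.elEquations_jetMom_eq_zero_iff (hres c) (fun _ hy => hy.2)
      (fun y hy => (c.mom_eq_iff_exists_addVol η h𝓛 h hy.1 hy.2).2 (ht y hy.1)) ⟨hx, hc⟩).2
        (hEL c x hx hc))

end EulerLagrangeSections

end

end Tulczyjew

theorem mainTheorem1 (m n : ℕ) (hm : 1 ≤ m)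
    {M E : Type*}
    [TopologicalSpace M] [ChartedSpace (Base m) M] [IsManifold 𝓘(ℝ, Base m) ∞ M]
    [TopologicalSpace E] [ChartedSpace (Base (m + n)) E] [IsManifold 𝓘(ℝ, Base (m + n)) ∞ E]
    (π : E → M) [IsFibration m (Base n) (Base (m + n)) π]
    (η : VolumeForm m M) (𝓛 : LagrangianDensity m (Base n) (Base (m + n)) π)
    (h𝓛 : ContMDiff 𝓘(ℝ, JModel m (Base n)) 𝓘(ℝ, ℝ) ∞ (lagrangianFunction η 𝓛)) :
    (∀ (U : Set M) (σ : M → E), IsLocalSection m (Base (m + n)) π U σ →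
      (IsEulerLagrange 𝓛 U σ ↔
        ∀ x ∈ U, tulczyjew η (jetMom (legJet η 𝓛 σ) x) =
          dLagrangian η 𝓛 (jet m (Base n) (Base (m + n)) π σ x))) ∧
    IsLagrangianSubmanifold (JModel m (Base n × HFib m (Base n) m))
      (premultisymplecticForm (F := Base n) (EE := Base (m + n)) (π := π) η) (m + 1)
      (lagrangianSet η 𝓛) ∧
    (∀ c : FiberedChart m (Base n) (Base (m + n)) π,
      IsLocalEquations (JModel m (Base n × HFib m (Base n) m))
        {z : JMom m (Base n) (Base (m + n)) π | z.pt.pt ∈ c.tot.source}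
        (c.elEquations 𝓛) (lagrangianSet η 𝓛)) ∧
    (∀ (U : Set M) (τ : M → HForm m (Base n) (Base (m + n)) π m),
      IsLocalSection m (HModel m (Base n) m) (formProj m (Base n) (Base (m + n)) π m) U τ →
      ((∀ x ∈ U, jetMom τ x ∈ lagrangianSet η 𝓛) ↔
        IsEulerLagrange 𝓛 U (fun x => (τ x).pt) ∧
        ∀ x ∈ U, ∃ t : ℝ, τ x = (legJet η 𝓛 (fun y => (τ y).pt) x).addVol η t)) :=
  ⟨fun _ _ hσ => isEulerLagrange_iff_tulczyjew_eq η h𝓛 hσ,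
    isLagrangianSubmanifold_lagrangianSet η h𝓛 hm,
    fun c => c.isLocalEquations_elEquations η h𝓛 hm,
    fun _ _ hτ => jetMom_mem_lagrangianSet_iff η h𝓛 hτ⟩
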